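/- **Setting.** Let $\mathcal D\subset\mathbb R^2$ be a bounded simply connected domain with smooth boundary, $\mathcal B$ a smooth simply connected domain with $\overline{\mathcal B}\subset\mathcal D$, and $\mathcal A:=\mathcal D\setminus\overline{\mathcal B}$. Let $V:\mathbb R^2\to\mathbb R^2$ be locally Lipschitz, $\operatorname{curl}V=\partial_1V_2-\partial_2V_1$, $\nabla^\perp=(-\partial_2,\partial_1)$, and $j(u)=\operatorname{Im}(\bar u\nabla u)$. Let $\zeta$ be the solution of $-\Delta\zeta=\operatorname{curl}V$ in $\mathcal A$, $\zeta=0$ on $\partial\mathcal A$, and assume $\zeta_{\max}:=\max_{\overline{\mathcal A}}\zeta>0$. Let $\omega:(0,\infty)\to(0,\infty)$ satisfy $\omega(\varepsilon)\to+\infty$ and $\omega(\varepsilon)/|\ln\varepsilon|\to0$ as $\varepsilon\to0^+$, and put $\Omega_\varepsilon:=\frac{|\ln\varepsilon|}{2\zeta_{\max}}+\omega(\varepsilon)$. For $u\in H^1(\mathcal A;\mathbb C)$ and, respectively, $u\in H^1(\mathcal A;\mathbb S^1)$, let $$J_\varepsilon(u)=\int_{\mathcal A}\Big\{\tfrac12|\nabla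 u|^2+\tfrac1{4\varepsilon^2}(|u|^2-1)^2-\Omega_\varepsilon V\cdot j(u)\Big\}dx,\qquad \mathcal H_\Omega(u)=\int_{\mathcal A}\Big\{\tfrac12|\nabla u|^2-\Omega V\cdot j(u)\Big\}dx,$$ and let $\min\mathcal H_\Omega$ be the minimum of $\mathcal H_\Omega$ over $H^1(\mathcal A;\mathbb S^1)$. Let $\varepsilon_n\to0^+$ be an arbitrary sequence, $\omega_n:=\omega(\varepsilon_n)$, $\Omega_n:=\Omega_{\varepsilon_n}$. For each $n$ let $u_n^\star$ be a minimizer of $\mathcal H_{\Omega_n}$ over $H^1(\mathcal A;\mathbb S^1)$, let $d_n\in\mathbb Z$ be its degree (winding number around $\mathcal B$), and let $\Phi_n$ be the solution of $$-\Delta\Phi_n=\Omega_n\operatorname{curl}V\ \text{in }\mathcal A,\quad \Phi_n=0\ \text{on }\partial\mathcal D,\quad \Phi_n=\text{const.}\ \text{on }\partial\mathcal B,\quad \int_{\partial\mathcal B}\frac{\partial\Phi_n}{\partial\nu}=2\pi d_n-\Omega_n\int_{\partial\mathcal B}V\cdot\tau ,$$ with $\nu$ the outward unit normal of $\mathcal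 B$ and $\tau=\nu^\perp$ the counterclockwise tangent; the degree and the last condition are understood in the weak sense, by testing against cut-off functions (the degree of $u\in H^1(\mathcal A;\mathbb S^1)$ is $d$ if $\int_{\partial\mathcal B}j(u)\cdot\tau=2\pi d$). For $v\in H^1(\mathcal A;\mathbb C)$ put $$\overline F_{\varepsilon_n}(v)=\omega_n^{-2}\int_{\mathcal A}\Big\{\tfrac12|\nabla v|^2+\tfrac1{4\varepsilon_n^2}(1-|v|^2)^2+\nabla^\perp\Phi_n\cdot j(v)\Big\}dx .$$ **Proposition (Energy decomposition).** Let $\{u_n\}_{n\in\mathbb N}\subset H^1(\mathcal A;\mathbb C)$ and $v_n:=\overline{u_n^\star}\,u_n$. Then $v_n\in H^1(\mathcal A;\mathbb C)$ for every $n$, and $$\sup_n\Omega_n^{-2}J_{\varepsilon_n}(u_n)<+\infty\quad\Longleftrightarrow\quad \sup_n\Omega_n^{-2}\omega_n^2\overline F_{\varepsilon_n}(v_n)<+\infty .$$ Moreover, if one of these two conditions holds, then $$J_{\varepsilon_n}(u_n)=\min\mathcal H_{\Omega_n}+\omega_n^2\overline F_{\varepsilon_n}(v_n)+o(1)\qquad\text{as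 }n\to+\infty .$$ -/

import Mathlib

open MeasureTheory Set Filter Topology
open scoped ComplexConjugate

noncomputable section

/-- The Euclidean plane. -/
abbrev Plane := EuclideanSpace ℝ (Fin 2)

/-! ### Annular domains -/

/-- The boundary of `U` is smooth: near each of its points `U` is the sublevel set `{ρ < 0}` of a
smooth function without critical points. -/
def HasSmoothBoundary (U : Set Plane) : Prop :=
  ∀ x ∈ frontier U, ∃ N : Set Plane, IsOpen N ∧ x ∈ N ∧ ∃ ρ : Plane → ℝ,
    ContDiffOn ℝ (⊤ : ℕ∞) ρ N ∧ (∀ y ∈ N, fderiv ℝ ρ y ≠ 0) ∧ ∀ y ∈ N, (y ∈ U ↔ ρ y < 0)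

/-- `D` and `B` are smooth bounded simply connected domains, `B` compactly contained in `D`. -/
structure IsAnnularPair (D B : Set Plane) : Prop where
  isOpen_outer : IsOpen D
  isBounded_outer : Bornology.IsBounded D
  simplyConnected_outer : IsSimplyConnected D
  smooth_outer : HasSmoothBoundary D
  isOpen_hole : IsOpen B
  simplyConnected_hole : IsSimplyConnected B
  smooth_hole : HasSmoothBoundary B
  closure_hole_subset : closure B ⊆ D

/-- The topological annulus with outer domain `D` and hole `B`. -/
def annulus (D B : Set Plane) : Set Plane := D \ closure B

/-! ### Weak derivatives and `H¹` -/

section Sobolev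

variable {F : Type*} [NormedAddCommGroup F] [NormedSpace ℝ F]

/-- The classical `i`-th partial derivative. -/
def classicalPartial (i : Fin 2) (f : Plane → F) (x : Plane) : F :=
  fderiv ℝ f x (EuclideanSpace.single i 1)

/-- `φ ∈ C_c^∞(U)`. -/
def IsTestFunction (U : Set Plane) (φ : Plane → ℝ) : Prop :=
  ContDiff ℝ (⊤ : ℕ∞) φ ∧ HasCompactSupport φ ∧ tsupport φ ⊆ U

/-- `g` is the `i`-th weak partial derivative of `u` in `U`. -/
def IsWeakPartial (U : Set Plane) (i : Fin 2) (u g : Plane → F) : Prop :=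
  LocallyIntegrableOn u U ∧ LocallyIntegrableOn g U ∧
    ∀ φ : Plane → ℝ, IsTestFunction U φ →
      ∫ x in U, classicalPartial i φ x • u x = - ∫ x in U, φ x • g x

/-- `u ∈ H¹(U; F)` (only the values of `u` in `U` matter). -/
def MemH1 (U : Set Plane) (u : Plane → F) : Prop :=
  MemLp u 2 (volume.restrict U) ∧
    ∀ i, ∃ g : Plane → F, IsWeakPartial U i u g ∧ MemLp g 2 (volume.restrict U)

open Classical in
/-- The weak gradient of `u` in the open set `U`; its components are unique up to null sets where
they exist. -/
def weakGrad (U : Set Plane) (u : Plane → F) (x : Plane) (i : Fin 2) : F :=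
  if h : ∃ g : Plane → F, IsWeakPartial U i u g then h.choose x else 0

end Sobolev

/-- The rotated vector `a^⊥ = (-a₂, a₁)`. -/
def rot (a : Fin 2 → ℝ) : Fin 2 → ℝ := ![- a 1, a 0]

/-- `curl V = ∂₁V₂ - ∂₂V₁`, defined almost everywhere if `V` is locally Lipschitz. -/
def curl (V : Plane → Plane) (x : Plane) : ℝ :=
  classicalPartial 0 V x 1 - classicalPartial 1 V x 0

/-- The pre-Jacobian `j(u) = (iu, ∇u) = Im (ū ∇u)` of `u` in `U`. -/
def preJacobian (U : Set Plane) (u : Plane → ℂ) (x : Plane) (i : Fin 2) : ℝ :=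
  (conj (u x) * weakGrad U u x i).im

/-! ### The energies -/

/-- The energy `J_ε`, with angular speed `Ω`. -/
def energyJ (A : Set Plane) (V : Plane → Plane) (ε Ω : ℝ) (u : Plane → ℂ) : ℝ :=
  ∫ x in A, ((1 / 2) * ∑ i, ‖weakGrad A u x i‖ ^ 2 + (1 / (4 * ε ^ 2)) * (‖u x‖ ^ 2 - 1) ^ 2
    - Ω * ∑ i, V x i * preJacobian A u x i)

/-- The energy `H_Ω` of circle-valued maps. -/
def energyH (A : Set Plane) (V : Plane → Plane) (Ω : ℝ) (u : Plane → ℂ) : ℝ :=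
  ∫ x in A, ((1 / 2) * ∑ i, ‖weakGrad A u x i‖ ^ 2 - Ω * ∑ i, V x i * preJacobian A u x i)

/-- The reduced functional `F̄_ε` of a potential `Φ`, with `w` for `ω(ε)`. -/
def reducedF (A : Set Plane) (Φ : Plane → ℝ) (ε w : ℝ) (v : Plane → ℂ) : ℝ :=
  (w ^ 2)⁻¹ * ∫ x in A, ((1 / 2) * ∑ i, ‖weakGrad A v x i‖ ^ 2
    + (1 / (4 * ε ^ 2)) * (1 - ‖v x‖ ^ 2) ^ 2
    + ∑ i, rot (weakGrad A Φ x) i * preJacobian A v x i)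

/-- The class `H¹(A; 𝕊¹)`. -/
def circleMaps (A : Set Plane) : Set (Plane → ℂ) :=
  {u | MemH1 A u ∧ ∀ᵐ x ∂(volume.restrict A), ‖u x‖ = 1}

/-- `min H_Ω` over `H¹(A; 𝕊¹)`. -/
def minH (A : Set Plane) (V : Plane → Plane) (Ω : ℝ) : ℝ :=
  sInf (energyH A V Ω '' circleMaps A)

/-- `u` minimizes `H_Ω` over `H¹(A; 𝕊¹)`. -/
def IsVortexlessMinimizer (A : Set Plane) (V : Plane → Plane) (Ω : ℝ) (u : Plane → ℂ) : Prop :=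
  u ∈ circleMaps A ∧ ∀ w ∈ circleMaps A, energyH A V Ω u ≤ energyH A V Ω w

/-! ### Circulation around the hole, degree, potentials -/

/-- `c` is the (counterclockwise) circulation `∮_{∂B} X·τ` around the hole of the square
integrable curl-free field `X` on the annulus. As such an `X` need not have a restriction to
curves, the integral is understood by testing: if `X` is regular, then Green's formula gives
`∮_{∂B} X·τ = - ∫_{D \ B} X·∇^⊥η` for each cut-off `η ∈ C_c^∞(D)` that is `1` near the
closure of `B`. -/
def HasCirculation (D B : Set Plane) (X : Plane → Fin 2 → ℝ) (c : ℝ) : Prop :=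
  ∀ η : Plane → ℝ, IsTestFunction D η → (∀ᶠ x in 𝓝ˢ (closure B), η x = 1) →
    - ∫ x in annulus D B, ∑ i, X x i * rot (fun k => classicalPartial k η x) i = c

/-- The circle-valued map `u` has degree (winding number around the hole) `d`, that is,
`∮_{∂B} j(u)·τ = 2πd`. -/
def HasDegree (D B : Set Plane) (u : Plane → ℂ) (d : ℤ) : Prop :=
  HasCirculation D B (preJacobian (annulus D B) u) (2 * Real.pi * d)

/-- `ψ ∈ H¹(U)` is a weak solution of `-Δψ = f` in `U`. -/
def IsWeakPoissonSolution (U : Set Plane) (f : Plane → ℝ) (ψ : Plane → ℝ) : Prop :=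
  MemH1 U ψ ∧ ∀ φ : Plane → ℝ, IsTestFunction U φ →
    ∫ x in U, ∑ i, weakGrad U ψ x i * classicalPartial i φ x = ∫ x in U, f x * φ x

/-- `ζ` solves `-Δζ = curl V` in the annulus, `ζ = 0` on its boundary. -/
structure IsDirichletPotential (D B : Set Plane) (V : Plane → Plane) (ζ : Plane → ℝ) : Prop where
  equation : IsWeakPoissonSolution (annulus D B) (curl V) ζ
  continuousOn : ContinuousOn ζ (closure (annulus D B))
  boundary : ∀ x ∈ frontier (annulus D B), ζ x = 0

/-- `Φ` solves `-ΔΦ = Ω curl V` in the annulus, `Φ = 0` on `∂D`, `Φ = const` on `∂B`, and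
`∮_{∂B} ∂Φ/∂ν = 2πd - Ω ∮_{∂B} V·τ`. As `∂Φ/∂ν = ∇^⊥Φ·τ`, the last condition prescribes the
circulation of `∇^⊥Φ + Ω V`, a curl-free field by the first one. -/
structure IsPhasePotential (D B : Set Plane) (V : Plane → Plane) (Ω : ℝ) (d : ℤ)
    (Φ : Plane → ℝ) : Prop where
  equation : IsWeakPoissonSolution (annulus D B) (fun x => Ω * curl V x) Φ
  continuousOn : ContinuousOn Φ (closure (annulus D B))
  outer_boundary : ∀ x ∈ frontier D, Φ x = 0
  hole_boundary : ∃ c : ℝ, ∀ x ∈ frontier B, Φ x = c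
  flux : HasCirculation D B
    (fun x i => rot (weakGrad (annulus D B) Φ x) i + Ω * V x i) (2 * Real.pi * d)

/-- The angular speed `Ω_ε = |ln ε| / (2 ζ_max) + ω(ε)`. -/
def angularSpeed (ζmax : ℝ) (ω : ℝ → ℝ) (ε : ℝ) : ℝ := |Real.log ε| / (2 * ζmax) + ω ε

end

/-! Write `u = u* v`, where `|u*| = 1`, and let `j* = j(u*)`. Expanding `|∇v|²` and `j(v)` in terms
of `u` and `j*` is algebra. Once `j* = ∇^⊥Φ + Ω V` is known, the cross terms `j*·j(u)` cancel and an
exact identity remains: `J(u) = min H + ω² F̄(v) + ∫ h (|u|² - 1)`, with `h = ½|j*|² - Ω V·j*` the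
energy density of the minimizer. If moreover `|j*| ≤ C Ω` almost everywhere, then `|h| ≤ C Ω²`, and
Young's inequality against the potential energy `P = ∫ (|u|² - 1)² / (4ε²)` bounds the last integral
by `C (ε Ω³ + ε Ω P)`. An upper bound of order `Ω²` on `J` or on `ω² F̄` forces `P = O(Ω²)`, because
`ε Ω → 0` allows `P` to be absorbed. As `Ω = O(|ln ε|)`, the remainder is `O(ε Ω³) = o(1)`, and
since `min H = O(Ω²)` the two boundedness conditions are equivalent. This is carried by
`exists_energy_decomposition` and `bddAbove_iff_and_tendsto`.

The two facts on `j*` are in `exists_preJacobian_bound`. For the identity, consider `X = j* - ∇^⊥Φ -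
Ω V`. It is orthogonal to gradients: for `j* - Ω V` this is the Euler-Lagrange equation under phase
rotations `e^{itψ} u*`, for `∇^⊥Φ` it holds because `Φ` is constant on each boundary component. It
is also orthogonal to compactly supported divergence-free fields, since these are rotated gradients
of stream functions constant near the hole (`IsAnnularPair.exists_streamFunction`) and the two
circulations agree. A de Rham argument (`exists_primitive`) makes `X` a gradient, hence orthogonal
to itself, hence zero.

For the bound, let `c` be the value of `Φ` on the boundary of the hole. Subtracting `c` times a
cutoff leaves a Poisson problem with zero boundary values and source `O(Ω + |c|)`. Barriers built on
exterior balls give linear decay at the boundary, and a representation formula turns this into a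
gradient bound up to the boundary (`HasSmoothBoundary.exists_poisson_bound`). Finally `c = O(Ω)`:
pair `∇Φ` with a radial field centred in the hole and compare the energy of `u*` with that of a
constant map. The same bound on `∇u*` puts `v` in `H¹`.

The potential term is integrable because `H¹ ⊂ L⁴`, which is proved by Gagliardo's slicing argument
in interior cones (`MemH1.integrable_norm_pow_four`). -/

noncomputable section

/-! ### Classical partial derivatives and test functions -/

section WeakDerivatives

variable {F : Type*} [NormedAddCommGroup F] [NormedSpace ℝ F]

/-- Off its support the product vanishes near the point, so smoothness of the factors matters in `U`
only. This turns cutoffs times functions that are smooth only in `U` into test functions. -/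
lemma contDiff_mul_of_tsupport_subset {G : Type*} [NormedAddCommGroup G] [NormedSpace ℝ G]
    {𝕜 : Type*} [NormedField 𝕜] [NormedAlgebra ℝ 𝕜] [NormedSpace 𝕜 G] [IsScalarTower ℝ 𝕜 G]
    {U : Set Plane} (hU : IsOpen U) {n : WithTop ℕ∞} {φ : Plane → 𝕜} {a : Plane → G}
    (hφ : ContDiffOn ℝ n φ U) (hs : tsupport φ ⊆ U) (ha : ContDiffOn ℝ n a U) :
    ContDiff ℝ n (fun x => φ x • a x) := by
  refine contDiff_iff_contDiffAt.2 fun x => ?_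
  by_cases hx : x ∈ tsupport fun x => φ x • a x
  swap
  · exact contDiffAt_const.congr_of_eventuallyEq (notMem_tsupport_iff_eventuallyEq.1 hx)
  have hxU : x ∈ U := hs (tsupport_smul_subset_left φ a hx)
  exact (hφ.contDiffAt (hU.mem_nhds hxU)).smul (ha.contDiffAt (hU.mem_nhds hxU))

lemma ContDiff.classicalPartial {m n : WithTop ℕ∞} {f : Plane → F} (hf : ContDiff ℝ n f)
    (hmn : m + 1 ≤ n) (i : Fin 2) : ContDiff ℝ m (classicalPartial i f) :=
  (hf.fderiv_right hmn).clm_apply contDiff_const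

lemma ContDiffOn.classicalPartial {U : Set Plane} (hU : IsOpen U) {m n : WithTop ℕ∞}
    {f : Plane → F} (hf : ContDiffOn ℝ n f U) (hmn : m + 1 ≤ n) (i : Fin 2) :
    ContDiffOn ℝ m (classicalPartial i f) U :=
  (hf.fderiv_of_isOpen hU hmn).clm_apply contDiffOn_const

lemma tsupport_classicalPartial_subset (i : Fin 2) (f : Plane → F) :
    tsupport (classicalPartial i f) ⊆ tsupport f := by
  refine closure_minimal (fun x hx => ?_) (isClosed_tsupport f)
  by_contra h
  apply hx
  have : f =ᶠ[𝓝 x] 0 := notMem_tsupport_iff_eventuallyEq.1 h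
  simp [classicalPartial, this.fderiv_eq]

lemma HasCompactSupport.classicalPartial {f : Plane → F} (hf : HasCompactSupport f) (i : Fin 2) :
    HasCompactSupport (classicalPartial i f) :=
  hf.of_isClosed_subset (isClosed_tsupport _) (tsupport_classicalPartial_subset i f)

lemma IsTestFunction.classicalPartial {U : Set Plane} {φ : Plane → ℝ} (h : IsTestFunction U φ)
    (i : Fin 2) : IsTestFunction U (classicalPartial i φ) :=
  ⟨h.1.classicalPartial (by simp) i, h.2.1.classicalPartial i,
    (tsupport_classicalPartial_subset i φ).trans h.2.2⟩

lemma IsTestFunction.mul_left {U : Set Plane} (hU : IsOpen U) {φ a : Plane → ℝ}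
    (h : IsTestFunction U φ) (ha : ContDiffOn ℝ (⊤ : ℕ∞) a U) :
    IsTestFunction U (fun x => φ x * a x) :=
  ⟨contDiff_mul_of_tsupport_subset hU h.1.contDiffOn h.2.2 ha, h.2.1.mul_right,
    (tsupport_smul_subset_left φ a).trans h.2.2⟩

lemma IsTestFunction.add {U : Set Plane} {φ ψ : Plane → ℝ}
    (h : IsTestFunction U φ) (h' : IsTestFunction U ψ) :
    IsTestFunction U (fun x => φ x + ψ x) :=
  ⟨h.1.add h'.1, h.2.1.add h'.2.1, (tsupport_add φ ψ).trans (union_subset h.2.2 h'.2.2)⟩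

lemma classicalPartial_eq_zero_of_eventuallyEq {f : Plane → F} {x : Plane} {c : F} (i : Fin 2)
    (h : f =ᶠ[𝓝 x] fun _ => c) : classicalPartial i f x = 0 := by
  simp [classicalPartial, h.fderiv_eq]

lemma classicalPartial_congr {f g : Plane → F} {x : Plane} (i : Fin 2) (h : f =ᶠ[𝓝 x] g) :
    classicalPartial i f x = classicalPartial i g x := by
  simp [classicalPartial, h.fderiv_eq]

lemma classicalPartial_smul {𝕜 : Type*} [NormedField 𝕜] [NormedAlgebra ℝ 𝕜] [NormedSpace 𝕜 F]
    [IsScalarTower ℝ 𝕜 F] {φ : Plane → 𝕜} {a : Plane → F} {x : Plane}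
    (hφ : DifferentiableAt ℝ φ x) (ha : DifferentiableAt ℝ a x) (i : Fin 2) :
    classicalPartial i (fun y => φ y • a y) x
      = φ x • classicalPartial i a x + classicalPartial i φ x • a x := by
  simp [classicalPartial, fderiv_fun_smul hφ ha]

lemma classicalPartial_add {f g : Plane → F} {x : Plane}
    (hf : DifferentiableAt ℝ f x) (hg : DifferentiableAt ℝ g x) (i : Fin 2) :
    classicalPartial i (fun y => f y + g y) x
      = classicalPartial i f x + classicalPartial i g x := by
  simp [classicalPartial, fderiv_fun_add hf hg]

lemma classicalPartial_sub {f g : Plane → F} {x : Plane}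
    (hf : DifferentiableAt ℝ f x) (hg : DifferentiableAt ℝ g x) (i : Fin 2) :
    classicalPartial i (fun y => f y - g y) x
      = classicalPartial i f x - classicalPartial i g x := by
  simp [classicalPartial, fderiv_fun_sub hf hg]

lemma classicalPartial_comm {f : Plane → F} {x : Plane} (hf : ContDiffAt ℝ 2 f x) (i j : Fin 2) :
    classicalPartial i (classicalPartial j f) x = classicalPartial j (classicalPartial i f) x := by
  have hd : DifferentiableAt ℝ (fderiv ℝ f) x :=
    (hf.fderiv_right (m := 1) (by norm_num)).differentiableAt (by norm_num)
  have key : ∀ k l : Fin 2, classicalPartial k (classicalPartial l f) x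
      = fderiv ℝ (fderiv ℝ f) x (EuclideanSpace.single k 1) (EuclideanSpace.single l 1) := by
    intro k l
    have : HasFDerivAt (fun y => fderiv ℝ f y (EuclideanSpace.single l 1))
        ((fderiv ℝ (fderiv ℝ f) x).flip (EuclideanSpace.single l 1)) x := by
      simpa using hd.hasFDerivAt.clm_apply
        (hasFDerivAt_const (EuclideanSpace.single l (1 : ℝ) : Plane) x)
    change fderiv ℝ (fun y => fderiv ℝ f y (EuclideanSpace.single l 1)) x _ = _
    rw [this.fderiv]; rfl
  rw [key, key]
  exact (hf.isSymmSndFDerivAt (by simp)) _ _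

lemma integral_classicalPartial_eq_zero {f : Plane → F} (hf : ContDiff ℝ 1 f)
    (hc : HasCompactSupport f) (i : Fin 2) : ∫ x, classicalPartial i f x = 0 := by
  have h1 : Integrable (classicalPartial i f) :=
    (hf.classicalPartial (m := 0) (by simp) i).continuous.integrable_of_hasCompactSupport
      (hc.classicalPartial i)
  have h2 : Integrable f := hf.continuous.integrable_of_hasCompactSupport hc
  have := integral_smul_fderiv_eq_neg_fderiv_smul_of_integrable (μ := (volume : Measure Plane))
    (f := fun _ => (1 : ℝ)) (g := f) (v := EuclideanSpace.single i 1)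
    (by simp) (by simp only [one_smul]; exact h1) (by simpa using h2)
    (fun x _ => differentiableAt_const _) (fun x _ => (hf.differentiable (by norm_num)) x)
  simpa [classicalPartial] using this

lemma setIntegral_eq_of_tsupport_subset {U : Set Plane} {f : Plane → F} (h : tsupport f ⊆ U) :
    ∫ x in U, f x = ∫ x, f x :=
  setIntegral_eq_integral_of_forall_compl_eq_zero fun x hx => by
    by_contra h0
    exact hx (h (subset_tsupport f h0))

/-- Integration by parts of smooth functions in an open set. -/
lemma setIntegral_classicalPartial_smul {𝕜 : Type*} [NormedField 𝕜] [NormedAlgebra ℝ 𝕜]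
    [NormedSpace 𝕜 F] [IsScalarTower ℝ 𝕜 F] {U : Set Plane} (hU : IsOpen U)
    {φ : Plane → 𝕜} {a : Plane → F} (hφ : ContDiff ℝ 1 φ) (hc : HasCompactSupport φ)
    (hs : tsupport φ ⊆ U) (ha : ContDiffOn ℝ 1 a U) (i : Fin 2) :
    ∫ x in U, classicalPartial i φ x • a x = - ∫ x in U, φ x • classicalPartial i a x := by
  have h1 : ContDiff ℝ 1 (fun x => φ x • a x) :=
    contDiff_mul_of_tsupport_subset hU hφ.contDiffOn hs ha
  have hc1 : HasCompactSupport (fun x => φ x • a x) := hc.smul_right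
  have c1 : Continuous (fun x => φ x • classicalPartial i a x) := by
    have := contDiff_mul_of_tsupport_subset hU (n := 0) (hφ.of_le (by simp)).contDiffOn hs
      (ha.classicalPartial hU (by simp) i)
    exact this.continuous
  have c2 : Continuous (fun x => classicalPartial i φ x • a x) := by
    have := contDiff_mul_of_tsupport_subset hU (n := 0)
      (hφ.classicalPartial (by simp) i).contDiffOn
      ((tsupport_classicalPartial_subset i φ).trans hs) (ha.of_le (by simp))
    exact this.continuous
  have i1 : Integrable (fun x => φ x • classicalPartial i a x) :=
    c1.integrable_of_hasCompactSupport hc.smul_right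
  have i2 : Integrable (fun x => classicalPartial i φ x • a x) :=
    c2.integrable_of_hasCompactSupport (hc.classicalPartial i).smul_right
  have h0 := integral_classicalPartial_eq_zero h1 hc1 i
  have hT : tsupport (fun x => φ x • a x) ⊆ U := (tsupport_smul_subset_left φ a).trans hs
  rw [← setIntegral_eq_of_tsupport_subset ((tsupport_classicalPartial_subset i _).trans hT)] at h0
  have : ∫ x in U, classicalPartial i (fun x => φ x • a x) x
      = ∫ x in U, (φ x • classicalPartial i a x + classicalPartial i φ x • a x) := by
    refine setIntegral_congr_fun hU.measurableSet fun x hx => ?_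
    exact classicalPartial_smul (hφ.differentiable (by norm_num) x)
      ((ha.contDiffAt (hU.mem_nhds hx)).differentiableAt (by norm_num)) i
  rw [this, integral_add i1.integrableOn i2.integrableOn] at h0
  exact eq_neg_of_add_eq_zero_right h0

/-! ### Weak partial derivatives -/

lemma ContDiffOn.isWeakPartial {U : Set Plane} (hU : IsOpen U) {a : Plane → F}
    (ha : ContDiffOn ℝ 1 a U) (i : Fin 2) : IsWeakPartial U i a (_root_.classicalPartial i a) := by
  refine ⟨ha.continuousOn.locallyIntegrableOn hU.measurableSet,
    (ha.classicalPartial (m := 0) hU (by simp) i).continuousOn.locallyIntegrableOn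
      hU.measurableSet, fun φ hφ => ?_⟩
  exact setIntegral_classicalPartial_smul hU (hφ.1.of_le (by exact_mod_cast le_top)) hφ.2.1
    hφ.2.2 ha i

lemma IsTestFunction.integrableOn_smul {U : Set Plane} {φ : Plane → ℝ}
    (hφ : IsTestFunction U φ) {u : Plane → F} (hu : LocallyIntegrableOn u U) :
    IntegrableOn (fun x => φ x • u x) U := by
  have hK : IntegrableOn u (tsupport φ) := hu.integrableOn_compact_subset hφ.2.2 hφ.2.1
  have : IntegrableOn (fun x => φ x • u x) (tsupport φ) :=
    hK.continuousOn_smul hφ.1.continuous.continuousOn hφ.2.1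
  exact ((integrableOn_iff_integrable_of_support_subset fun x hx =>
    subset_tsupport φ fun h => hx (by simp [h])).1 this).integrableOn

/-- The fundamental lemma of the calculus of variations, applied to the difference. It makes
statements about `weakGrad`, which is a chosen representative, independent of the choice almost
everywhere. -/
lemma IsWeakPartial.ae_eq [CompleteSpace F] {U : Set Plane} (hU : IsOpen U) {i : Fin 2} {u g g' : Plane → F}
    (h : IsWeakPartial U i u g) (h' : IsWeakPartial U i u g') :
    g =ᵐ[volume.restrict U] g' := by
  have := hU.ae_eq_zero_of_integral_contDiff_smul_eq_zero (μ := volume)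
    (f := fun x => g x - g' x) (h.2.1.sub h'.2.1) (by
      intro φ h1 h2 h3
      have hφ : IsTestFunction U φ := ⟨h1, h2, h3⟩
      rw [← setIntegral_eq_of_tsupport_subset
        ((tsupport_smul_subset_left φ fun x => g x - g' x).trans h3)]
      simp only [smul_sub]
      rw [integral_sub (hφ.integrableOn_smul h.2.1) (hφ.integrableOn_smul h'.2.1)]
      have e1 := h.2.2 φ hφ
      have e2 := h'.2.2 φ hφ
      rw [e1, neg_inj] at e2
      rw [e2, sub_self])
  refine (ae_restrict_iff' hU.measurableSet).2 ?_
  filter_upwards [this] with x hx hxU using sub_eq_zero.1 (hx hxU)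

lemma IsWeakPartial.weakGrad {U : Set Plane} {i : Fin 2} {u g : Plane → F}
    (h : IsWeakPartial U i u g) : IsWeakPartial U i u (fun x => weakGrad U u x i) := by
  have hex : ∃ g : Plane → F, IsWeakPartial U i u g := ⟨g, h⟩
  have : (fun x => _root_.weakGrad U u x i) = hex.choose := by
    funext x; simp only [_root_.weakGrad, dif_pos hex]
  rw [this]; exact hex.choose_spec

lemma IsWeakPartial.weakGrad_ae_eq [CompleteSpace F] {U : Set Plane} (hU : IsOpen U) {i : Fin 2} {u g : Plane → F}
    (h : IsWeakPartial U i u g) :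
    (fun x => _root_.weakGrad U u x i) =ᵐ[volume.restrict U] g :=
  h.weakGrad.ae_eq hU h

lemma MemH1.isWeakPartial {U : Set Plane} {u : Plane → F} (h : MemH1 U u) (i : Fin 2) :
    IsWeakPartial U i u (fun x => weakGrad U u x i) :=
  let ⟨_, hg, _⟩ := h.2 i
  hg.weakGrad

lemma MemH1.memLp_weakGrad [CompleteSpace F] {U : Set Plane} (hU : IsOpen U) {u : Plane → F} (h : MemH1 U u)
    (i : Fin 2) : MemLp (fun x => weakGrad U u x i) 2 (volume.restrict U) :=
  let ⟨_, hg, hg2⟩ := h.2 i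
  hg2.ae_eq (hg.weakGrad_ae_eq hU).symm

/-- Needed for the product rule, where the test function is a cutoff times a mollified complex map.
Real and imaginary parts are tested separately. -/
lemma IsWeakPartial.integral_complex_test {U : Set Plane} {i : Fin 2} {u g : Plane → ℂ}
    (h : IsWeakPartial U i u g) {θ : Plane → ℂ} (h1 : ContDiff ℝ (⊤ : ℕ∞) θ)
    (h2 : HasCompactSupport θ) (h3 : tsupport θ ⊆ U) :
    ∫ x in U, classicalPartial i θ x * u x = - ∫ x in U, θ x * g x := by
  have hre : IsTestFunction U (fun x => (θ x).re) :=
    ⟨Complex.reCLM.contDiff.comp h1, h2.comp_left (g := Complex.re) rfl,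
      (tsupport_comp_subset (g := Complex.re) rfl θ).trans h3⟩
  have him : IsTestFunction U (fun x => (θ x).im) :=
    ⟨Complex.imCLM.contDiff.comp h1, h2.comp_left (g := Complex.im) rfl,
      (tsupport_comp_subset (g := Complex.im) rfl θ).trans h3⟩
  have dθ : Differentiable ℝ θ := h1.differentiable (by simp)
  have pre : ∀ x, classicalPartial i (fun y => (θ y).re) x = (classicalPartial i θ x).re := by
    intro x
    have := (Complex.reCLM.hasFDerivAt (x := θ x)).comp x (dθ x).hasFDerivAt
    simp only [classicalPartial]
    rw [show (fun y => (θ y).re) = Complex.reCLM ∘ θ from rfl, this.fderiv]; rfl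
  have pim : ∀ x, classicalPartial i (fun y => (θ y).im) x = (classicalPartial i θ x).im := by
    intro x
    have := (Complex.imCLM.hasFDerivAt (x := θ x)).comp x (dθ x).hasFDerivAt
    simp only [classicalPartial]
    rw [show (fun y => (θ y).im) = Complex.imCLM ∘ θ from rfl, this.fderiv]; rfl
  have e1 := h.2.2 _ hre
  have e2 := h.2.2 _ him
  have split : ∀ z w : ℂ, z * w = z.re • w + Complex.I * (z.im • w) := by
    intro z w
    conv_lhs => rw [← Complex.re_add_im z]
    simp only [Complex.real_smul]; ring
  have i1 := (hre.classicalPartial i).integrableOn_smul h.1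
  have i2 := (him.classicalPartial i).integrableOn_smul h.1
  have i3 := hre.integrableOn_smul h.2.1
  have i4 := him.integrableOn_smul h.2.1
  calc ∫ x in U, classicalPartial i θ x * u x
      = ∫ x in U, (classicalPartial i (fun y => (θ y).re) x • u x
        + Complex.I * (classicalPartial i (fun y => (θ y).im) x • u x)) := by
        refine integral_congr_ae (Eventually.of_forall fun x => ?_)
        simp only [pre, pim]; exact split _ _
    _ = - ∫ x in U, ((θ x).re • g x + Complex.I * ((θ x).im • g x)) := by
        rw [integral_add i1 (i2.const_mul _), integral_add i3 (i4.const_mul _),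
          integral_const_mul, integral_const_mul, e1, e2]
        ring
    _ = _ := by
        congr 1
        exact integral_congr_ae (Eventually.of_forall fun x => (split _ _).symm)

end WeakDerivatives
end

noncomputable section

/-! ### A radial mollifier -/

/-- A smooth step from `0` (for `t ≤ 1/4`) to `1` (for `t ≥ 1`). -/
def smoothStep (t : ℝ) : ℝ := Real.smoothTransition ((4 * t - 1) / 3)

lemma smoothStep_contDiff : ContDiff ℝ (⊤ : ℕ∞) smoothStep :=
  Real.smoothTransition.contDiff.comp
    (((contDiff_const.mul contDiff_id).sub contDiff_const).div_const 3)

lemma smoothStep_of_le {t : ℝ} (h : t ≤ 1 / 4) : smoothStep t = 0 :=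
  Real.smoothTransition.zero_of_nonpos (by linarith)

lemma smoothStep_of_ge {t : ℝ} (h : 1 ≤ t) : smoothStep t = 1 :=
  Real.smoothTransition.one_of_one_le (by linarith)

lemma smoothStep_nonneg (t : ℝ) : 0 ≤ smoothStep t := Real.smoothTransition.nonneg _
lemma smoothStep_le_one (t : ℝ) : smoothStep t ≤ 1 := Real.smoothTransition.le_one _

lemma smoothStep_monotone : Monotone smoothStep := fun a b h =>
  Real.smoothTransition.monotone (by linarith)

/-- The derivative of the smooth step. -/
def stepDeriv (t : ℝ) : ℝ := deriv smoothStep t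

lemma stepDeriv_contDiff : ContDiff ℝ (⊤ : ℕ∞) stepDeriv :=
  ((contDiff_infty_iff_deriv (f := smoothStep)).1 smoothStep_contDiff).2

lemma hasDerivAt_smoothStep (t : ℝ) : HasDerivAt smoothStep (stepDeriv t) t :=
  (smoothStep_contDiff.differentiable (by simp) t).hasDerivAt

lemma stepDeriv_nonneg (t : ℝ) : 0 ≤ stepDeriv t := smoothStep_monotone.deriv_nonneg

/-- The one-sided derivative also covers the endpoint `t = 1/4`, where constancy is only known to
the left. -/
lemma stepDeriv_of_le {t : ℝ} (h : t ≤ 1 / 4) : stepDeriv t = 0 := by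
  have h1 : HasDerivWithinAt smoothStep (stepDeriv t) (Iic t) t :=
    (hasDerivAt_smoothStep t).hasDerivWithinAt
  have h2 : HasDerivWithinAt smoothStep 0 (Iic t) t :=
    (hasDerivWithinAt_const t (Iic t) (0 : ℝ)).congr
      (fun y hy => smoothStep_of_le (le_trans hy h)) (smoothStep_of_le h)
  exact (uniqueDiffOn_Iic t t self_mem_Iic).eq_deriv _ h1 h2

lemma stepDeriv_of_ge {t : ℝ} (h : 1 ≤ t) : stepDeriv t = 0 := by
  have h1 : HasDerivWithinAt smoothStep (stepDeriv t) (Ici t) t :=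
    (hasDerivAt_smoothStep t).hasDerivWithinAt
  have h2 : HasDerivWithinAt smoothStep 0 (Ici t) t :=
    (hasDerivWithinAt_const t (Ici t) (1 : ℝ)).congr
      (fun y hy => smoothStep_of_ge (le_trans h hy)) (smoothStep_of_ge h)
  exact (uniqueDiffOn_Ici t t self_mem_Ici).eq_deriv _ h1 h2

lemma exists_stepDeriv_pos : ∃ t, 0 < stepDeriv t := by
  obtain ⟨c, _, hc⟩ := exists_deriv_eq_slope smoothStep (a := 0) (b := 1) (by norm_num)
    smoothStep_contDiff.continuous.continuousOn
    (smoothStep_contDiff.differentiable (by simp)).differentiableOn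
  refine ⟨c, ?_⟩
  rw [stepDeriv, hc, smoothStep_of_ge le_rfl, smoothStep_of_le (by norm_num)]; norm_num

lemma contDiff_comp_norm_sq {f : ℝ → ℝ} (hf : ContDiff ℝ (⊤ : ℕ∞) f) :
    ContDiff ℝ (⊤ : ℕ∞) (fun x : Plane => f (‖x‖ ^ 2)) :=
  hf.comp (contDiff_norm_sq ℝ)

lemma plane_norm_sq (x : Plane) : ‖x‖ ^ 2 = x 0 ^ 2 + x 1 ^ 2 := by
  rw [EuclideanSpace.real_norm_sq_eq, Fin.sum_univ_two]

lemma abs_coord_le (x : Plane) (i : Fin 2) : |x i| ≤ ‖x‖ := by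
  simpa using PiLp.norm_apply_le x i

lemma classicalPartial_comp_norm_sq {f : ℝ → ℝ} {x : Plane} {f' : ℝ}
    (hf : HasDerivAt f f' (‖x‖ ^ 2)) (i : Fin 2) :
    classicalPartial i (fun x : Plane => f (‖x‖ ^ 2)) x = 2 * x i * f' := by
  have h1 : HasFDerivAt (fun x : Plane => ‖x‖ ^ 2) (2 • innerSL ℝ x) x :=
    (hasStrictFDerivAt_norm_sq x).hasFDerivAt
  have h2 := hf.comp_hasFDerivAt x h1
  change fderiv ℝ (f ∘ fun x : Plane => ‖x‖ ^ 2) x _ = _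
  rw [h2.fderiv]
  simp [EuclideanSpace.inner_single_right]
  ring

lemma classicalPartial_coord (x : Plane) (i j : Fin 2) :
    classicalPartial i (fun x : Plane => x j) x = if i = j then 1 else 0 := by
  have : HasFDerivAt (fun x : Plane => x j) (EuclideanSpace.proj j : Plane →L[ℝ] ℝ) x :=
    (EuclideanSpace.proj j : Plane →L[ℝ] ℝ).hasFDerivAt
  simp [classicalPartial, this.fderiv, eq_comm]

lemma contDiff_coord (i : Fin 2) {n : WithTop ℕ∞} : ContDiff ℝ n (fun x : Plane => x i) :=
  (EuclideanSpace.proj i : Plane →L[ℝ] ℝ).contDiff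

/-- The mass of the unnormalized kernel `stepDeriv ‖x‖²`. -/
def kernelMass : ℝ := ∫ x : Plane, stepDeriv (‖x‖ ^ 2)

lemma stepDeriv_norm_sq_hasCompactSupport :
    HasCompactSupport (fun x : Plane => stepDeriv (‖x‖ ^ 2)) := by
  refine HasCompactSupport.intro (isCompact_closedBall (0 : Plane) 1) fun x hx => ?_
  have : 1 < ‖x‖ := by simpa using hx
  exact stepDeriv_of_ge (by nlinarith)

lemma kernelMass_pos : 0 < kernelMass := by
  have hc : Continuous (fun x : Plane => stepDeriv (‖x‖ ^ 2)) :=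
    (contDiff_comp_norm_sq stepDeriv_contDiff).continuous
  obtain ⟨t, ht⟩ := exists_stepDeriv_pos
  have ht0 : 0 ≤ t := by
    by_contra h
    rw [stepDeriv_of_le (by linarith)] at ht
    exact lt_irrefl _ ht
  refine hc.integral_pos_of_hasCompactSupport_nonneg_nonzero stepDeriv_norm_sq_hasCompactSupport
    (fun x => stepDeriv_nonneg _) (x := EuclideanSpace.single 0 (Real.sqrt t)) ?_
  simp [Real.sq_sqrt ht0, ht.ne']

/-- The radial mollifier at scale `δ`. -/
def rho (δ : ℝ) (x : Plane) : ℝ := (kernelMass * δ ^ 2)⁻¹ * stepDeriv (‖x‖ ^ 2 / δ ^ 2)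

lemma rho_contDiff (δ : ℝ) : ContDiff ℝ (⊤ : ℕ∞) (rho δ) :=
  contDiff_const.mul (contDiff_comp_norm_sq (f := fun t => stepDeriv (t / δ ^ 2))
    (stepDeriv_contDiff.comp (contDiff_id.div_const _)))

lemma rho_nonneg (δ : ℝ) (x : Plane) : 0 ≤ rho δ x :=
  mul_nonneg (inv_nonneg.2 (mul_nonneg kernelMass_pos.le (sq_nonneg _))) (stepDeriv_nonneg _)

lemma rho_eq_zero {δ : ℝ} (hδ : 0 < δ) {x : Plane} (h : δ ≤ ‖x‖) : rho δ x = 0 := by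
  have : 1 ≤ ‖x‖ ^ 2 / δ ^ 2 := by
    rw [le_div_iff₀ (by positivity)]; nlinarith
  rw [rho, stepDeriv_of_ge this, mul_zero]

lemma rho_neg (δ : ℝ) (x : Plane) : rho δ (-x) = rho δ x := by simp [rho]

lemma rho_sub_comm (δ : ℝ) (x y : Plane) : rho δ (x - y) = rho δ (y - x) := by
  rw [← rho_neg, neg_sub]

lemma tsupport_rho_subset {δ : ℝ} (hδ : 0 < δ) : tsupport (rho δ) ⊆ Metric.closedBall 0 δ := by
  refine closure_minimal (fun x hx => ?_) Metric.isClosed_closedBall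
  by_contra h
  exact hx (rho_eq_zero hδ (by simpa using (not_le.1 (by simpa using h)).le))

lemma rho_hasCompactSupport {δ : ℝ} (hδ : 0 < δ) : HasCompactSupport (rho δ) :=
  (isCompact_closedBall (0 : Plane) δ).of_isClosed_subset (isClosed_tsupport _)
    (tsupport_rho_subset hδ)

lemma rho_eq_scale {δ : ℝ} (hδ : 0 < δ) (x : Plane) : rho δ x = (δ ^ 2)⁻¹ * rho 1 (δ⁻¹ • x) := by
  simp only [rho, norm_smul, norm_inv, Real.norm_eq_abs, abs_of_pos hδ]
  field_simp

lemma integral_comp_scale {F : Type*} [NormedAddCommGroup F] [NormedSpace ℝ F] (f : Plane → F)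
    {δ : ℝ} (hδ : 0 < δ) : ∫ x, f (δ⁻¹ • x) = δ ^ 2 • ∫ x, f x := by
  rw [Measure.integral_comp_smul_of_nonneg _ _ (hR := inv_nonneg.2 hδ.le)]
  simp

lemma integral_rho {δ : ℝ} (hδ : 0 < δ) : ∫ x, rho δ x = 1 := by
  simp_rw [rho_eq_scale hδ]
  rw [integral_const_mul, integral_comp_scale _ hδ]
  have : ∫ x, rho 1 x = 1 := by
    simp only [rho, one_pow, mul_one, div_one]
    rw [integral_const_mul]
    exact inv_mul_cancel₀ kernelMass_pos.ne'
  rw [this]; simp; field_simp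

lemma rho_integrable {δ : ℝ} (hδ : 0 < δ) : Integrable (rho δ) :=
  (rho_contDiff δ).continuous.integrable_of_hasCompactSupport (rho_hasCompactSupport hδ)

lemma integral_rho_sub {δ : ℝ} (hδ : 0 < δ) (x : Plane) : ∫ y, rho δ (x - y) = 1 := by
  rw [integral_sub_left_eq_self (rho δ) volume x, integral_rho hδ]

lemma rho_sub_integrable {δ : ℝ} (hδ : 0 < δ) (x : Plane) : Integrable (fun y => rho δ (x - y)) :=
  (rho_integrable hδ).comp_sub_left x

lemma exists_rho_le : ∃ C, 0 < C ∧ ∀ δ : ℝ, 0 < δ → ∀ x, rho δ x ≤ C * (δ ^ 2)⁻¹ := by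
  obtain ⟨C, hC⟩ := (rho_contDiff 1).continuous.bounded_above_of_compact_support
    (rho_hasCompactSupport one_pos)
  refine ⟨max C 1, by positivity, fun δ hδ x => ?_⟩
  rw [rho_eq_scale hδ, mul_comm]
  gcongr
  exact ((le_abs_self _).trans (hC _)).trans (le_max_left _ _)

/-- Scaling: the derivative of the dilate gains `δ⁻¹`, and the normalizing factor `δ⁻²` is undone by
the change of variables. -/
lemma exists_integral_abs_partial_rho_le :
    ∃ C, 0 < C ∧ ∀ δ : ℝ, 0 < δ → ∀ i, ∫ x, |classicalPartial i (rho δ) x| ≤ C * δ⁻¹ := by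
  refine ⟨1 + ∑ i, ∫ x, |classicalPartial i (rho 1) x|, ?_, fun δ hδ i => ?_⟩
  · have : 0 ≤ ∑ i, ∫ x, |classicalPartial i (rho 1) x| :=
      Finset.sum_nonneg fun i _ => integral_nonneg fun x => abs_nonneg _
    linarith
  · have h : ∀ x, classicalPartial i (rho δ) x
        = (δ ^ 2)⁻¹ * (δ⁻¹ * classicalPartial i (rho 1) (δ⁻¹ • x)) := by
      intro x
      have e : rho δ = fun x => (δ ^ 2)⁻¹ * rho 1 (δ⁻¹ • x) := funext (rho_eq_scale hδ)
      have d : HasFDerivAt (fun x : Plane => rho 1 (δ⁻¹ • x))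
          ((fderiv ℝ (rho 1) (δ⁻¹ • x)).comp (δ⁻¹ • ContinuousLinearMap.id ℝ Plane)) x :=
        HasFDerivAt.comp x
          ((rho_contDiff 1).differentiable (by simp) (δ⁻¹ • x)).hasFDerivAt
          ((hasFDerivAt_id x).const_smul δ⁻¹)
      have d2 := d.const_mul (δ ^ 2)⁻¹
      simp only [classicalPartial]
      rw [e, d2.fderiv]
      simp
    simp_rw [h, abs_mul]
    rw [integral_const_mul, integral_const_mul,
      integral_comp_scale (fun x => |classicalPartial i (rho 1) x|) hδ]
    have h2 : ∫ x, |classicalPartial i (rho 1) x| ≤ 1 + ∑ i, ∫ x, |classicalPartial i (rho 1) x| := by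
      have := Finset.single_le_sum (f := fun i => ∫ x, |classicalPartial i (rho 1) x|)
        (fun i _ => integral_nonneg fun x => abs_nonneg _) (Finset.mem_univ i)
      linarith
    rw [abs_of_pos (by positivity : 0 < (δ ^ 2)⁻¹), abs_of_pos (by positivity : 0 < δ⁻¹)]
    calc _ = (∫ x, |classicalPartial i (rho 1) x|) * δ⁻¹ := by
          rw [smul_eq_mul]; field_simp
      _ ≤ _ := by gcongr

/-! ### The radial field with divergence `rho` -/

/-- The profile of the radial field whose divergence is `rho`. -/
def radialProfile (δ t : ℝ) : ℝ := smoothStep (t / δ ^ 2) / t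

lemma radialProfile_mul (δ t : ℝ) : t * radialProfile δ t = smoothStep (t / δ ^ 2) := by
  rcases eq_or_ne t 0 with rfl | h
  · simp [smoothStep_of_le]
  · simp only [radialProfile]; field_simp

/-- The step vanishes for small arguments, so the singularity of `1/t` at the origin is never seen.
-/
lemma radialProfile_contDiff {δ : ℝ} (hδ : 0 < δ) :
    ContDiff ℝ (⊤ : ℕ∞) (radialProfile δ) := by
  refine contDiff_iff_contDiffAt.2 fun t => ?_
  rcases eq_or_ne t 0 with rfl | h
  · refine (contDiffAt_const (c := (0 : ℝ))).congr_of_eventuallyEq ?_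
    have : ∀ᶠ t : ℝ in 𝓝 0, t < δ ^ 2 / 4 := Iio_mem_nhds (by positivity)
    filter_upwards [this] with t ht
    rw [radialProfile, smoothStep_of_le, zero_div]
    rw [div_le_iff₀ (by positivity)]; linarith
  · exact ((smoothStep_contDiff.comp (contDiff_id.div_const _)).contDiffAt).div contDiffAt_id h

lemma radialProfile_deriv {δ : ℝ} (hδ : 0 < δ) (t : ℝ) :
    radialProfile δ t + t * deriv (radialProfile δ) t = stepDeriv (t / δ ^ 2) / δ ^ 2 := by
  have h1 : HasDerivAt (fun t => t * radialProfile δ t)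
      (1 * radialProfile δ t + t * deriv (radialProfile δ) t) t :=
    (hasDerivAt_id t).mul ((radialProfile_contDiff hδ).differentiable (by simp) t).hasDerivAt
  have h2 : HasDerivAt (fun t => smoothStep (t / δ ^ 2)) (stepDeriv (t / δ ^ 2) * (1 / δ ^ 2)) t :=
    (hasDerivAt_smoothStep _).comp t ((hasDerivAt_id t).div_const _)
  have h3 : (fun t => t * radialProfile δ t) = fun t => smoothStep (t / δ ^ 2) :=
    funext (radialProfile_mul δ)
  rw [h3] at h1
  have := h1.unique h2
  rw [one_mul] at this
  rw [this]; ring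

/-- The radial field with divergence `rho δ`. -/
def radialField (δ : ℝ) (i : Fin 2) (x : Plane) : ℝ :=
  (2 * kernelMass)⁻¹ * (x i * radialProfile δ (‖x‖ ^ 2))

lemma radialField_contDiff {δ : ℝ} (hδ : 0 < δ) (i : Fin 2) :
    ContDiff ℝ (⊤ : ℕ∞) (radialField δ i) :=
  contDiff_const.mul ((contDiff_coord i).mul (contDiff_comp_norm_sq (radialProfile_contDiff hδ)))

lemma radialField_of_le {δ : ℝ} (hδ : 0 < δ) (i : Fin 2) {x : Plane} (h : δ ≤ ‖x‖) :
    radialField δ i x = (2 * kernelMass)⁻¹ * (x i / ‖x‖ ^ 2) := by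
  have : 1 ≤ ‖x‖ ^ 2 / δ ^ 2 := by
    rw [le_div_iff₀ (by positivity)]; nlinarith
  rw [radialField, radialProfile, smoothStep_of_ge this]; ring

/-- In the plane `x g(|x|²)` has divergence `2 (g + t g')` at `t = |x|²`, twice the derivative of `t
g(t) = smoothStep (t / δ²)`. The prefactor `(2 * kernelMass)⁻¹` turns this into the normalized
kernel. -/
lemma divergence_radialField {δ : ℝ} (hδ : 0 < δ) (x : Plane) :
    ∑ i, classicalPartial i (radialField δ i) x = rho δ x := by
  have hg := radialProfile_contDiff hδ
  have key : ∀ i, classicalPartial i (radialField δ i) x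
      = (2 * kernelMass)⁻¹ * (x i * (2 * x i * deriv (radialProfile δ) (‖x‖ ^ 2))
        + radialProfile δ (‖x‖ ^ 2)) := by
    intro i
    have d1 : DifferentiableAt ℝ (fun x : Plane => x i) x :=
      (contDiff_coord i (n := 1)).differentiable (by norm_num) x
    have d2 : DifferentiableAt ℝ (fun x : Plane => radialProfile δ (‖x‖ ^ 2)) x :=
      (contDiff_comp_norm_sq hg).differentiable (by simp) x
    have := classicalPartial_smul (𝕜 := ℝ) (φ := fun _ => (2 * kernelMass)⁻¹)
      (differentiableAt_const _) (d1.mul d2) i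
    simp only [smul_eq_mul, Pi.mul_apply] at this
    have e : classicalPartial i (fun _ : Plane => (2 * kernelMass)⁻¹) x = 0 := by
      simp [classicalPartial]
    have h2 := classicalPartial_smul (𝕜 := ℝ) d1 d2 i
    simp only [smul_eq_mul] at h2
    rw [classicalPartial_comp_norm_sq
      ((hg.differentiable (by simp) _).hasDerivAt) i, classicalPartial_coord] at h2
    simp only [if_true, one_mul] at h2
    rw [e, zero_mul, add_zero] at this
    exact this.trans (by rw [← h2]; rfl)
  rw [Fin.sum_univ_two, key, key, ← mul_add]
  have hs := plane_norm_sq x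
  have h3 := radialProfile_deriv hδ (‖x‖ ^ 2)
  have : rho δ x = kernelMass⁻¹ * (stepDeriv (‖x‖ ^ 2 / δ ^ 2) / δ ^ 2) := by
    rw [rho, mul_inv]; ring
  rw [this, ← h3, mul_inv]
  set D := deriv (radialProfile δ) (‖x‖ ^ 2)
  rw [show ‖x‖ ^ 2 * D = (x 0 ^ 2 + x 1 ^ 2) * D by rw [hs]]
  ring

/-- The bound is uniform in `δ`, which lets the mollification scale go to zero in the gradient
estimate for the Poisson equation. -/
lemma abs_radialField_le (δ : ℝ) (i : Fin 2) (x : Plane) :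
    |radialField δ i x| ≤ (2 * kernelMass)⁻¹ * ‖x‖⁻¹ := by
  rw [radialField, abs_mul, abs_of_pos (by have := kernelMass_pos; positivity)]
  have := kernelMass_pos
  gcongr
  rcases eq_or_ne x 0 with rfl | hx
  · simp
  have hx' : 0 < ‖x‖ := norm_pos_iff.2 hx
  rw [radialProfile, abs_mul, abs_div, abs_of_nonneg (smoothStep_nonneg _),
    abs_of_pos (by positivity : 0 < ‖x‖ ^ 2), ← mul_div_assoc, div_le_iff₀ (by positivity)]
  calc |x i| * smoothStep (‖x‖ ^ 2 / δ ^ 2) ≤ ‖x‖ * 1 := by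
        gcongr
        · exact smoothStep_nonneg _
        · exact abs_coord_le x i
        · exact smoothStep_le_one _
    _ = ‖x‖⁻¹ * ‖x‖ ^ 2 := by field_simp

/-- A compactly supported function with gradient `radialField δ' - radialField δ`, hence with
Laplacian `rho δ' - rho δ`. -/
def radialPotential (δ δ' : ℝ) (x : Plane) : ℝ :=
  (4 * kernelMass)⁻¹ * ∫ t in (max (δ ^ 2) (δ' ^ 2))..(‖x‖ ^ 2),
    (radialProfile δ' t - radialProfile δ t)

lemma radialPotential_aux {δ δ' : ℝ} (hδ : 0 < δ) (hδ' : 0 < δ') :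
    ContDiff ℝ (⊤ : ℕ∞) (fun r => ∫ t in (max (δ ^ 2) (δ' ^ 2))..r,
      (radialProfile δ' t - radialProfile δ t)) ∧
    ∀ r, HasDerivAt (fun r => ∫ t in (max (δ ^ 2) (δ' ^ 2))..r,
      (radialProfile δ' t - radialProfile δ t)) (radialProfile δ' r - radialProfile δ r) r := by
  have hc : ContDiff ℝ (⊤ : ℕ∞) fun t => radialProfile δ' t - radialProfile δ t :=
    (radialProfile_contDiff hδ').sub (radialProfile_contDiff hδ)
  have hd : ∀ r, HasDerivAt (fun r => ∫ t in (max (δ ^ 2) (δ' ^ 2))..r,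
      (radialProfile δ' t - radialProfile δ t)) (radialProfile δ' r - radialProfile δ r) r :=
    fun r => intervalIntegral.integral_hasDerivAt_right (hc.continuous.intervalIntegrable _ _)
      (hc.continuous.stronglyMeasurableAtFilter _ _) hc.continuous.continuousAt
  refine ⟨contDiff_infty_iff_deriv.2 ⟨fun r => (hd r).differentiableAt, ?_⟩, hd⟩
  rw [show deriv (fun r => ∫ t in (max (δ ^ 2) (δ' ^ 2))..r,
      (radialProfile δ' t - radialProfile δ t)) = fun r => radialProfile δ' r - radialProfile δ r
    from funext fun r => (hd r).deriv]
  exact hc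

lemma radialPotential_contDiff {δ δ' : ℝ} (hδ : 0 < δ) (hδ' : 0 < δ') :
    ContDiff ℝ (⊤ : ℕ∞) (radialPotential δ δ') :=
  contDiff_const.mul (contDiff_comp_norm_sq (radialPotential_aux hδ hδ').1)

lemma partial_radialPotential {δ δ' : ℝ} (hδ : 0 < δ) (hδ' : 0 < δ') (i : Fin 2) (x : Plane) :
    classicalPartial i (radialPotential δ δ') x = radialField δ' i x - radialField δ i x := by
  have h := classicalPartial_comp_norm_sq ((radialPotential_aux hδ hδ').2 (‖x‖ ^ 2)) i
  have d : DifferentiableAt ℝ (fun x : Plane => ∫ t in (max (δ ^ 2) (δ' ^ 2))..(‖x‖ ^ 2),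
      (radialProfile δ' t - radialProfile δ t)) x :=
    (contDiff_comp_norm_sq (radialPotential_aux hδ hδ').1).differentiable (by simp) x
  have := classicalPartial_smul (𝕜 := ℝ) (φ := fun _ => (4 * kernelMass)⁻¹)
      (differentiableAt_const _) d i
  rw [h] at this
  have e : classicalPartial i (fun _ : Plane => (4 * kernelMass)⁻¹) x = 0 := by
    simp [classicalPartial]
  simp only [smul_eq_mul] at this
  rw [e, zero_mul, add_zero] at this
  refine this.trans ?_
  simp only [radialField, mul_inv]
  ring

/-- Once `t` exceeds both `δ²` and `δ'²`, the two profiles equal `1/t` and cancel. Integrating from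
the larger of these two values makes the potential vanish outside the ball. -/
lemma tsupport_radialPotential_subset {δ δ' r : ℝ} (hδ : 0 < δ) (hδ' : 0 < δ') (h1 : δ ≤ r)
    (h2 : δ' ≤ r) : tsupport (radialPotential δ δ') ⊆ Metric.closedBall 0 r := by
  refine closure_minimal (fun x hx => ?_) Metric.isClosed_closedBall
  by_contra h
  have hr : r < ‖x‖ := by simpa using h
  apply hx
  rw [radialPotential]
  have : ∫ t in (max (δ ^ 2) (δ' ^ 2))..(‖x‖ ^ 2),
      (radialProfile δ' t - radialProfile δ t) = 0 := by
    refine (intervalIntegral.integral_congr fun t ht => ?_).trans intervalIntegral.integral_zero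
    have hle : max (δ ^ 2) (δ' ^ 2) ≤ ‖x‖ ^ 2 := max_le (by nlinarith) (by nlinarith)
    rw [uIcc_of_le hle] at ht
    have t1 := (le_max_left _ _).trans ht.1
    have t2 := (le_max_right _ _).trans ht.1
    simp only [radialProfile]
    rw [smoothStep_of_ge, smoothStep_of_ge, sub_self]
    · rwa [le_div_iff₀ (by positivity), one_mul]
    · rwa [le_div_iff₀ (by positivity), one_mul]
  rw [this, mul_zero]

lemma radialPotential_hasCompactSupport {δ δ' : ℝ} (hδ : 0 < δ) (hδ' : 0 < δ') :
    HasCompactSupport (radialPotential δ δ') :=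
  (isCompact_closedBall (0 : Plane) (max δ δ')).of_isClosed_subset (isClosed_tsupport _)
    (tsupport_radialPotential_subset hδ hδ' (le_max_left _ _) (le_max_right _ _))

lemma laplacian_radialPotential {δ δ' : ℝ} (hδ : 0 < δ) (hδ' : 0 < δ') (x : Plane) :
    ∑ i, classicalPartial i (classicalPartial i (radialPotential δ δ')) x
      = rho δ' x - rho δ x := by
  rw [← divergence_radialField hδ, ← divergence_radialField hδ', ← Finset.sum_sub_distrib]
  refine Finset.sum_congr rfl fun i _ => ?_
  rw [show classicalPartial i (radialPotential δ δ')
    = fun x => radialField δ' i x - radialField δ i x from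
      funext (partial_radialPotential hδ hδ' i)]
  exact classicalPartial_sub ((radialField_contDiff hδ' i).differentiable (by simp) x)
    ((radialField_contDiff hδ i).differentiable (by simp) x) i

end

noncomputable section

/-! ### Mollification -/

section Mollification

variable {F : Type*} [NormedAddCommGroup F] [NormedSpace ℝ F]

/-- The mollification of `f` at scale `δ`. -/
def mol (δ : ℝ) (f : Plane → F) (x : Plane) : F := ∫ y, rho δ (x - y) • f y

lemma mol_eq_convolution (δ : ℝ) (f : Plane → F) :
    mol δ f = convolution (rho δ) f (ContinuousLinearMap.lsmul ℝ ℝ) volume := by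
  funext x
  rw [convolution_lsmul_swap]; rfl

lemma rho_sub_contDiff (δ : ℝ) (x : Plane) : ContDiff ℝ (⊤ : ℕ∞) (fun y => rho δ (x - y)) :=
  (rho_contDiff δ).comp (contDiff_const.sub contDiff_id)

lemma comp_const_sub_hasCompactSupport {G : Type*} [Zero G] {k : Plane → G}
    (hk : HasCompactSupport k) (x : Plane) : HasCompactSupport (fun y => k (x - y)) :=
  hk.comp_homeomorph (Homeomorph.subLeft x)

lemma integrable_smul_of_locallyIntegrable {k : Plane → ℝ} (hk : Continuous k)
    (hc : HasCompactSupport k) {f : Plane → F} (hf : LocallyIntegrable f) :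
    Integrable (fun y => k y • f y) :=
  hf.integrable_smul_left_of_hasCompactSupport hk hc

lemma rho_smul_integrable {δ : ℝ} (hδ : 0 < δ) {f : Plane → F} (hf : LocallyIntegrable f)
    (x : Plane) : Integrable (fun y => rho δ (x - y) • f y) :=
  integrable_smul_of_locallyIntegrable (rho_sub_contDiff δ x).continuous
    (comp_const_sub_hasCompactSupport (rho_hasCompactSupport hδ) x) hf

lemma mol_contDiff {δ : ℝ} (hδ : 0 < δ) {f : Plane → F} (hf : LocallyIntegrable f) :
    ContDiff ℝ (⊤ : ℕ∞) (mol δ f) := by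
  rw [mol_eq_convolution]
  exact (rho_hasCompactSupport hδ).contDiff_convolution_left _ (rho_contDiff δ) hf

lemma classicalPartial_integral_kernel [CompleteSpace F] {k : Plane → ℝ}
    (hk : ContDiff ℝ (⊤ : ℕ∞) k) (hc : HasCompactSupport k) {f : Plane → F}
    (hf : LocallyIntegrable f) (i : Fin 2) (x : Plane) :
    classicalPartial i (fun x => ∫ y, k (x - y) • f y) x
      = ∫ y, classicalPartial i k (x - y) • f y := by
  have h := hc.hasFDerivAt_convolution_left (μ := volume)
    (ContinuousLinearMap.lsmul ℝ ℝ) (hk.of_le (by simp)) hf x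
  have e : (fun x => ∫ y, k (x - y) • f y)
      = convolution k f (ContinuousLinearMap.lsmul ℝ ℝ) volume := by
    funext x
    rw [convolution_lsmul_swap]
  rw [classicalPartial, e, h.fderiv, convolution_eq_swap]
  have hi : Integrable (fun t => ((ContinuousLinearMap.lsmul ℝ ℝ).precompL Plane)
      (fderiv ℝ k (x - t)) (f t)) := by
    have := (hc.fderiv ℝ).convolutionExists_left
      (μ := volume) ((ContinuousLinearMap.lsmul ℝ ℝ : ℝ →L[ℝ] F →L[ℝ] F).precompL Plane)
      (hk.continuous_fderiv (by simp)) hf x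
    exact this.integrable_swap
  rw [ContinuousLinearMap.integral_apply hi]
  rfl

lemma classicalPartial_mol [CompleteSpace F] {δ : ℝ} (hδ : 0 < δ) {f : Plane → F}
    (hf : LocallyIntegrable f) (i : Fin 2) (x : Plane) :
    classicalPartial i (mol δ f) x = ∫ y, classicalPartial i (rho δ) (x - y) • f y :=
  classicalPartial_integral_kernel (rho_contDiff δ) (rho_hasCompactSupport hδ) hf i x

lemma mol_sub {δ : ℝ} (hδ : 0 < δ) {f g : Plane → F} (hf : LocallyIntegrable f)
    (hg : LocallyIntegrable g) (x : Plane) :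
    mol δ (fun y => f y - g y) x = mol δ f x - mol δ g x := by
  simp only [mol, smul_sub]
  exact integral_sub (rho_smul_integrable hδ hf x) (rho_smul_integrable hδ hg x)

/-- The kernel is a probability density, so `mol δ f x - c` is an average of `f - c` over the ball.
With `C = 0` this says that mollification preserves functions where they are locally constant. -/
lemma norm_mol_sub_le [CompleteSpace F] {δ : ℝ} (hδ : 0 < δ) {f : Plane → F} (hf : LocallyIntegrable f)
    {x : Plane} {c : F} {C : ℝ} (h : ∀ᵐ y, y ∈ Metric.closedBall x δ → ‖f y - c‖ ≤ C) :
    ‖mol δ f x - c‖ ≤ C := by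
  have e : mol δ f x - c = ∫ y, rho δ (x - y) • (f y - c) := by
    simp only [smul_sub]
    rw [integral_sub (rho_smul_integrable hδ hf x) ((rho_sub_integrable hδ x).smul_const c),
      integral_smul_const, integral_rho_sub hδ, one_smul]; rfl
  rw [e]
  calc ‖∫ y, rho δ (x - y) • (f y - c)‖ ≤ ∫ y, rho δ (x - y) * C := by
        refine norm_integral_le_of_norm_le ((rho_sub_integrable hδ x).mul_const C) ?_
        filter_upwards [h] with y hy
        rw [norm_smul, Real.norm_eq_abs, abs_of_nonneg (rho_nonneg _ _)]
        by_cases hb : y ∈ Metric.closedBall x δ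
        · exact mul_le_mul_of_nonneg_left (hy hb) (rho_nonneg _ _)
        · have : rho δ (x - y) = 0 := rho_eq_zero hδ (by
            rw [Metric.mem_closedBall, not_le, dist_comm, dist_eq_norm] at hb; exact hb.le)
          simp [this]
    _ = C := by rw [integral_mul_const, integral_rho_sub hδ, one_mul]

lemma norm_mol_le [CompleteSpace F] {δ : ℝ} (hδ : 0 < δ) {f : Plane → F} (hf : LocallyIntegrable f)
    {x : Plane} {C : ℝ} (h : ∀ᵐ y, y ∈ Metric.closedBall x δ → ‖f y‖ ≤ C) :
    ‖mol δ f x‖ ≤ C := by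
  simpa using norm_mol_sub_le hδ hf (c := 0) (x := x) (C := C) (by simpa using h)

lemma mol_eq_zero {δ : ℝ} (hδ : 0 < δ) {f : Plane → F} {x : Plane}
    (h : ∀ y ∈ Metric.closedBall x δ, f y = 0) : mol δ f x = 0 := by
  refine integral_eq_zero_of_ae (Eventually.of_forall fun y => ?_)
  by_cases hb : y ∈ Metric.closedBall x δ
  · simp [h y hb]
  · have : rho δ (x - y) = 0 := rho_eq_zero hδ (by
      rw [Metric.mem_closedBall, not_le, dist_comm, dist_eq_norm] at hb; exact hb.le)
    simp [this]

lemma isTestFunction_comp_const_sub {U : Set Plane} {k : Plane → ℝ} {r : ℝ} {x : Plane}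
    (hk : ContDiff ℝ (⊤ : ℕ∞) k) (hs : tsupport k ⊆ Metric.closedBall 0 r)
    (hx : Metric.closedBall x r ⊆ U) : IsTestFunction U (fun y => k (x - y)) := by
  have hc : HasCompactSupport k :=
    (isCompact_closedBall (0 : Plane) r).of_isClosed_subset (isClosed_tsupport _) hs
  refine ⟨hk.comp (contDiff_const.sub contDiff_id), comp_const_sub_hasCompactSupport hc x, ?_⟩
  refine Subset.trans ?_ hx
  refine closure_minimal (fun y hy => ?_) Metric.isClosed_closedBall
  have := hs (subset_tsupport k hy)
  rw [Metric.mem_closedBall, dist_comm, dist_eq_norm]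
  simpa using this

lemma classicalPartial_comp_const_sub {k : Plane → F} (hk : Differentiable ℝ k) (x y : Plane)
    (i : Fin 2) : classicalPartial i (fun y => k (x - y)) y = - classicalPartial i k (x - y) := by
  have : HasFDerivAt (fun y => k (x - y))
      ((fderiv ℝ k (x - y)).comp (-ContinuousLinearMap.id ℝ Plane)) y :=
    (hk (x - y)).hasFDerivAt.comp y ((hasFDerivAt_id y).const_sub x)
  simp [classicalPartial, this.fderiv]

lemma integral_smul_indicator {U : Set Plane} (hU : MeasurableSet U) (k : Plane → ℝ)
    (f : Plane → F) : ∫ y, k y • U.indicator f y = ∫ y in U, k y • f y := by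
  rw [← integral_indicator hU]
  exact integral_congr_ae (Eventually.of_forall fun y => by
    by_cases h : y ∈ U <;> simp [h])

/-- Mollification commutes with weak derivatives, away from the boundary. -/
lemma IsWeakPartial.classicalPartial_mol [CompleteSpace F] {U : Set Plane} (hU : IsOpen U) {i : Fin 2}
    {u g : Plane → F} (h : IsWeakPartial U i u g) (hu : LocallyIntegrable (U.indicator u))
    {δ : ℝ} (hδ : 0 < δ) {x : Plane} (hx : Metric.closedBall x δ ⊆ U) :
    classicalPartial i (mol δ (U.indicator u)) x = mol δ (U.indicator g) x := by
  rw [_root_.classicalPartial_mol hδ hu, mol, integral_smul_indicator hU.measurableSet,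
    integral_smul_indicator hU.measurableSet]
  have := h.2.2 _ (isTestFunction_comp_const_sub (rho_contDiff δ) (tsupport_rho_subset hδ) hx)
  simp_rw [classicalPartial_comp_const_sub ((rho_contDiff δ).differentiable (by simp)),
    neg_smul, integral_neg, neg_inj] at this
  exact this

/-- Lebesgue differentiation along balls of radius `δ` whose centres `x + δ • q` stay within `‖q‖ δ`
of `x`; the kernel is at most a multiple of the reciprocal area of the ball. The moving centre is
needed to mollify inside a cone. -/
lemma mol_tendsto_ae [CompleteSpace F] {f : Plane → F} (hf : LocallyIntegrable f) (q : Plane) :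
    ∀ᵐ x, Tendsto (fun δ : ℝ => mol δ f (x + δ • q)) (𝓝[>] 0) (𝓝 (f x)) := by
  obtain ⟨C, hC, hρ⟩ := exists_rho_le
  filter_upwards [IsUnifLocDoublingMeasure.ae_tendsto_average_norm_sub volume hf ‖q‖] with x hx
  have h1 := hx (l := 𝓝[>] (0 : ℝ)) (fun δ => x + δ • q) id tendsto_id (by
    filter_upwards [self_mem_nhdsWithin] with δ hδ
    have hδ : 0 < δ := hδ
    simp [Metric.mem_closedBall, dist_eq_norm, norm_smul, abs_of_pos hδ, mul_comm])
  rw [tendsto_iff_norm_sub_tendsto_zero]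
  set v := (volume : Measure Plane).real (Metric.ball (0 : Plane) 1)
  have hv : 0 < v := ENNReal.toReal_pos (Metric.measure_ball_pos _ _ one_pos).ne'
    measure_ball_lt_top.ne
  refine squeeze_zero' (Eventually.of_forall fun δ => norm_nonneg _) ?_
    (by simpa using h1.const_mul (C * v))
  filter_upwards [self_mem_nhdsWithin] with δ hδ
  have hδ : 0 < δ := hδ
  set w := x + δ • q
  have e : mol δ f w - f x = ∫ y, rho δ (w - y) • (f y - f x) := by
    simp only [smul_sub]
    rw [integral_sub (rho_smul_integrable hδ hf w) ((rho_sub_integrable hδ w).smul_const _),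
      integral_smul_const, integral_rho_sub hδ, one_smul]; rfl
  have e2 : ∫ y, rho δ (w - y) • (f y - f x)
      = ∫ y in Metric.closedBall w δ, rho δ (w - y) • (f y - f x) := by
    refine (setIntegral_eq_integral_of_forall_compl_eq_zero fun y hy => ?_).symm
    have : rho δ (w - y) = 0 := rho_eq_zero hδ (by
      rw [Metric.mem_closedBall, not_le, dist_comm, dist_eq_norm] at hy; exact hy.le)
    simp [this]
  have hint : IntegrableOn (fun y => ‖f y - f x‖) (Metric.closedBall w δ) :=
    ((hf.integrableOn_isCompact (isCompact_closedBall w δ)).sub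
      (integrableOn_const (measure_closedBall_lt_top.ne))).norm
  rw [e, e2]
  calc _ ≤ ∫ y in Metric.closedBall w δ, C * (δ ^ 2)⁻¹ * ‖f y - f x‖ := by
        refine norm_integral_le_of_norm_le (hint.const_mul _) (Eventually.of_forall fun y => ?_)
        rw [norm_smul, Real.norm_eq_abs, abs_of_nonneg (rho_nonneg _ _)]
        exact mul_le_mul_of_nonneg_right (hρ δ hδ _) (norm_nonneg _)
    _ = _ := by
        rw [integral_const_mul, setAverage_eq]
        have : (volume : Measure Plane).real (Metric.closedBall w δ) = δ ^ 2 * v := by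
          have := (volume : Measure Plane).addHaar_real_closedBall w hδ.le
          rw [this]; simp [v]
        rw [this, smul_eq_mul]
        field_simp

/-- Writing the kernel as a product of two square roots, Cauchy-Schwarz gives `|mol f|² ≤ mol |f|²`
pointwise. Tonelli and the unit mass of the kernel finish. -/
lemma eLpNorm_mol_le {δ : ℝ} (hδ : 0 < δ) {f : Plane → F} (hf : MemLp f 2 volume) :
    eLpNorm (mol δ f) 2 volume ≤ eLpNorm f 2 volume := by
  have hfm : AEMeasurable (fun y => ‖f y‖ₑ) volume := hf.1.enorm
  have hρm : ∀ x, Measurable (fun y => ENNReal.ofReal (rho δ (x - y))) := fun x =>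
    (rho_sub_contDiff δ x).continuous.measurable.ennreal_ofReal
  have hρ1 : ∀ x, ∫⁻ y, ENNReal.ofReal (rho δ (x - y)) = 1 := by
    intro x
    rw [← ofReal_integral_eq_lintegral_ofReal (rho_sub_integrable hδ x)
      (Eventually.of_forall fun y => rho_nonneg _ _), integral_rho_sub hδ, ENNReal.ofReal_one]
  have hρ2 : ∀ y, ∫⁻ x, ENNReal.ofReal (rho δ (x - y)) = 1 := by
    intro y; simp_rw [rho_sub_comm δ _ y]; exact hρ1 y
  have pt : ∀ x, ‖mol δ f x‖ₑ ^ (2 : ℝ)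
      ≤ ∫⁻ y, ENNReal.ofReal (rho δ (x - y)) * ‖f y‖ₑ ^ (2 : ℝ) := by
    intro x
    have h1 : ‖mol δ f x‖ₑ ≤ ∫⁻ y, ENNReal.ofReal (rho δ (x - y)) ^ (1 / 2 : ℝ)
        * (ENNReal.ofReal (rho δ (x - y)) ^ (1 / 2 : ℝ) * ‖f y‖ₑ) := by
      refine (enorm_integral_le_lintegral_enorm _).trans (lintegral_mono fun y => ?_)
      rw [enorm_smul, ← mul_assoc, ← ENNReal.rpow_add_of_nonneg _ _ (by norm_num) (by norm_num),
        Real.enorm_eq_ofReal (rho_nonneg _ _)]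
      norm_num
    have h2 := ENNReal.lintegral_mul_le_Lp_mul_Lq volume
      (Real.HolderConjugate.two_two)
      (f := fun y => ENNReal.ofReal (rho δ (x - y)) ^ (1 / 2 : ℝ))
      (g := fun y => ENNReal.ofReal (rho δ (x - y)) ^ (1 / 2 : ℝ) * ‖f y‖ₑ)
      ((hρm x).pow_const _).aemeasurable (((hρm x).pow_const _).aemeasurable.mul hfm)
    have e1 : ∀ y, (ENNReal.ofReal (rho δ (x - y)) ^ (1 / 2 : ℝ)) ^ (2 : ℝ)
        = ENNReal.ofReal (rho δ (x - y)) := by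
      intro y; rw [← ENNReal.rpow_mul]; norm_num
    have h3 : ‖mol δ f x‖ₑ ≤
        (∫⁻ y, ENNReal.ofReal (rho δ (x - y)) * ‖f y‖ₑ ^ (2 : ℝ)) ^ (1 / 2 : ℝ) := by
      refine (h1.trans h2).trans_eq ?_
      simp_rw [ENNReal.mul_rpow_of_nonneg _ _ (by norm_num : (0 : ℝ) ≤ 2), e1, hρ1]
      simp
    calc ‖mol δ f x‖ₑ ^ (2 : ℝ) ≤ _ := ENNReal.rpow_le_rpow h3 (by norm_num)
      _ = _ := by rw [← ENNReal.rpow_mul]; norm_num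
  rw [eLpNorm_eq_lintegral_rpow_enorm_toReal (by norm_num) (by norm_num),
    eLpNorm_eq_lintegral_rpow_enorm_toReal (by norm_num) (by norm_num)]
  refine ENNReal.rpow_le_rpow ?_ (by norm_num)
  simp only [ENNReal.toReal_ofNat]
  calc ∫⁻ x, ‖mol δ f x‖ₑ ^ (2 : ℝ)
      ≤ ∫⁻ x, ∫⁻ y, ENNReal.ofReal (rho δ (x - y)) * ‖f y‖ₑ ^ (2 : ℝ) := lintegral_mono pt
    _ = ∫⁻ y, ∫⁻ x, ENNReal.ofReal (rho δ (x - y)) * ‖f y‖ₑ ^ (2 : ℝ) := by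
        refine lintegral_lintegral_swap ?_
        refine AEMeasurable.mul ?_ ?_
        · have : Continuous (fun p : Plane × Plane => rho δ (p.1 - p.2)) :=
            (rho_contDiff δ).continuous.comp (continuous_fst.sub continuous_snd)
          exact this.measurable.ennreal_ofReal.aemeasurable
        · exact ((hfm.pow_const (2 : ℝ)).comp_quasiMeasurePreserving
            (Measure.quasiMeasurePreserving_snd))
    _ = ∫⁻ y, ‖f y‖ₑ ^ (2 : ℝ) := by
        refine lintegral_congr fun y => ?_
        rw [lintegral_mul_const _ (by
          simp_rw [rho_sub_comm δ _ y]; exact hρm y), hρ2, one_mul]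

lemma MemLp.mol {δ : ℝ} (hδ : 0 < δ) {f : Plane → F} (hf : MemLp f 2 volume) :
    MemLp (mol δ f) 2 volume :=
  ⟨(mol_contDiff hδ (hf.locallyIntegrable (by norm_num))).continuous.aestronglyMeasurable,
    (eLpNorm_mol_le hδ hf).trans_lt hf.2⟩

/-- Uniform continuity makes the difference uniformly small, and for `δ ≤ 1` it lives in a fixed
compact neighbourhood of the support. -/
lemma mol_tendsto_eLpNorm_of_continuous [CompleteSpace F] {k : Plane → F} (hk : Continuous k)
    (hc : HasCompactSupport k) :
    Tendsto (fun δ => eLpNorm (fun x => mol δ k x - k x) 2 volume) (𝓝[>] 0) (𝓝 0) := by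
  have huc := hc.uniformContinuous_of_continuous hk
  set K := Metric.cthickening 1 (tsupport k)
  have hK : IsCompact K := hc.isCompact.cthickening
  have hv : (volume K) ^ (1 / (2 : ℝ)) ≠ ⊤ :=
    ENNReal.rpow_ne_top_of_nonneg (by norm_num) hK.measure_lt_top.ne
  rw [ENNReal.tendsto_nhds_zero]
  intro ε hε
  have hlim : Tendsto (fun η : ℝ => ENNReal.ofReal η * (volume K) ^ (1 / (2 : ℝ)))
      (𝓝[>] 0) (𝓝 0) := by
    have := ENNReal.Tendsto.mul_const (b := (volume K) ^ (1 / (2 : ℝ)))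
      (ENNReal.tendsto_ofReal ((tendsto_id (α := ℝ)).mono_left
      (nhdsWithin_le_nhds (a := (0 : ℝ)) (s := Ioi 0)))) (Or.inr hv)
    simpa using this
  obtain ⟨η, hη, hη0⟩ := ((hlim.eventually (gt_mem_nhds hε)).and self_mem_nhdsWithin).exists
  have hη0 : 0 < η := hη0
  obtain ⟨d, hd, hdk⟩ := Metric.uniformContinuous_iff.1 huc η hη0
  filter_upwards [Ioo_mem_nhdsGT (lt_min hd one_pos)] with δ hδ
  have hδ0 : 0 < δ := hδ.1
  have hpt : ∀ x, ‖mol δ k x - k x‖ ≤ ‖K.indicator (fun _ => η) x‖ := by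
    intro x
    by_cases hx : x ∈ K
    · rw [indicator_of_mem hx, Real.norm_eq_abs, abs_of_pos hη0]
      refine norm_mol_sub_le hδ0 hk.locallyIntegrable (Eventually.of_forall fun y hy => ?_)
      rw [← dist_eq_norm]
      exact (hdk ((Metric.mem_closedBall.1 hy).trans_lt (hδ.2.trans_le (min_le_left _ _)))).le
    · have hz : ∀ y ∈ Metric.closedBall x δ, k y = 0 := by
        intro y hy
        by_contra h0
        refine hx (Metric.mem_cthickening_of_dist_le x y 1 _ (subset_tsupport k h0) ?_)
        rw [dist_comm]
        exact (Metric.mem_closedBall.1 hy).trans (hδ.2.le.trans (min_le_right _ _))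
      rw [mol_eq_zero hδ0 hz, hz x (Metric.mem_closedBall_self hδ0.le)]
      simp
  refine (eLpNorm_mono hpt).trans ?_
  rw [eLpNorm_indicator_const hK.measurableSet (by norm_num) (by norm_num)]
  simp only [Real.enorm_eq_ofReal hη0.le, ENNReal.toReal_ofNat]
  exact hη.le

/-- Continuous functions with compact support are dense in `L²`, and mollification does not increase
the norm. -/
lemma mol_tendsto_eLpNorm [CompleteSpace F] {f : Plane → F} (hf : MemLp f 2 volume) :
    Tendsto (fun δ => eLpNorm (fun x => mol δ f x - f x) 2 volume) (𝓝[>] 0) (𝓝 0) := by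
  rw [ENNReal.tendsto_nhds_zero]
  intro ε hε
  have hε3 : ε / 3 ≠ 0 := (ENNReal.div_pos hε.ne' (by norm_num)).ne'
  obtain ⟨k, hkc, hk, hkcont, hk2⟩ :=
    hf.exists_hasCompactSupport_eLpNorm_sub_le (by norm_num) hε3
  have h1 := (ENNReal.tendsto_nhds_zero.1 (mol_tendsto_eLpNorm_of_continuous hkcont hkc)) _
    hε3.bot_lt
  filter_upwards [h1, self_mem_nhdsWithin] with δ hδ hδ0
  have hδ0 : 0 < δ := hδ0
  have hfl : LocallyIntegrable f := hf.locallyIntegrable (by norm_num)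
  have hfk : MemLp (fun x => f x - k x) 2 volume := hf.sub hk2
  have e : (fun x => mol δ f x - f x) = (mol δ (fun x => f x - k x) + fun x => mol δ k x - k x)
      - fun x => f x - k x := by
    funext x
    simp only [Pi.add_apply, Pi.sub_apply]
    rw [mol_sub hδ0 hfl hkcont.locallyIntegrable]; abel
  have m1 : MemLp (mol δ (fun x => f x - k x)) 2 volume := MemLp.mol hδ0 hfk
  have m2 : MemLp (fun x => mol δ k x - k x) 2 volume := (MemLp.mol hδ0 hk2).sub hk2
  rw [e]
  calc _ ≤ eLpNorm (mol δ (fun x => f x - k x) + fun x => mol δ k x - k x) 2 volume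
        + eLpNorm (fun x => f x - k x) 2 volume :=
        eLpNorm_sub_le (m1.add m2).1 hfk.1 (by norm_num)
    _ ≤ (eLpNorm (mol δ (fun x => f x - k x)) 2 volume + ε / 3) + ε / 3 := by
        gcongr
        · exact (eLpNorm_add_le m1.1 m2.1 (by norm_num)).trans (by gcongr)
        · exact hk
    _ ≤ (ε / 3 + ε / 3) + ε / 3 := by
        gcongr
        exact (eLpNorm_mol_le hδ0 hfk).trans hk
    _ = ε := ENNReal.add_thirds ε

end Mollification
end

noncomputable section

/-! ### Calculus of weak derivatives -/

section WeakCalculus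

lemma IsWeakPartial.clm_comp {F G : Type*} [NormedAddCommGroup F] [NormedSpace ℝ F]
    [CompleteSpace F] [NormedAddCommGroup G] [NormedSpace ℝ G] [CompleteSpace G] (T : F →L[ℝ] G)
    {U : Set Plane} {i : Fin 2} {u g : Plane → F} (h : IsWeakPartial U i u g) :
    IsWeakPartial U i (fun x => T (u x)) (fun x => T (g x)) := by
  refine ⟨fun x hx => ?_, fun x hx => ?_, fun φ hφ => ?_⟩
  · obtain ⟨s, hs, hi⟩ := h.1 x hx
    exact ⟨s, hs, T.integrable_comp hi⟩
  · obtain ⟨s, hs, hi⟩ := h.2.1 x hx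
    exact ⟨s, hs, T.integrable_comp hi⟩
  · have := congrArg T (h.2.2 φ hφ)
    rw [map_neg, ← T.integral_comp_comm ((hφ.classicalPartial i).integrableOn_smul h.1),
      ← T.integral_comp_comm (hφ.integrableOn_smul h.2.1)] at this
    simpa only [map_smul] using this

lemma IsWeakPartial.add {F : Type*} [NormedAddCommGroup F] [NormedSpace ℝ F]
    {U : Set Plane} {i : Fin 2} {u g u' g' : Plane → F}
    (h : IsWeakPartial U i u g) (h' : IsWeakPartial U i u' g') :
    IsWeakPartial U i (fun x => u x + u' x) (fun x => g x + g' x) := by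
  refine ⟨h.1.add h'.1, h.2.1.add h'.2.1, fun φ hφ => ?_⟩
  simp only [smul_add]
  rw [integral_add ((hφ.classicalPartial i).integrableOn_smul h.1)
    ((hφ.classicalPartial i).integrableOn_smul h'.1),
    integral_add (hφ.integrableOn_smul h.2.1) (hφ.integrableOn_smul h'.2.1), h.2.2 φ hφ,
    h'.2.2 φ hφ]
  abel

lemma IsWeakPartial.congr_ae {F : Type*} [NormedAddCommGroup F] [NormedSpace ℝ F]
    {U : Set Plane} (hU : IsOpen U) {i : Fin 2} {u g u' g' : Plane → F}
    (h : IsWeakPartial U i u g) (hu : u =ᵐ[volume.restrict U] u')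
    (hg : g =ᵐ[volume.restrict U] g') : IsWeakPartial U i u' g' := by
  have key : ∀ {f f' : Plane → F}, f =ᵐ[volume.restrict U] f' → LocallyIntegrableOn f U →
      LocallyIntegrableOn f' U := by
    intro f f' hff hf
    rw [locallyIntegrableOn_iff hU.isLocallyClosed] at hf ⊢
    intro k hk hkc
    exact (hf k hk hkc).congr_fun_ae (ae_restrict_of_ae_restrict_of_subset hk hff)
  refine ⟨key hu h.1, key hg h.2.1, fun φ hφ => ?_⟩
  have e1 : ∫ x in U, classicalPartial i φ x • u' x = ∫ x in U, classicalPartial i φ x • u x :=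
    integral_congr_ae (hu.mono fun x hx => by simp only [hx])
  have e2 : ∫ x in U, φ x • g' x = ∫ x in U, φ x • g x :=
    integral_congr_ae (hg.mono fun x hx => by simp only [hx])
  rw [e1, e2, h.2.2 φ hφ]

lemma IsWeakPartial.conj {U : Set Plane} {i : Fin 2} {u g : Plane → ℂ}
    (h : IsWeakPartial U i u g) :
    IsWeakPartial U i (fun x => conj (u x)) (fun x => conj (g x)) :=
  h.clm_comp (Complex.conjCLE : ℂ →L[ℝ] ℂ)

lemma MemLp.conj {μ : Measure Plane} {p : ENNReal} {u : Plane → ℂ} (h : MemLp u p μ) :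
    MemLp (fun x => conj (u x)) p μ :=
  (Complex.conjCLE : ℂ →L[ℝ] ℂ).comp_memLp' h

lemma MeasureTheory.MemLp.integrable_mul_two {𝕜 : Type*} [NormedRing 𝕜] {μ : Measure Plane}
    {f g : Plane → 𝕜} (hf : MemLp f 2 μ) (hg : MemLp g 2 μ) :
    Integrable (fun x => f x * g x) μ :=
  memLp_one_iff_integrable.1 (hg.mul hf)

lemma tendsto_integral_of_eLpNorm {U : Set Plane} {ι : Type*} {l : Filter ι} {f : Plane → ℂ}
    {F : ι → Plane → ℂ} {h : Plane → ℂ} (hF : ∀ᶠ k in l, MemLp (F k) 2 volume)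
    (hf : MemLp f 2 volume) (hh : MemLp h 2 (volume.restrict U))
    (hlim : Tendsto (fun k => eLpNorm (fun x => F k x - f x) 2 volume) l (𝓝 0)) :
    Tendsto (fun k => ∫ x in U, F k x * h x) l (𝓝 (∫ x in U, f x * h x)) := by
  rw [tendsto_iff_edist_tendsto_0]
  have hb : Tendsto (fun k => eLpNorm (fun x => F k x - f x) 2 volume
      * eLpNorm h 2 (volume.restrict U)) l (𝓝 0) := by
    have := ENNReal.Tendsto.mul_const (b := eLpNorm h 2 (volume.restrict U)) hlim
      (Or.inr hh.2.ne)
    simpa using this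
  refine tendsto_of_tendsto_of_tendsto_of_le_of_le' tendsto_const_nhds hb
    (Eventually.of_forall fun k => zero_le) ?_
  filter_upwards [hF] with k hk
  have i1 := (hk.restrict U).integrable_mul_two hh
  have i2 := (hf.restrict U).integrable_mul_two hh
  have e : (∫ x in U, F k x * h x) - ∫ x in U, f x * h x
      = ∫ x in U, (F k x - f x) • h x := by
    rw [← integral_sub i1 i2]
    exact integral_congr_ae (Eventually.of_forall fun x => by simp [sub_mul])
  have hs : AEStronglyMeasurable (fun x => F k x - f x) (volume.restrict U) :=
    (hk.1.sub hf.1).restrict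
  have hle : eLpNorm (fun x => F k x - f x) 2 (volume.restrict U)
      ≤ eLpNorm (fun x => F k x - f x) 2 volume :=
    eLpNorm_mono_measure _ Measure.restrict_le_self
  have hH : eLpNorm ((fun x => F k x - f x) • h) 1 (volume.restrict U)
      ≤ eLpNorm (fun x => F k x - f x) 2 (volume.restrict U)
        * eLpNorm h 2 (volume.restrict U) :=
    eLpNorm_smul_le_mul_eLpNorm (p := 2) (q := 2) (r := 1) hh.1 hs
  rw [edist_eq_enorm_sub, e]
  refine (enorm_integral_le_lintegral_enorm _).trans ?_
  rw [eLpNorm_one_eq_lintegral_enorm] at hH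
  exact hH.trans (mul_le_mul_left hle _)

lemma exists_forall_closedBall_subset {K U : Set Plane} (hK : IsCompact K) (hU : IsOpen U)
    (h : K ⊆ U) : ∃ r > 0, ∀ x ∈ K, Metric.closedBall x r ⊆ U := by
  obtain ⟨r, hr, hrU⟩ := hK.exists_cthickening_subset_open hU h
  exact ⟨r, hr, fun x hx => (Metric.closedBall_subset_cthickening hx r).trans hrU⟩

lemma memLp_bounded_smul {U : Set Plane} {b : Plane → ℝ} (hb : Continuous b)
    (hc : HasCompactSupport b) {h : Plane → ℂ} (hh : MemLp h 2 (volume.restrict U)) :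
    MemLp (fun x => b x • h x) 2 (volume.restrict U) := by
  obtain ⟨C, hC⟩ := hb.bounded_above_of_compact_support hc
  have h1 : MemLp b ⊤ (volume.restrict U) :=
    memLp_top_of_bound hb.aestronglyMeasurable C (Eventually.of_forall hC)
  exact hh.smul h1

/-- The product rule for weak derivatives of functions in `H¹`. -/
lemma IsWeakPartial.mul {U : Set Plane} (hU : IsOpen U) {i : Fin 2} {u u' w w' : Plane → ℂ}
    (hu : IsWeakPartial U i u u') (hw : IsWeakPartial U i w w')
    (mu : MemLp u 2 (volume.restrict U)) (mu' : MemLp u' 2 (volume.restrict U))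
    (mw : MemLp w 2 (volume.restrict U)) (mw' : MemLp w' 2 (volume.restrict U)) :
    IsWeakPartial U i (fun x => u x * w x) (fun x => u x * w' x + u' x * w x) := by
  have i1 := mu.integrable_mul_two mw'
  have i2 := mu'.integrable_mul_two mw
  have j0 : IntegrableOn (fun x => u x * w x) U := mu.integrable_mul_two mw
  have j1 : IntegrableOn (fun x => u x * w' x) U := i1
  have j2 : IntegrableOn (fun x => u' x * w x) U := i2
  have j3 : IntegrableOn (fun x => u x * w' x + u' x * w x) U := j1.add j2
  refine ⟨j0.locallyIntegrableOn, j3.locallyIntegrableOn, fun φ hφ => ?_⟩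
  have mU : MemLp (U.indicator u) 2 volume := (memLp_indicator_iff_restrict hU.measurableSet).2 mu
  have mU' : MemLp (U.indicator u') 2 volume :=
    (memLp_indicator_iff_restrict hU.measurableSet).2 mu'
  have lU : LocallyIntegrable (U.indicator u) := mU.locallyIntegrable (by norm_num)
  obtain ⟨r, hr, hrU⟩ := exists_forall_closedBall_subset hφ.2.1 hU hφ.2.2
  have hφi := hφ.classicalPartial i
  have c0 := hφ.1.continuous
  have c1 := hφi.1.continuous
  have k1 := memLp_bounded_smul c1 hφi.2.1 mw
  have k2 := memLp_bounded_smul c0 hφ.2.1 mw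
  have k3 := memLp_bounded_smul c0 hφ.2.1 mw'
  have hpos : ∀ᶠ δ : ℝ in 𝓝[>] 0, 0 < δ := self_mem_nhdsWithin
  have M1 : ∀ᶠ δ : ℝ in 𝓝[>] 0, MemLp (mol δ (U.indicator u)) 2 volume :=
    hpos.mono fun δ hδ => MemLp.mol hδ mU
  have M2 : ∀ᶠ δ : ℝ in 𝓝[>] 0, MemLp (mol δ (U.indicator u')) 2 volume :=
    hpos.mono fun δ hδ => MemLp.mol hδ mU'
  have L1 := tendsto_integral_of_eLpNorm M1 mU k1 (mol_tendsto_eLpNorm mU)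
  have L2 := tendsto_integral_of_eLpNorm M2 mU' k2 (mol_tendsto_eLpNorm mU')
  have L3 := tendsto_integral_of_eLpNorm M1 mU k3 (mol_tendsto_eLpNorm mU)
  -- With `u` mollified, `φ • mol δ u` is a smooth test function for the weak derivative of `w`. On
  -- the support of `φ` the derivative of the mollification is the mollification of `u'`, so `δ → 0`
  -- in `L²` yields the product rule.
  have key : ∀ᶠ δ : ℝ in 𝓝[>] 0,
      (∫ x in U, mol δ (U.indicator u) x * (classicalPartial i φ x • w x))
        + (∫ x in U, mol δ (U.indicator u') x * (φ x • w x))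
        = - ∫ x in U, mol δ (U.indicator u) x * (φ x • w' x) := by
    filter_upwards [Ioo_mem_nhdsGT hr] with δ hδ
    have hδ0 : 0 < δ := hδ.1
    have hs : ContDiff ℝ (⊤ : ℕ∞) (mol δ (U.indicator u)) := mol_contDiff hδ0 lU
    have ht := hw.integral_complex_test (θ := fun x => φ x • mol δ (U.indicator u) x)
      (hφ.1.smul hs) hφ.2.1.smul_right
      ((tsupport_smul_subset_left φ _).trans hφ.2.2)
    rw [← integral_add ((MemLp.mol hδ0 mU).restrict U |>.integrable_mul_two k1)
      ((MemLp.mol hδ0 mU').restrict U |>.integrable_mul_two k2)]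
    refine Eq.trans ?_ (ht.trans ?_)
    · refine integral_congr_ae (Eventually.of_forall fun x => ?_)
      have e := classicalPartial_smul (hφ.1.differentiable (by simp) x)
        (hs.differentiable (by simp) x) i
      simp only
      rw [e]
      by_cases hx : x ∈ tsupport φ
      · have hb : Metric.closedBall x δ ⊆ U :=
          (Metric.closedBall_subset_closedBall hδ.2.le).trans (hrU x hx)
        rw [hu.classicalPartial_mol hU lU hδ0 hb]
        simp only [Complex.real_smul]; ring
      · rw [image_eq_zero_of_notMem_tsupport hx]
        simp only [Complex.real_smul]; push_cast; ring
    · congr 1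
      refine integral_congr_ae (Eventually.of_forall fun x => ?_)
      simp only [Complex.real_smul]; ring
  have hlim := tendsto_nhds_unique_of_eventuallyEq (L1.add L2) L3.neg key
  have res : ∀ (f h : Plane → ℂ) (b : Plane → ℝ), (∫ x in U, U.indicator f x * (b x • h x))
      = ∫ x in U, b x • (f x * h x) := by
    intro f h b
    refine setIntegral_congr_fun hU.measurableSet fun x hx => ?_
    simp only [indicator_of_mem hx, Complex.real_smul]; ring
  rw [res, res, res] at hlim
  simp only [smul_add]
  rw [integral_add (hφ.integrableOn_smul j1.locallyIntegrableOn)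
    (hφ.integrableOn_smul j2.locallyIntegrableOn), eq_sub_of_add_eq hlim]
  ring

end WeakCalculus
end

noncomputable section

/-! ### Geometry of smooth domains -/

section Geometry

lemma isOpen_annulus {D B : Set Plane} (h : IsAnnularPair D B) : IsOpen (annulus D B) :=
  h.isOpen_outer.sdiff isClosed_closure

lemma isBounded_annulus {D B : Set Plane} (h : IsAnnularPair D B) :
    Bornology.IsBounded (annulus D B) := h.isBounded_outer.subset sdiff_subset

lemma frontier_annulus_subset {D B : Set Plane} (h : IsAnnularPair D B) :
    frontier (annulus D B) ⊆ frontier D ∪ frontier B := by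
  intro x hx
  have hxA : x ∉ annulus D B := by
    rw [(isOpen_annulus h).frontier_eq] at hx; exact hx.2
  have hxc : x ∈ closure (annulus D B) := frontier_subset_closure hx
  by_cases hD : x ∈ D
  · right
    have hB : x ∈ closure B := by
      by_contra hB; exact hxA ⟨hD, hB⟩
    rw [h.isOpen_hole.frontier_eq]
    refine ⟨hB, fun hxB => ?_⟩
    obtain ⟨y, hyB, hyA⟩ := mem_closure_iff.1 hxc B h.isOpen_hole hxB
    exact hyA.2 (subset_closure hyB)
  · left
    rw [h.isOpen_outer.frontier_eq]
    exact ⟨closure_mono sdiff_subset hxc, hD⟩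

lemma frontier_outer_disjoint {D B : Set Plane} (h : IsAnnularPair D B) {x : Plane}
    (hx : x ∈ frontier D) : x ∉ D := by
  rw [h.isOpen_outer.frontier_eq] at hx; exact hx.2

/-- Along the hole the defining function changes sign. The point is that `ρ y ≤ 0` forces `y ∈
closure B`: otherwise `ρ ≥ 0` near `y`, which would make `y` a local minimum and so a critical point
of `ρ`. -/
lemma hasSmoothBoundary_annulus {D B : Set Plane} (h : IsAnnularPair D B) :
    HasSmoothBoundary (annulus D B) := by
  intro x hx
  rcases frontier_annulus_subset h hx with hxD | hxB
  · obtain ⟨N, hN, hxN, ρ, hρ, hρ', hρU⟩ := h.smooth_outer x hxD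
    refine ⟨N ∩ (closure B)ᶜ, hN.inter isClosed_closure.isOpen_compl,
      ⟨hxN, fun hB => frontier_outer_disjoint h hxD (h.closure_hole_subset hB)⟩, ρ,
      hρ.mono inter_subset_left, fun y hy => hρ' y hy.1, fun y hy => ?_⟩
    rw [← hρU y hy.1]
    exact ⟨fun hy' => hy'.1, fun hy' => ⟨hy', hy.2⟩⟩
  · obtain ⟨N, hN, hxN, ρ, hρ, hρ', hρU⟩ := h.smooth_hole x hxB
    refine ⟨N ∩ D, hN.inter h.isOpen_outer,
      ⟨hxN, h.closure_hole_subset (frontier_subset_closure hxB)⟩, fun y => -ρ y,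
      (hρ.mono inter_subset_left).neg, fun y hy => ?_, fun y hy => ?_⟩
    · rw [fderiv_fun_neg, neg_ne_zero]; exact hρ' y hy.1
    · have hc : ContinuousAt ρ y := (hρ.continuousOn.continuousAt (hN.mem_nhds hy.1))
      rw [neg_lt_zero]
      constructor
      · intro hyA
        by_contra hle
        apply hyA.2
        rw [mem_closure_iff_frequently]
        intro hev
        have hmin : IsLocalMin ρ y := by
          filter_upwards [hev, hN.mem_nhds hy.1] with z hz hzN
          have : ¬ ρ z < 0 := fun hlt => hz ((hρU z hzN).2 hlt)
          linarith
        exact hρ' y hy.1 hmin.fderiv_eq_zero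
      · intro hpos
        refine ⟨hy.2, fun hyB => ?_⟩
        rw [mem_closure_iff_frequently] at hyB
        apply hyB
        filter_upwards [hc.eventually (lt_mem_nhds hpos), hN.mem_nhds hy.1] with z hz hzN hzB
        exact lt_asymm hz ((hρU z hzN).1 hzB)

/-- The plane has an orthonormal basis on which a given nonzero functional is negative. -/
lemma exists_orthonormalBasis_neg (T : Plane →L[ℝ] ℝ) (hT : T ≠ 0) :
    ∃ b : OrthonormalBasis (Fin 2) ℝ Plane, ∀ i, T (b i) < 0 := by
  set p := T (EuclideanSpace.single 0 1)
  set q := T (EuclideanSpace.single 1 1)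
  have hTv : ∀ v : Plane, T v = v 0 * p + v 1 * q := by
    intro v
    have : v = v 0 • EuclideanSpace.single 0 1 + v 1 • EuclideanSpace.single 1 1 := by
      ext j; fin_cases j <;> simp
    conv_lhs => rw [this]
    simp [p, q]
  have hn : 0 < p ^ 2 + q ^ 2 := by
    by_contra hle
    have hp : p = 0 := by nlinarith [sq_nonneg p, sq_nonneg q]
    have hq : q = 0 := by nlinarith [sq_nonneg p, sq_nonneg q]
    exact hT (ContinuousLinearMap.ext fun v => by rw [hTv v, hp, hq]; simp)
  set m := Real.sqrt (2 * (p ^ 2 + q ^ 2))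
  have hm : 0 < m := Real.sqrt_pos.2 (by positivity)
  have hm2 : m ^ 2 = 2 * (p ^ 2 + q ^ 2) := Real.sq_sqrt (by positivity)
  -- The direction `-(p, q)` of steepest descent of `T`, rotated by `±45°` and normalized; hence `m
  -- = √2 |(p, q)|`.
  let v : Fin 2 → Plane := ![!₂[-(p - q) / m, -(p + q) / m], !₂[-(p + q) / m, -(q - p) / m]]
  have hv : Orthonormal ℝ v := by
    have hin : ∀ v w : Plane, inner ℝ v w = v 0 * w 0 + v 1 * w 1 := by
      intro v w
      simp only [PiLp.inner_apply, Fin.sum_univ_two, RCLike.inner_apply, conj_trivial]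
      ring
    rw [orthonormal_iff_ite]
    intro i j
    rw [hin]
    fin_cases i <;> fin_cases j <;> simp [v] <;> field_simp <;> (try rw [hm2]) <;> ring
  obtain ⟨b, hb⟩ := Orthonormal.exists_orthonormalBasis_extension_of_card_eq (𝕜 := ℝ) (v := v)
    (s := univ) (by simp) (hv.comp _ Subtype.val_injective)
  refine ⟨b, fun i => ?_⟩
  rw [hb i (mem_univ i), hTv]
  fin_cases i
  · have : -(p - q) / m * p + -(p + q) / m * q = -((p ^ 2 + q ^ 2) / m) := by field_simp; ring
    simp only [v]
    simp only [Fin.zero_eta, Matrix.cons_val_zero, Matrix.cons_val_one]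
    exact this.trans_lt (neg_neg_of_pos (by positivity))
  · have : -(p + q) / m * p + -(q - p) / m * q = -((p ^ 2 + q ^ 2) / m) := by field_simp; ring
    simp only [v]
    simp only [Fin.mk_one, Matrix.cons_val_zero, Matrix.cons_val_one]
    exact this.trans_lt (neg_neg_of_pos (by positivity))

/-- The interior cone condition for smooth domains. -/
lemma HasSmoothBoundary.exists_cone {A : Set Plane} (hA : IsOpen A) (hs : HasSmoothBoundary A)
    {x₀ : Plane} (hx₀ : x₀ ∈ closure A) :
    ∃ b : OrthonormalBasis (Fin 2) ℝ Plane, ∃ r > 0, ∃ l > 0, ∀ x ∈ A ∩ Metric.ball x₀ r,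
      ∀ s t : ℝ, 0 ≤ s → s ≤ l → 0 ≤ t → t ≤ l → x + (s • b 0 + t • b 1) ∈ A := by
  have hsmall : ∀ (b : OrthonormalBasis (Fin 2) ℝ Plane) (s t l : ℝ), 0 ≤ s → s ≤ l → 0 ≤ t →
      t ≤ l → ‖s • b 0 + t • b 1‖ ≤ 2 * l := by
    intro b s t l h1 h2 h3 h4
    calc _ ≤ ‖s • b 0‖ + ‖t • b 1‖ := norm_add_le _ _
      _ = s + t := by
        rw [norm_smul, norm_smul, b.orthonormal.1, b.orthonormal.1, Real.norm_of_nonneg h1,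
          Real.norm_of_nonneg h3, mul_one, mul_one]
      _ ≤ _ := by linarith
  have hball : ∀ (b : OrthonormalBasis (Fin 2) ℝ Plane) (R : ℝ), ∀ x ∈ Metric.ball x₀ (R / 4),
      ∀ s t : ℝ, 0 ≤ s → s ≤ R / 4 → 0 ≤ t → t ≤ R / 4 →
      x + (s • b 0 + t • b 1) ∈ Metric.ball x₀ R := by
    intro b R x hx s t h1 h2 h3 h4
    have := hsmall b s t _ h1 h2 h3 h4
    rw [Metric.mem_ball, dist_eq_norm] at hx ⊢
    calc _ = ‖(x - x₀) + (s • b 0 + t • b 1)‖ := by congr 1; abel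
      _ ≤ ‖x - x₀‖ + ‖s • b 0 + t • b 1‖ := norm_add_le _ _
      _ < R := by linarith
  by_cases hxA : x₀ ∈ A
  · obtain ⟨R, hR, hRA⟩ := Metric.isOpen_iff.1 hA x₀ hxA
    exact ⟨EuclideanSpace.basisFun (Fin 2) ℝ, R / 4, by positivity, R / 4, by positivity,
      fun x hx s t h1 h2 h3 h4 => hRA (hball _ R x hx.2 s t h1 h2 h3 h4)⟩
  · have hf : x₀ ∈ frontier A := by rw [hA.frontier_eq]; exact ⟨hx₀, hxA⟩
    obtain ⟨N, hN, hxN, ρ, hρ, hρ', hρU⟩ := hs x₀ hf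
    obtain ⟨b, hb⟩ := exists_orthonormalBasis_neg _ (hρ' x₀ hxN)
    have hcf : ContinuousAt (fderiv ℝ ρ) x₀ :=
      (hρ.continuousOn_fderiv_of_isOpen hN (by simp)).continuousAt (hN.mem_nhds hxN)
    have hev : ∀ i, ∀ᶠ y in 𝓝 x₀, fderiv ℝ ρ y (b i) < 0 := fun i =>
      (hcf.clm_apply continuousAt_const).eventually (gt_mem_nhds (hb i))
    obtain ⟨R, hR, hRN⟩ := Metric.eventually_nhds_iff_ball.1
      (((hev 0).and (hev 1)).and (hN.mem_nhds hxN))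
    refine ⟨b, R / 4, by positivity, R / 4, by positivity, fun x hx s t h1 h2 h3 h4 => ?_⟩
    have hz := hball b R x hx.2 s t h1 h2 h3 h4
    have hxR : x ∈ Metric.ball x₀ R := Metric.ball_subset_ball (by linarith) hx.2
    -- Near `x₀` the function `ρ` decreases in both basis directions, so moving along the cone keeps
    -- it negative.
    obtain ⟨ξ, hξ, he⟩ := domain_mvt (f := ρ) (f' := fderiv ℝ ρ) (s := Metric.ball x₀ R)
      (fun y hy => (((hρ.contDiffAt (hN.mem_nhds (hRN y hy).2)).differentiableAt
        (by simp)).hasFDerivAt).hasFDerivWithinAt) (convex_ball _ _) hxR hz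
    have hξR := (convex_ball x₀ R).segment_subset hxR hz hξ
    have hneg : fderiv ℝ ρ ξ (x + (s • b 0 + t • b 1) - x) ≤ 0 := by
      rw [add_sub_cancel_left, map_add, map_smul, map_smul, smul_eq_mul, smul_eq_mul]
      have := (hRN ξ hξR).1
      nlinarith [this.1, this.2]
    have hρx : ρ x < 0 := (hρU x (hRN x hxR).2).1 hx.1
    exact (hρU _ (hRN _ hz).2).2 (by linarith)

/-- The uniform exterior ball condition for bounded smooth domains. -/
lemma HasSmoothBoundary.exists_exterior_ball {A : Set Plane} (hA : IsOpen A)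
    (hb : Bornology.IsBounded A) (hs : HasSmoothBoundary A) :
    ∃ r > 0, ∀ x ∈ frontier A, ∃ y, dist y x = r ∧ Disjoint (Metric.ball y r) A := by
  have hK : IsCompact (frontier A) :=
    Metric.isCompact_of_isClosed_isBounded isClosed_frontier
      (hb.closure.subset frontier_subset_closure)
  refine hK.induction_on (p := fun K => ∃ r > 0, ∀ x ∈ K, ∃ y, dist y x = r ∧
    Disjoint (Metric.ball y r) A) ⟨1, one_pos, by simp⟩ ?_ ?_ ?_
  · rintro s t hst ⟨r, hr, h⟩
    exact ⟨r, hr, fun x hx => h x (hst hx)⟩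
  -- A smaller ball tangent at the same boundary point lies inside the larger one, so two radii can
  -- be replaced by their minimum.
  · have shrink : ∀ {r r' : ℝ} {x : Plane}, 0 < r' → r' ≤ r →
        (∃ y, dist y x = r ∧ Disjoint (Metric.ball y r) A) →
        ∃ y, dist y x = r' ∧ Disjoint (Metric.ball y r') A := by
      rintro r r' x hr' hle ⟨y, hy, hd⟩
      have hr : 0 < r := hr'.trans_le hle
      rw [dist_eq_norm] at hy
      refine ⟨x + (r' / r) • (y - x), ?_, hd.mono_left (Metric.ball_subset_ball' ?_)⟩
      · rw [dist_eq_norm, add_sub_cancel_left, norm_smul, hy, Real.norm_of_nonneg (by positivity)]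
        field_simp
      · rw [dist_eq_norm]
        have : x + (r' / r) • (y - x) - y = (-(1 - r' / r)) • (y - x) := by module
        rw [this, norm_smul, hy, norm_neg, Real.norm_of_nonneg (by
          rw [sub_nonneg]; exact (div_le_one hr).2 hle)]
        field_simp; linarith
    rintro s t ⟨r, hr, h⟩ ⟨r', hr', h'⟩
    refine ⟨min r r', lt_min hr hr', ?_⟩
    rintro x (hx | hx)
    · exact shrink (lt_min hr hr') (min_le_left _ _) (h x hx)
    · exact shrink (lt_min hr hr') (min_le_right _ _) (h' x hx)
  · intro x₀ hx₀
    obtain ⟨N, hN, hxN, ρ, hρ, hρ', hρU⟩ := hs x₀ hx₀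
    have hcd : ContDiffAt ℝ 1 (fderiv ℝ ρ) x₀ :=
      ((hρ.contDiffAt (hN.mem_nhds hxN)).of_le (m := ((2 : ℕ∞) : WithTop ℕ∞)) (by exact_mod_cast le_top)).fderiv_right
        (by norm_num)
    obtain ⟨C, T, hT, hLip⟩ := hcd.exists_lipschitzOnWith
    set m := ‖fderiv ℝ ρ x₀‖ / 2
    have hm0 : 0 < ‖fderiv ℝ ρ x₀‖ := norm_pos_iff.2 (hρ' x₀ hxN)
    have hm : 0 < m := half_pos hm0
    have hev : ∀ᶠ y in 𝓝 x₀, m < ‖fderiv ℝ ρ y‖ :=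
      hcd.continuousAt.norm.eventually (lt_mem_nhds (half_lt_self hm0))
    obtain ⟨R, hR, hRN⟩ := Metric.eventually_nhds_iff_ball.1
      ((hev.and (hN.mem_nhds hxN)).and hT)
    refine ⟨frontier A ∩ Metric.ball x₀ (R / 3),
      inter_mem_nhdsWithin _ (Metric.ball_mem_nhds _ (by positivity)),
      min (R / 6) (m / (2 * (C + 1))), lt_min (by positivity) (by positivity), ?_⟩
    rintro x₁ ⟨hx₁, hx₁b⟩
    -- `R / 6` keeps the exterior ball where the bounds on `ρ` hold. The second entry gives `2 r C ≤
    -- m`, where `C` is a Lipschitz constant of `fderiv ℝ ρ` and `m` a lower bound of its norm.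
    set r := min (R / 6) (m / (2 * ((C : ℝ) + 1)))
    have hr : 0 < r := lt_min (by positivity) (by positivity)
    have hrR : r ≤ R / 6 := min_le_left _ _
    have hrC : 2 * r * C ≤ m := by
      have h1 : r ≤ m / (2 * ((C : ℝ) + 1)) := min_le_right _ _
      rw [le_div_iff₀ (by positivity)] at h1
      nlinarith [C.2]
    have hx₁R : x₁ ∈ Metric.ball x₀ R := Metric.ball_subset_ball (by linarith) hx₁b
    obtain ⟨⟨hm1, hx₁N⟩, hx₁T⟩ := hRN x₁ hx₁R
    have hρx₁ : ρ x₁ = 0 := by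
      have hx₁A : x₁ ∉ A := by rw [hA.frontier_eq] at hx₁; exact hx₁.2
      have h1 : ¬ ρ x₁ < 0 := fun hlt => hx₁A ((hρU x₁ hx₁N).2 hlt)
      have h2 : ¬ 0 < ρ x₁ := fun hpos => by
        have hc : ContinuousAt ρ x₁ := hρ.continuousOn.continuousAt (hN.mem_nhds hx₁N)
        have := mem_closure_iff_frequently.1 (frontier_subset_closure hx₁)
        apply this
        filter_upwards [hc.eventually (lt_mem_nhds hpos), hN.mem_nhds hx₁N] with z hz hzN hzA
        exact lt_asymm hz ((hρU z hzN).1 hzA)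
      linarith
    set g : Plane := (InnerProductSpace.toDual ℝ Plane).symm (fderiv ℝ ρ x₁)
    have hg : ∀ v, fderiv ℝ ρ x₁ v = inner ℝ g v := fun v => by
      rw [InnerProductSpace.toDual_symm_apply]
    have hgn : ‖g‖ = ‖fderiv ℝ ρ x₁‖ := LinearIsometryEquiv.norm_map _ _
    have hg0 : 0 < ‖g‖ := by rw [hgn]; linarith
    refine ⟨x₁ + (r / ‖g‖) • g, ?_, ?_⟩
    · rw [dist_eq_norm, add_sub_cancel_left, norm_smul, Real.norm_of_nonneg (by positivity)]
      field_simp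
    · rw [Set.disjoint_left]
      intro z hz hzA
      set w := z - x₁
      have hzw : z = x₁ + w := by simp [w]
      have h1 : ‖w - (r / ‖g‖) • g‖ < r := by
        rw [Metric.mem_ball, dist_eq_norm] at hz
        have : w - (r / ‖g‖) • g = z - (x₁ + (r / ‖g‖) • g) := by simp only [w]; abel
        rwa [this]
      have hrg : ‖(r / ‖g‖) • g‖ = r := by
        rw [norm_smul, Real.norm_of_nonneg (by positivity)]; field_simp
      have hw2 : ‖w‖ < 2 * r := by
        calc ‖w‖ = ‖(w - (r / ‖g‖) • g) + (r / ‖g‖) • g‖ := by rw [sub_add_cancel]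
          _ ≤ _ := norm_add_le _ _
          _ < 2 * r := by rw [hrg]; linarith
      -- Membership in the ball of radius `r` about `x₁ + r g / |g|`, after expanding the square.
      -- Below, `ρ z < 0` and the Lipschitz gradient give `⟨g, w⟩ < C |w|²`, and the two contradict
      -- `2 r C ≤ m ≤ |g|`.
      have h2 : ‖g‖ * ‖w‖ ^ 2 < 2 * r * inner ℝ g w := by
        have h3 := norm_sub_sq_real w ((r / ‖g‖) • g)
        have h4 : ‖w - (r / ‖g‖) • g‖ ^ 2 < r ^ 2 := by gcongr
        rw [h3, hrg, inner_smul_right, real_inner_comm] at h4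
        have h5 : ‖w‖ ^ 2 < 2 * (r / ‖g‖ * inner ℝ g w) := by linarith
        calc ‖g‖ * ‖w‖ ^ 2 < ‖g‖ * (2 * (r / ‖g‖ * inner ℝ g w)) := by gcongr
          _ = _ := by field_simp
      have hzR : z ∈ Metric.ball x₀ R := by
        rw [Metric.mem_ball] at hx₁b ⊢
        calc dist z x₀ ≤ dist z x₁ + dist x₁ x₀ := dist_triangle _ _ _
          _ < R := by rw [dist_eq_norm]; linarith
      obtain ⟨ξ, hξ, he⟩ := domain_mvt (f := ρ) (f' := fderiv ℝ ρ) (s := Metric.ball x₀ R)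
        (fun y hy => (((hρ.contDiffAt (hN.mem_nhds (hRN y hy).1.2)).differentiableAt
          (by simp)).hasFDerivAt).hasFDerivWithinAt) (convex_ball _ _) hx₁R hzR
      have hξR := (convex_ball x₀ R).segment_subset hx₁R hzR hξ
      have hξ1 : ‖ξ - x₁‖ ≤ ‖w‖ := by
        obtain ⟨θ, hθ, rfl⟩ := (segment_eq_image' ℝ x₁ z ▸ hξ)
        rw [add_sub_cancel_left, norm_smul, Real.norm_of_nonneg hθ.1]
        exact mul_le_of_le_one_left (norm_nonneg _) hθ.2
      have h6 : |fderiv ℝ ρ ξ w - fderiv ℝ ρ x₁ w| ≤ C * ‖w‖ ^ 2 := by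
        have := hLip.dist_le_mul ξ (hRN ξ hξR).2 x₁ hx₁T
        rw [dist_eq_norm, dist_eq_norm] at this
        calc _ = ‖(fderiv ℝ ρ ξ - fderiv ℝ ρ x₁) w‖ := rfl
          _ ≤ ‖fderiv ℝ ρ ξ - fderiv ℝ ρ x₁‖ * ‖w‖ := ContinuousLinearMap.le_opNorm _ _
          _ ≤ (C * ‖w‖) * ‖w‖ := by
            gcongr
            exact this.trans (by gcongr)
          _ = _ := by ring
      have hρz : ρ z < 0 := (hρU z (hRN z hzR).1.2).1 hzA
      rw [hρx₁, sub_zero] at he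
      have h7 := neg_abs_le (fderiv ℝ ρ ξ w - fderiv ℝ ρ x₁ w)
      rw [hg w] at h6 h7
      have h8 : fderiv ℝ ρ ξ w = ρ z := he.symm
      rw [h8] at h6 h7
      have h9 : inner ℝ g w < C * ‖w‖ ^ 2 := by linarith
      have h10 : m * ‖w‖ ^ 2 ≤ ‖g‖ * ‖w‖ ^ 2 := by
        rw [hgn]; gcongr
      nlinarith [sq_nonneg ‖w‖]

end Geometry
end

noncomputable section

/-! ### The embedding of `H¹` into `L⁴` -/

section Sobolev

lemma exists_coordinates (b : OrthonormalBasis (Fin 2) ℝ Plane) :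
    MeasurePreserving (fun p : ℝ × ℝ => p.1 • b 0 + p.2 • b 1) (volume.prod volume) volume := by
  have h1 := (volume_preserving_finTwoArrow ℝ).symm
  have h2 := PiLp.volume_preserving_toLp (Fin 2)
  have h3 := b.measurePreserving_repr_symm
  have h := h3.comp (h2.comp h1)
  refine (congrArg (fun f => MeasurePreserving f (volume : Measure (ℝ × ℝ)) volume) ?_).mp h
  funext p
  simp only [Function.comp_apply]
  rw [← b.sum_repr_symm, Fin.sum_univ_two]
  rfl

/-- A function bounded by its integrals along two orthogonal directions is square integrable. -/
lemma setLIntegral_sq_le_of_line_bounds (b : OrthonormalBasis (Fin 2) ℝ Plane) {S : Set Plane}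
    (hS : MeasurableSet S) {G h : Plane → ENNReal} (hh : Measurable h)
    (hG : ∀ x ∈ S, ∀ i, G x ≤ ∫⁻ s : ℝ, h (x + s • b i)) :
    ∫⁻ x in S, G x ^ 2 ≤ (∫⁻ x, h x) ^ 2 := by
  set Ψ : ℝ × ℝ → Plane := fun p => p.1 • b 0 + p.2 • b 1
  have hΨ : MeasurePreserving Ψ (volume.prod volume) volume := exists_coordinates b
  have hHm : ∀ i, Measurable (fun x => ∫⁻ s : ℝ, h (x + s • b i)) := by
    intro i
    refine Measurable.lintegral_prod_right' (f := fun p : Plane × ℝ => h (p.1 + p.2 • b i)) ?_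
    exact hh.comp (by fun_prop)
  have hΨm : Measurable fun p : ℝ × ℝ => h (Ψ p) := hh.comp hΨ.measurable
  calc ∫⁻ x in S, G x ^ 2
      ≤ ∫⁻ x in S, (∫⁻ s : ℝ, h (x + s • b 0)) * ∫⁻ s : ℝ, h (x + s • b 1) := by
        refine setLIntegral_mono' hS fun x hx => ?_
        rw [sq]
        exact mul_le_mul' (hG x hx 0) (hG x hx 1)
    _ ≤ ∫⁻ x, (∫⁻ s : ℝ, h (x + s • b 0)) * ∫⁻ s : ℝ, h (x + s • b 1) :=
        setLIntegral_le_lintegral _ _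
    _ = ∫⁻ p : ℝ × ℝ, (∫⁻ s : ℝ, h (Ψ p + s • b 0)) * (∫⁻ s : ℝ, h (Ψ p + s • b 1))
        ∂(volume.prod volume) := (hΨ.lintegral_comp ((hHm 0).mul (hHm 1))).symm
    -- A line integral forgets the coordinate it runs over, so the product separates the variables.
    _ = ∫⁻ p : ℝ × ℝ, (∫⁻ s : ℝ, h (Ψ (p.1, s))) * (∫⁻ s : ℝ, h (Ψ (s, p.2)))
        ∂(volume.prod volume) := by
        refine lintegral_congr fun p => ?_
        rw [mul_comm]
        congr 1
        · rw [← lintegral_add_left_eq_self (fun s => h (Ψ (p.1, s))) p.2]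
          refine lintegral_congr fun s => ?_
          simp only [Ψ]; congr 1; module
        · rw [← lintegral_add_left_eq_self (fun s => h (Ψ (s, p.2))) p.1]
          refine lintegral_congr fun s => ?_
          simp only [Ψ]; congr 1; module
    _ = (∫⁻ a, ∫⁻ s : ℝ, h (Ψ (a, s))) * ∫⁻ c, ∫⁻ s : ℝ, h (Ψ (s, c)) :=
        lintegral_prod_mul hΨm.lintegral_prod_right'.aemeasurable
          hΨm.lintegral_prod_left'.aemeasurable
    _ = (∫⁻ x, h x) ^ 2 := by
        rw [sq]
        congr 1
        · rw [← lintegral_prod _ hΨm.aemeasurable, hΨ.lintegral_comp hh]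
        · rw [← lintegral_prod_symm _ hΨm.aemeasurable, hΨ.lintegral_comp hh]

/-- The fundamental theorem of calculus for `(s / L - 1) f(s)`, which is `-f 0` at `0` and vanishes
at `L`. The weight has modulus at most one. -/
lemma le_integral_of_abs_deriv_le {L : ℝ} (hL : 0 < L) {f f' g : ℝ → ℝ}
    (hf : ∀ s ∈ Icc 0 L, HasDerivAt f (f' s) s) (hfc : Continuous f) (hf'c : Continuous f')
    (hgc : Continuous g) (hg : ∀ s ∈ Icc 0 L, |f' s| + L⁻¹ * f s ≤ g s) :
    f 0 ≤ ∫ s in (0 : ℝ)..L, g s := by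
  have hd : ∀ s ∈ uIcc 0 L, HasDerivAt (fun s => L⁻¹ * (s - L) * f s)
      (L⁻¹ * f s + L⁻¹ * (s - L) * f' s) s := by
    intro s hs
    rw [uIcc_of_le hL.le] at hs
    have h1 : HasDerivAt (fun s => L⁻¹ * (s - L)) L⁻¹ s := by
      simpa using ((hasDerivAt_id s).sub_const L).const_mul L⁻¹
    exact h1.mul (hf s hs)
  have hc : Continuous fun s => L⁻¹ * f s + L⁻¹ * (s - L) * f' s := by fun_prop
  have h0 := intervalIntegral.integral_eq_sub_of_hasDerivAt hd (hc.intervalIntegrable _ _)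
  have h1 : f 0 = ∫ s in (0 : ℝ)..L, (L⁻¹ * f s + L⁻¹ * (s - L) * f' s) := by
    rw [h0]; field_simp; ring
  rw [h1]
  refine intervalIntegral.integral_mono_on hL.le (hc.intervalIntegrable _ _)
    (hgc.intervalIntegrable _ _) fun s hs => ?_
  refine le_trans ?_ (hg s hs)
  have h2 : |L⁻¹ * (s - L)| ≤ 1 := by
    rw [abs_mul, abs_of_pos (inv_pos.2 hL), abs_of_nonpos (by linarith [hs.2]), neg_sub,
      inv_mul_le_iff₀ hL]
    linarith [hs.1]
  have h3 : L⁻¹ * (s - L) * f' s ≤ |f' s| := by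
    calc _ ≤ |L⁻¹ * (s - L) * f' s| := le_abs_self _
      _ = |L⁻¹ * (s - L)| * |f' s| := abs_mul _ _
      _ ≤ _ := mul_le_of_le_one_left (abs_nonneg _) h2
  linarith

lemma lintegral_enorm_sq_eq {F : Type*} [NormedAddCommGroup F] (f : Plane → F)
    (μ : Measure Plane) : ∫⁻ x, ‖f x‖ₑ ^ 2 ∂μ = eLpNorm f 2 μ ^ 2 := by
  have := eLpNorm_nnreal_pow_eq_lintegral (f := f) (μ := μ) (p := 2) (by norm_num)
  simp only [NNReal.coe_ofNat, ENNReal.coe_ofNat] at this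
  have e : ∀ z : ENNReal, z ^ (2 : ℝ) = z ^ 2 := fun z => by
    rw [← ENNReal.rpow_natCast]; norm_num
  simp only [e] at this
  exact this.symm

lemma fderiv_apply_eq_sum_partial {F : Type*} [NormedAddCommGroup F] [NormedSpace ℝ F]
    (f : Plane → F) (x v : Plane) : fderiv ℝ f x v = ∑ k, v k • classicalPartial k f x := by
  have : v = ∑ k, v k • EuclideanSpace.single k (1 : ℝ) := by
    ext j; fin_cases j <;> simp [Fin.sum_univ_two]
  conv_lhs => rw [this]
  simp [classicalPartial]

/-- The derivative of `|w|²` along `e` is at most `2|w|(|g₀| + |g₁|) ≤ 2|w|² + |g₀|² + |g₁|²`; hence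
the constant `L⁻¹ + 2`. The derivatives of `w` have to agree with `g` on the segment only, which
allows `g` to be a mollified weak gradient. -/
lemma sq_norm_le_line_integral {w : Plane → ℂ} (hw : ContDiff ℝ 1 w) {g : Fin 2 → Plane → ℂ}
    (hg : ∀ k, Continuous (g k)) {L : ℝ} (hL : 0 < L) {x e : Plane} (he : ‖e‖ = 1)
    (hx : ∀ s ∈ Icc 0 L, ∀ k, classicalPartial k w (x + s • e) = g k (x + s • e)) :
    ENNReal.ofReal (‖w x‖ ^ 2) ≤ ∫⁻ s : ℝ, ENNReal.ofReal
      ((L⁻¹ + 2) * ‖w (x + s • e)‖ ^ 2 + ∑ k, ‖g k (x + s • e)‖ ^ 2) := by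
  have hline : ∀ s : ℝ, HasDerivAt (fun s : ℝ => x + s • e) e s := fun s => by
    simpa using ((hasDerivAt_id s).smul_const e).const_add x
  have hwd : ∀ s : ℝ, HasDerivAt (fun s : ℝ => w (x + s • e)) (fderiv ℝ w (x + s • e) e) s :=
    fun s => ((hw.differentiable (by norm_num) _).hasFDerivAt).comp_hasDerivAt s (hline s)
  have hfd : ∀ s : ℝ, HasDerivAt (fun s : ℝ => ‖w (x + s • e)‖ ^ 2)
      (2 * inner ℝ (w (x + s • e)) (fderiv ℝ w (x + s • e) e)) s := fun s => (hwd s).norm_sq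
  have hlc : Continuous fun s : ℝ => x + s • e := by fun_prop
  have hwc : Continuous fun s : ℝ => w (x + s • e) := hw.continuous.comp hlc
  have hdc : Continuous fun s : ℝ => fderiv ℝ w (x + s • e) e :=
    ((hw.continuous_fderiv (by norm_num)).comp hlc).clm_apply continuous_const
  have hgc : ∀ k, Continuous fun s : ℝ => g k (x + s • e) := fun k => (hg k).comp hlc
  set G : ℝ → ℝ := fun s => (L⁻¹ + 2) * ‖w (x + s • e)‖ ^ 2 + ∑ k, ‖g k (x + s • e)‖ ^ 2
  have hGc : Continuous G := by
    refine (continuous_const.mul (hwc.norm.pow 2)).add ?_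
    exact continuous_finsetSum _ fun k _ => (hgc k).norm.pow 2
  have hG0 : ∀ s, 0 ≤ G s := fun s => by simp only [G]; positivity
  have hek : ∀ k, |e k| ≤ 1 := fun k => he ▸ abs_coord_le e k
  have h1 := le_integral_of_abs_deriv_le hL (fun s _ => hfd s) (hwc.norm.pow 2)
    (continuous_const.mul (hwc.inner hdc)) hGc (fun s hs => by
      have hD : ‖fderiv ℝ w (x + s • e) e‖ ≤ ∑ k, ‖g k (x + s • e)‖ := by
        rw [fderiv_apply_eq_sum_partial]
        refine (norm_sum_le _ _).trans (Finset.sum_le_sum fun k _ => ?_)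
        rw [hx s hs k, norm_smul, Real.norm_eq_abs]
        exact mul_le_of_le_one_left (norm_nonneg _) (hek k)
      have hI : |2 * inner ℝ (w (x + s • e)) (fderiv ℝ w (x + s • e) e)|
          ≤ 2 * (‖w (x + s • e)‖ * ∑ k, ‖g k (x + s • e)‖) := by
        rw [abs_mul, abs_two]
        gcongr
        exact (abs_real_inner_le_norm _ _).trans (by gcongr)
      simp only [G, Fin.sum_univ_two] at hI ⊢
      nlinarith [sq_nonneg (‖w (x + s • e)‖ - ‖g 0 (x + s • e)‖),
        sq_nonneg (‖w (x + s • e)‖ - ‖g 1 (x + s • e)‖)])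
  simp only [zero_smul, add_zero] at h1
  calc ENNReal.ofReal (‖w x‖ ^ 2) ≤ ENNReal.ofReal (∫ s in (0 : ℝ)..L, G s) :=
        ENNReal.ofReal_le_ofReal h1
    _ = ∫⁻ s in Ioc 0 L, ENNReal.ofReal (G s) := by
        rw [intervalIntegral.integral_of_le hL.le]
        exact ofReal_integral_eq_lintegral_ofReal
          ((hGc.intervalIntegrable 0 L).1) (Eventually.of_forall hG0)
    _ ≤ _ := setLIntegral_le_lintegral _ _

/-- For a mollification `w`, both directions of the cone bound `|w|²` by line integrals of `|w|² +
|∇w|²`, up to constants. The product of the two bounds integrates to the square of an `H¹` quantity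
that does not depend on `δ`, and Fatou's lemma passes to `u`. -/
lemma MemH1.lintegral_pow_four_lt_top_of_cone {A : Set Plane} (hA : IsOpen A) {u : Plane → ℂ}
    (hu : MemH1 A u) (b : OrthonormalBasis (Fin 2) ℝ Plane) {S : Set Plane}
    (hS : MeasurableSet S) (hSA : S ⊆ A) {l : ℝ} (hl : 0 < l)
    (hcone : ∀ x ∈ S, ∀ s t : ℝ, 0 ≤ s → s ≤ l → 0 ≤ t → t ≤ l →
      x + (s • b 0 + t • b 1) ∈ A) :
    ∫⁻ x in S, ‖u x‖ₑ ^ 4 < ⊤ := by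
  -- Shifting by `δ • q` moves the ball of radius `δ` into the quadrant spanned by `b`, so the
  -- mollification only sees values of `u` in `A`.
  set q : Plane := b 0 + b 1
  set U := A.indicator u
  set g : Fin 2 → Plane → ℂ := fun k => A.indicator fun x => weakGrad A u x k
  have mU : MemLp U 2 volume := (memLp_indicator_iff_restrict hA.measurableSet).2 hu.1
  have mg : ∀ k, MemLp (g k) 2 volume := fun k =>
    (memLp_indicator_iff_restrict hA.measurableSet).2 (hu.memLp_weakGrad hA k)
  have lU : LocallyIntegrable U := mU.locallyIntegrable (by norm_num)
  have lg : ∀ k, LocallyIntegrable (g k) := fun k => (mg k).locallyIntegrable (by norm_num)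
  -- With `s ≤ l / 2` and `δ ≤ l / 4` the coordinates used, at most `s + 2δ`, stay below `l`.
  set L := l / 2
  have hL : 0 < L := half_pos hl
  have hLl : L = l / 2 := rfl
  set c : ENNReal := ENNReal.ofReal (L⁻¹ + 2)
  set M : ENNReal := c * eLpNorm U 2 volume ^ 2 + ∑ k, eLpNorm (g k) 2 volume ^ 2
  have hM : M < ⊤ := by
    refine ENNReal.add_lt_top.2 ⟨ENNReal.mul_lt_top ENNReal.ofReal_lt_top
      (ENNReal.pow_lt_top mU.2), ENNReal.sum_lt_top.2 fun k _ => ENNReal.pow_lt_top (mg k).2⟩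
  have key : ∀ δ : ℝ, 0 < δ → δ ≤ l / 4 →
      ∫⁻ x in S, ‖mol δ U (x + δ • q)‖ₑ ^ 4 ≤ M ^ 2 := by
    intro δ hδ hδl
    have hcd : ContDiff ℝ (⊤ : ℕ∞) (mol δ U) := mol_contDiff hδ lU
    have hgc : ∀ k, Continuous (mol δ (g k)) := fun k => (mol_contDiff hδ (lg k)).continuous
    set w : Plane → ℂ := fun x => mol δ U (x + δ • q)
    set G : Fin 2 → Plane → ℂ := fun k x => mol δ (g k) (x + δ • q)
    have hw : ContDiff ℝ 1 w :=
      (hcd.of_le (by exact_mod_cast le_top)).comp (contDiff_id.add contDiff_const)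
    have hG : ∀ k, Continuous (G k) := fun k =>
      (hgc k).comp (continuous_id.add continuous_const)
    have hpw : ∀ k x, classicalPartial k w x = classicalPartial k (mol δ U) (x + δ • q) := by
      intro k x
      simp only [classicalPartial, w]
      rw [fderiv_comp_add_right]
    set h : Plane → ENNReal := fun x => ENNReal.ofReal
      ((L⁻¹ + 2) * ‖w x‖ ^ 2 + ∑ k, ‖G k x‖ ^ 2)
    have hhm : Measurable h := by
      refine (Continuous.measurable ?_).ennreal_ofReal
      refine (continuous_const.mul (hw.continuous.norm.pow 2)).add ?_
      exact continuous_finsetSum _ fun k _ => (hG k).norm.pow 2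
    have hball : ∀ x ∈ S, ∀ i, ∀ s ∈ Icc 0 L,
        Metric.closedBall (x + s • b i + δ • q) δ ⊆ A := by
      intro x hx i s hs y hy
      set z := y - (x + s • b i + δ • q)
      have hz : ‖z‖ ≤ δ := by rwa [Metric.mem_closedBall, dist_eq_norm] at hy
      have hzb : ∀ j, |inner ℝ (b j) z| ≤ δ := fun j =>
        (abs_real_inner_le_norm _ _).trans (by rw [b.orthonormal.1, one_mul]; exact hz)
      have hrep : z = inner ℝ (b 0) z • b 0 + inner ℝ (b 1) z • b 1 := by
        have := b.sum_repr' z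
        rw [Fin.sum_univ_two] at this
        exact this.symm
      have hy' : y = x + s • b i + δ • q + z := by simp [z]
      have b0 := abs_le.1 (hzb 0)
      have b1 := abs_le.1 (hzb 1)
      fin_cases i
      · have := hcone x hx (s + δ + inner ℝ (b 0) z) (δ + inner ℝ (b 1) z)
          (by linarith [hs.1]) (by linarith [hs.2]) (by linarith) (by linarith)
        rw [hy']
        convert this using 1
        conv_lhs => rw [hrep]
        simp only [Fin.zero_eta, q]; module
      · have := hcone x hx (δ + inner ℝ (b 0) z) (s + δ + inner ℝ (b 1) z)
          (by linarith) (by linarith) (by linarith [hs.1]) (by linarith [hs.2])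
        rw [hy']
        convert this using 1
        conv_lhs => rw [hrep]
        simp only [Fin.mk_one, q]; module
    have hline : ∀ x ∈ S, ∀ i, ENNReal.ofReal (‖w x‖ ^ 2) ≤ ∫⁻ s : ℝ, h (x + s • b i) := by
      intro x hx i
      refine sq_norm_le_line_integral hw hG hL (b.orthonormal.1 i) fun s hs k => ?_
      rw [hpw]
      exact (hu.isWeakPartial k).classicalPartial_mol hA lU hδ (hball x hx i s hs)
    have h2 := setLIntegral_sq_le_of_line_bounds b hS hhm hline
    have e4 : ∀ z : ℂ, ENNReal.ofReal (‖z‖ ^ 2) = ‖z‖ₑ ^ 2 := fun z => by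
      rw [ENNReal.ofReal_pow (norm_nonneg _), ofReal_norm]
    have hsum : ∫⁻ x, h x ≤ M := by
      have hpt : ∀ x, h x = c * ‖w x‖ₑ ^ 2 + ∑ k, ‖G k x‖ₑ ^ 2 := by
        intro x
        simp only [h]
        rw [ENNReal.ofReal_add (by positivity) (by positivity),
          ENNReal.ofReal_mul (by positivity), e4, ENNReal.ofReal_sum_of_nonneg (by intros; positivity)]
        simp only [e4, c]
      have hwm : Measurable fun x => ‖w x‖ₑ ^ 2 := (hw.continuous.measurable.enorm).pow_const 2
      have hGm : ∀ k, Measurable fun x => ‖G k x‖ₑ ^ 2 := fun k =>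
        ((hG k).measurable.enorm).pow_const 2
      simp_rw [hpt]
      rw [lintegral_add_left (hwm.const_mul c), lintegral_const_mul c hwm,
        lintegral_finsetSum _ fun k _ => hGm k]
      have hb : ∀ (f : Plane → ℂ), MemLp f 2 volume →
          ∫⁻ x, ‖mol δ f (x + δ • q)‖ₑ ^ 2 ≤ eLpNorm f 2 volume ^ 2 := by
        intro f hf
        rw [lintegral_add_right_eq_self (fun x => ‖mol δ f x‖ₑ ^ 2) (δ • q),
          lintegral_enorm_sq_eq]
        gcongr
        exact eLpNorm_mol_le hδ hf
      exact add_le_add (mul_le_mul_right (hb U mU) c)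
        (Finset.sum_le_sum fun k _ => hb (g k) (mg k))
    calc _ = ∫⁻ x in S, (ENNReal.ofReal (‖w x‖ ^ 2)) ^ 2 := by
          refine lintegral_congr fun x => ?_
          rw [e4, ← pow_mul]
      _ ≤ _ := h2.trans (by gcongr)
  have hlim : ∀ᵐ x ∂(volume.restrict S), ‖u x‖ₑ ^ 4
      = liminf (fun δ : ℝ => ‖mol δ U (x + δ • q)‖ₑ ^ 4) (𝓝[>] 0) := by
    filter_upwards [ae_restrict_of_ae (mol_tendsto_ae lU q), ae_restrict_mem hS] with x hx hxS
    have : Tendsto (fun δ : ℝ => ‖mol δ U (x + δ • q)‖ₑ ^ 4) (𝓝[>] 0) (𝓝 (‖U x‖ₑ ^ 4)) :=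
      ((ENNReal.continuous_pow 4).tendsto _).comp ((continuous_enorm.tendsto _).comp hx)
    rw [this.liminf_eq]
    simp only [U, indicator_of_mem (hSA hxS)]
  rw [lintegral_congr_ae hlim]
  have hmeas : ∀ δ : ℝ, AEMeasurable (fun x => ‖mol δ U (x + δ • q)‖ₑ ^ 4)
      (volume.restrict S) := by
    intro δ
    by_cases hδ : 0 < δ
    · have : Continuous fun x => mol δ U (x + δ • q) :=
        (mol_contDiff hδ lU).continuous.comp (continuous_id.add continuous_const)
      exact (this.measurable.enorm.pow_const 4).aemeasurable
    -- Nonpositive `δ` play no role in the limit, but Fatou's lemma asks for measurability at every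
    -- index. It follows by integrating a jointly measurable function.
    · have hc : Continuous fun p : Plane × Plane => rho δ (p.1 + δ • q - p.2) :=
        (rho_contDiff δ).continuous.comp (by fun_prop)
      have : AEStronglyMeasurable (fun p : Plane × Plane => rho δ (p.1 + δ • q - p.2) • U p.2)
          ((volume.restrict S).prod volume) :=
        hc.aestronglyMeasurable.smul mU.1.comp_snd
      exact (this.integral_prod_right'.enorm).pow_const 4
  refine (lintegral_liminf_le' hmeas).trans_lt ?_
  refine lt_of_le_of_lt ?_ (ENNReal.pow_lt_top hM (n := 2))
  refine liminf_le_of_le (by isBoundedDefault) fun c hc => ?_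
  obtain ⟨δ, hδ, hδ'⟩ := (hc.and (Ioc_mem_nhdsGT (show (0 : ℝ) < l / 4 by positivity))).exists
  exact hδ.trans (key δ hδ'.1 hδ'.2)

/-- Functions in `H¹` of a bounded smooth planar domain are in `L⁴`. -/
lemma MemH1.integrable_norm_pow_four {A : Set Plane} (hA : IsOpen A)
    (hb : Bornology.IsBounded A) (hs : HasSmoothBoundary A) {u : Plane → ℂ} (hu : MemH1 A u) :
    Integrable (fun x => ‖u x‖ ^ 4) (volume.restrict A) := by
  have hK : IsCompact (closure A) := hb.isCompact_closure
  have h := hK.induction_on (p := fun K => ∫⁻ x in A ∩ K, ‖u x‖ₑ ^ 4 < ⊤) (by simp)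
    (fun s t hst ht => (lintegral_mono_set (inter_subset_inter_right A hst)).trans_lt ht)
    (fun s t hs ht => by
      rw [inter_union_distrib_left]
      exact (lintegral_union_le _ _ _).trans_lt (ENNReal.add_lt_top.2 ⟨hs, ht⟩))
    (fun x hx => by
      obtain ⟨b, r, hr, l, hl, hc⟩ := hs.exists_cone hA hx
      refine ⟨Metric.ball x r, mem_nhdsWithin_of_mem_nhds (Metric.ball_mem_nhds x hr), ?_⟩
      exact hu.lintegral_pow_four_lt_top_of_cone hA b
        (hA.inter Metric.isOpen_ball).measurableSet inter_subset_left hl hc)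
  rw [inter_eq_left.2 subset_closure] at h
  refine ⟨(hu.1.1.norm).pow 4, ?_⟩
  rw [HasFiniteIntegral]
  simpa [enorm_pow] using h

end Sobolev
end

noncomputable section

/-! ### Bounds for the Poisson equation up to the boundary -/

section Regularity

/-- The Laplacian in coordinates. -/
def lap (h : Plane → ℝ) (x : Plane) : ℝ := ∑ i, classicalPartial i (classicalPartial i h) x

/-- On a coordinate line a positive second derivative would make the maximum a minimum as well. The
restriction would then be locally constant, with vanishing second derivative. -/
lemma lap_nonpos_of_isLocalMax {h : Plane → ℝ} {x : Plane} (hm : IsLocalMax h x)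
    (hc : ContDiffAt ℝ 2 h x) : lap h x ≤ 0 := by
  refine Finset.sum_nonpos fun i _ => ?_
  by_contra hpos
  rw [not_le] at hpos
  set e : Plane := EuclideanSpace.single i 1
  set g : ℝ → ℝ := fun t => h (x + t • e)
  have hl : ∀ t : ℝ, HasDerivAt (fun t : ℝ => x + t • e) e t := fun t => by
    simpa using ((hasDerivAt_id t).smul_const e).const_add x
  have hlc : ContinuousAt (fun t : ℝ => x + t • e) 0 := (hl 0).continuousAt
  have hl0 : Tendsto (fun t : ℝ => x + t • e) (𝓝 0) (𝓝 x) := by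
    have := hlc.tendsto; simpa using this
  have hev : ∀ᶠ t in 𝓝 (0 : ℝ), HasDerivAt g (classicalPartial i h (x + t • e)) t := by
    filter_upwards [hl0.eventually (hc.eventually (by simp))] with t ht
    exact ((ht.differentiableAt (by norm_num)).hasFDerivAt).comp_hasDerivAt t (hl t)
  have hgd : deriv g =ᶠ[𝓝 0] fun t => classicalPartial i h (x + t • e) :=
    hev.mono fun t ht => ht.deriv
  have hpd : DifferentiableAt ℝ (classicalPartial i h) x :=
    ((hc.fderiv_right (m := 1) (by norm_num)).clm_apply contDiffAt_const).differentiableAt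
      (by norm_num)
  have hgdd : deriv (deriv g) 0 = classicalPartial i (classicalPartial i h) x := by
    rw [hgd.deriv_eq]
    have hx0 : x + (0 : ℝ) • e = x := by simp
    have h1 : HasFDerivAt (classicalPartial i h) (fderiv ℝ (classicalPartial i h) x)
        (x + (0 : ℝ) • e) := by rw [hx0]; exact hpd.hasFDerivAt
    exact (h1.comp_hasDerivAt 0 (hl 0)).deriv
  have hgm : IsLocalMax g 0 := by
    have : ∀ᶠ t in 𝓝 (0 : ℝ), h (x + t • e) ≤ h x := hl0.eventually hm
    filter_upwards [this] with t ht
    simpa [g] using ht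
  have hgc : ContinuousAt g 0 := hev.self_of_nhds.continuousAt
  have hgmin : IsLocalMin g 0 :=
    isLocalMin_of_deriv_deriv_pos (by rw [hgdd]; exact hpos) hgm.deriv_eq_zero hgc
  have hconst : g =ᶠ[𝓝 0] fun _ => g 0 := by
    filter_upwards [hgm, hgmin] with t h1 h2 using le_antisymm h1 h2
  have : deriv (deriv g) 0 = 0 := by
    have h1 : deriv g =ᶠ[𝓝 0] fun _ => 0 := by
      have := hconst.deriv
      simpa using this
    rw [h1.deriv_eq]; simp
  rw [hgdd] at this
  exact hpos.ne' this

/-- One derivative is moved by the definition of the weak gradient, the other by the equation. The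
kernel is general because it is used both for the mollifier and for a partial derivative of a radial
potential. -/
lemma IsWeakPoissonSolution.integral_lap_kernel {A : Set Plane} (hA : IsOpen A) {f ψ : Plane → ℝ}
    (h : IsWeakPoissonSolution A f ψ) {k : Plane → ℝ} {r : ℝ} {x : Plane}
    (hk : ContDiff ℝ (⊤ : ℕ∞) k) (hs : tsupport k ⊆ Metric.closedBall 0 r)
    (hx : Metric.closedBall x r ⊆ A) :
    ∫ y, lap k (x - y) • A.indicator ψ y = - ∫ y, k (x - y) • A.indicator f y := by
  have hki : ∀ i, ContDiff ℝ (⊤ : ℕ∞) (classicalPartial i k) := fun i =>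
    hk.classicalPartial (by simp) i
  have hsi : ∀ i, tsupport (classicalPartial i k) ⊆ Metric.closedBall 0 r := fun i =>
    (tsupport_classicalPartial_subset i k).trans hs
  have ht : IsTestFunction A (fun y => k (x - y)) := isTestFunction_comp_const_sub hk hs hx
  have hti : ∀ i, IsTestFunction A (fun y => classicalPartial i k (x - y)) := fun i =>
    isTestFunction_comp_const_sub (hki i) (hsi i) hx
  have htii : ∀ i, IsTestFunction A (fun y => classicalPartial i (classicalPartial i k) (x - y)) :=
    fun i => isTestFunction_comp_const_sub ((hki i).classicalPartial (by simp) i)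
      ((tsupport_classicalPartial_subset i _).trans (hsi i)) hx
  have w := fun i => h.1.isWeakPartial i
  have e1 : ∀ i, ∫ y in A, classicalPartial i (classicalPartial i k) (x - y) • ψ y
      = ∫ y in A, classicalPartial i k (x - y) • weakGrad A ψ y i := by
    intro i
    have := (w i).2.2 _ (hti i)
    simp_rw [classicalPartial_comp_const_sub ((hki i).differentiable (by simp)), neg_smul,
      integral_neg, neg_inj] at this
    exact this
  rw [integral_smul_indicator hA.measurableSet (fun y => lap k (x - y)),
    integral_smul_indicator hA.measurableSet (fun y => k (x - y))]
  simp only [lap, Finset.sum_smul]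
  rw [integral_finsetSum _ fun i _ => (htii i).integrableOn_smul (w i).1]
  simp_rw [e1]
  have e2 := h.2 _ ht
  simp_rw [classicalPartial_comp_const_sub (hk.differentiable (by simp))] at e2
  rw [← integral_finsetSum _ fun i _ => (hti i).integrableOn_smul (w i).2.1]
  have e3 : ∫ y in A, k (x - y) • f y = ∫ y in A, f y * k (x - y) :=
    integral_congr_ae (Eventually.of_forall fun y => by simp only [smul_eq_mul]; ring)
  rw [e3, ← e2, ← integral_neg]
  refine integral_congr_ae (Eventually.of_forall fun y => ?_)
  simp only [← Finset.sum_neg_distrib, smul_eq_mul]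
  exact Finset.sum_congr rfl fun i _ => by ring

lemma MemH1.integrableOn_indicator {F : Type*} [NormedAddCommGroup F] [NormedSpace ℝ F]
    {A : Set Plane} (hA : IsOpen A) {ψ : Plane → F} (h : MemH1 A ψ) :
    LocallyIntegrable (A.indicator ψ) :=
  ((memLp_indicator_iff_restrict hA.measurableSet).2 h.1).locallyIntegrable (by norm_num)

lemma lap_mol {A : Set Plane} (hA : IsOpen A) {f ψ : Plane → ℝ}
    (h : IsWeakPoissonSolution A f ψ) {δ : ℝ} (hδ : 0 < δ) {x : Plane}
    (hx : Metric.closedBall x δ ⊆ A) :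
    lap (mol δ (A.indicator ψ)) x = - mol δ (A.indicator f) x := by
  have hl := h.1.integrableOn_indicator hA
  refine Eq.trans ?_ (h.integral_lap_kernel hA (rho_contDiff δ) (tsupport_rho_subset hδ) hx)
  simp only [lap, Finset.sum_smul]
  have hc : ∀ i, HasCompactSupport (classicalPartial i (rho δ)) := fun i =>
    (rho_hasCompactSupport hδ).classicalPartial i
  have hs : ∀ i, ContDiff ℝ (⊤ : ℕ∞) (classicalPartial i (rho δ)) := fun i =>
    (rho_contDiff δ).classicalPartial (by simp) i
  rw [integral_finsetSum]
  · refine Finset.sum_congr rfl fun i _ => ?_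
    have : classicalPartial i (mol δ (A.indicator ψ))
        = fun x => ∫ y, classicalPartial i (rho δ) (x - y) • A.indicator ψ y :=
      funext fun x => classicalPartial_mol hδ hl i x
    rw [this, classicalPartial_integral_kernel (hs i) (hc i) hl]
  · intro i _
    exact integrable_smul_of_locallyIntegrable
      (((hs i).classicalPartial (m := 0) (by simp) i).continuous.comp
        (continuous_const.sub continuous_id))
      (comp_const_sub_hasCompactSupport ((hc i).classicalPartial i) x) hl

lemma ae_indicator_bound {A : Set Plane} (hA : MeasurableSet A) {f : Plane → ℝ} {M : ℝ}
    (hM : 0 ≤ M) (hf : ∀ᵐ x ∂(volume.restrict A), |f x| ≤ M) :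
    ∀ᵐ x, ‖A.indicator f x‖ ≤ M := by
  filter_upwards [(ae_restrict_iff' hA).1 hf] with x hx
  by_cases h : x ∈ A
  · rw [indicator_of_mem h]; exact hx h
  · rw [indicator_of_notMem h, norm_zero]; exact hM

lemma locallyIntegrable_indicator {F : Type*} [NormedAddCommGroup F] {A : Set Plane}
    (hA : MeasurableSet A) {f : Plane → F}
    (hf : IntegrableOn f A) : LocallyIntegrable (A.indicator f) :=
  ((integrable_indicator_iff hA).2 hf).locallyIntegrable

lemma lap_sub {h k : Plane → ℝ} {x : Plane} (hh : ContDiffAt ℝ 2 h x) (hk : ContDiffAt ℝ 2 k x) :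
    lap (fun y => h y - k y) x = lap h x - lap k x := by
  have pd : ∀ {h : Plane → ℝ} (i : Fin 2), ContDiffAt ℝ 2 h x →
      DifferentiableAt ℝ (classicalPartial i h) x := fun i hc =>
    ((hc.fderiv_right (m := 1) (by norm_num)).clm_apply contDiffAt_const).differentiableAt
      (by norm_num)
  simp only [lap]
  rw [← Finset.sum_sub_distrib]
  refine Finset.sum_congr rfl fun i _ => ?_
  rw [← classicalPartial_sub (pd i hh) (pd i hk)]
  refine classicalPartial_congr i ?_
  filter_upwards [hh.eventually (by simp), hk.eventually (by simp)] with y h1 h2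
  exact classicalPartial_sub (h1.differentiableAt (by norm_num))
    (h2.differentiableAt (by norm_num)) i

lemma lap_comp_norm_sq_sub {F : ℝ → ℝ} {F' : ℝ → ℝ} {x y : Plane} {F'' : ℝ}
    (h1 : ∀ᶠ t in 𝓝 (‖x - y‖ ^ 2), HasDerivAt F (F' t) t)
    (h2 : HasDerivAt F' F'' (‖x - y‖ ^ 2)) :
    lap (fun x => F (‖x - y‖ ^ 2)) x = 4 * F' (‖x - y‖ ^ 2) + 4 * ‖x - y‖ ^ 2 * F'' := by
  have tr : ∀ (g : Plane → ℝ) (i : Fin 2) (z : Plane),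
      classicalPartial i (fun x => g (x - y)) z = classicalPartial i g (z - y) := by
    intro g i z
    simp only [classicalPartial, sub_eq_add_neg]
    rw [fderiv_comp_add_right]
  have hc : Tendsto (fun z : Plane => ‖z - y‖ ^ 2) (𝓝 x) (𝓝 (‖x - y‖ ^ 2)) :=
    Continuous.tendsto (by fun_prop) x
  have key : ∀ i, classicalPartial i (classicalPartial i fun x => F (‖x - y‖ ^ 2)) x
      = 2 * F' (‖x - y‖ ^ 2) + 4 * (x - y) i ^ 2 * F'' := by
    intro i
    have e : classicalPartial i (fun x => F (‖x - y‖ ^ 2))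
        =ᶠ[𝓝 x] fun z => (fun z : Plane => 2 * z i * F' (‖z‖ ^ 2)) (z - y) := by
      filter_upwards [hc.eventually h1] with z hz
      rw [tr (fun z => F (‖z‖ ^ 2)), classicalPartial_comp_norm_sq hz]
    rw [classicalPartial_congr i e]
    refine (tr (fun z : Plane => 2 * z i * F' (‖z‖ ^ 2)) i x).trans ?_
    have d1 : DifferentiableAt ℝ (fun z : Plane => 2 * z i) (x - y) :=
      ((contDiff_coord i (n := 1)).differentiable (by norm_num) _).const_mul 2
    have d2 : DifferentiableAt ℝ (fun z : Plane => F' (‖z‖ ^ 2)) (x - y) :=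
      DifferentiableAt.comp (x - y) h2.differentiableAt
        ((contDiff_norm_sq ℝ (n := 1)).differentiable (by norm_num) _)
    have h3 := classicalPartial_smul (𝕜 := ℝ) d1 d2 i
    simp only [smul_eq_mul] at h3
    rw [h3, classicalPartial_comp_norm_sq h2]
    have h4 := classicalPartial_smul (𝕜 := ℝ) (φ := fun _ : Plane => (2 : ℝ))
      (a := fun z : Plane => z i) (x := x - y) (differentiableAt_const _)
      ((contDiff_coord i (n := 1)).differentiable (by norm_num) _) i
    simp only [smul_eq_mul] at h4
    rw [h4, classicalPartial_coord, classicalPartial_eq_zero_of_eventuallyEq i EventuallyEq.rfl]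
    simp only [if_true]
    ring
  rw [lap, Fin.sum_univ_two, key, key, plane_norm_sq]
  ring

/-- A continuous weak solution cannot touch a strict supersolution from below at an interior
point. -/
lemma IsWeakPoissonSolution.not_touch {A : Set Plane} (hA : IsOpen A) {f ψ : Plane → ℝ} {M : ℝ}
    (hM : 0 ≤ M) (h : IsWeakPoissonSolution A f ψ) (hfi : IntegrableOn f A)
    (hf : ∀ᵐ x ∂(volume.restrict A), |f x| ≤ M) (hc : ContinuousOn ψ A) {w : Plane → ℝ}
    {x₁ : Plane} {R c : ℝ} (hR : 0 < R) (hc0 : 0 < c) (hball : Metric.closedBall x₁ R ⊆ A)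
    (hw : ∀ x ∈ Metric.closedBall x₁ R, ContDiffAt ℝ 2 w x)
    (hwl : ∀ x ∈ Metric.closedBall x₁ R, M + c ≤ - lap w x)
    (hmax : ∀ x ∈ Metric.closedBall x₁ R, ψ x - w x ≤ ψ x₁ - w x₁) : False := by
  -- The penalty `p = -κ|x - x₁|²` makes the maximum strict at the cost `-Δp = 4κ = c / 2`, which is
  -- less than the margin `c`.
  set κ := c / 8
  have hκ : 0 < κ := by positivity
  set p : Plane → ℝ := fun x => - (κ * ‖x - x₁‖ ^ 2)
  have hp : ContDiff ℝ 2 p := by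
    have : ContDiff ℝ 2 fun x : Plane => ‖x - x₁‖ ^ 2 :=
      (contDiff_norm_sq ℝ).comp (contDiff_id.sub contDiff_const)
    exact (contDiff_const.mul this).neg
  have hlp : ∀ x, lap p x = - (4 * κ) := by
    intro x
    have := lap_comp_norm_sq_sub (F := fun t => -(κ * t)) (F' := fun _ => -κ) (x := x) (y := x₁)
      (F'' := 0) (Eventually.of_forall fun t => by
        simpa using ((hasDerivAt_id t).const_mul κ).fun_neg)
      (hasDerivAt_const _ _)
    simp only [p]
    rw [this]; ring
  obtain ⟨r, hr, hrA⟩ := (isCompact_closedBall x₁ R).exists_cthickening_subset_open hA hball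
  have hKc : IsCompact (Metric.cthickening r (Metric.closedBall x₁ R)) :=
    (isCompact_closedBall x₁ R).cthickening
  have huc := hKc.uniformContinuousOn_of_continuous (hc.mono hrA)
  obtain ⟨d, hd, hdψ⟩ := Metric.uniformContinuousOn_iff.1 huc (κ * R ^ 2 / 4) (by positivity)
  set δ := min r (d / 2)
  have hδ : 0 < δ := lt_min hr (by positivity)
  have hδb : ∀ x ∈ Metric.closedBall x₁ R, Metric.closedBall x δ ⊆
      Metric.cthickening r (Metric.closedBall x₁ R) := fun x hx =>
    (Metric.closedBall_subset_closedBall (min_le_left _ _)).trans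
      (Metric.closedBall_subset_cthickening hx r)
  have hl := h.1.integrableOn_indicator hA
  set Ψ := mol δ (A.indicator ψ)
  have hΨ : ContDiff ℝ (⊤ : ℕ∞) Ψ := mol_contDiff hδ hl
  -- The error, occurring at two points, totals at most `κR²/2`, less than the drop `κR²` of the
  -- penalty on the sphere. So the mollified difference still attains its maximum inside, where the
  -- classical second-derivative test applies.
  have hclose : ∀ x ∈ Metric.closedBall x₁ R, |Ψ x - ψ x| ≤ κ * R ^ 2 / 4 := by
    intro x hx
    refine norm_mol_sub_le hδ hl (Eventually.of_forall fun y hy => ?_)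
    have hyT := hδb x hx hy
    rw [indicator_of_mem (hrA hyT), ← dist_eq_norm]
    refine (hdψ y hyT x (hδb x hx (Metric.mem_closedBall_self hδ.le)) ?_).le
    have : δ ≤ d / 2 := min_le_right _ _
    linarith [Metric.mem_closedBall.1 hy]
  have hcw : ContinuousOn (fun x => Ψ x - w x + p x) (Metric.closedBall x₁ R) := fun x hx =>
    ((hΨ.continuous.continuousAt.sub (hw x hx).continuousAt).add
      hp.continuous.continuousAt).continuousWithinAt
  obtain ⟨x₂, hx₂, hm₂⟩ := (isCompact_closedBall x₁ R).exists_isMaxOn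
    ⟨x₁, Metric.mem_closedBall_self hR.le⟩ hcw
  have hx₂b : x₂ ∈ Metric.ball x₁ R := by
    rw [Metric.mem_ball]
    refine lt_of_le_of_ne hx₂ fun heq => ?_
    have h1 : Ψ x₁ - w x₁ + p x₁ ≤ Ψ x₂ - w x₂ + p x₂ :=
      hm₂ (Metric.mem_closedBall_self hR.le)
    have h2 := abs_le.1 (hclose x₁ (Metric.mem_closedBall_self hR.le))
    have h3 := abs_le.1 (hclose x₂ hx₂)
    have h4 := hmax x₂ hx₂
    have h5 : p x₁ = 0 := by simp [p]
    have h6 : p x₂ = -(κ * R ^ 2) := by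
      simp only [p]; rw [← dist_eq_norm, heq]
    have h7 : 0 < κ * R ^ 2 := by positivity
    linarith [h2.1, h3.2]
  have hΨ2 : ContDiffAt ℝ 2 Ψ x₂ := (hΨ.of_le (m := ((2 : ℕ∞) : WithTop ℕ∞))
    (by exact_mod_cast le_top)).contDiffAt
  have hlm : IsLocalMax (fun x => Ψ x - (w x - p x)) x₂ := by
    filter_upwards [Metric.isOpen_ball.mem_nhds hx₂b] with x hx
    have h1 : Ψ x - w x + p x ≤ Ψ x₂ - w x₂ + p x₂ := hm₂ (Metric.ball_subset_closedBall hx)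
    linarith
  have hle := lap_nonpos_of_isLocalMax hlm (hΨ2.sub ((hw x₂ hx₂).sub hp.contDiffAt))
  rw [lap_sub hΨ2 ((hw x₂ hx₂).sub hp.contDiffAt), lap_sub (hw x₂ hx₂) hp.contDiffAt, hlp,
    lap_mol hA h hδ ((hδb x₂ hx₂).trans hrA)] at hle
  have hfb := norm_mol_le hδ (locallyIntegrable_indicator hA.measurableSet hfi) (x := x₂)
    ((ae_indicator_bound hA.measurableSet hM hf).mono fun y hy _ => hy)
  have h8 := (abs_le.1 hfb).2
  have h9 := hwl x₂ hx₂
  have h10 : 4 * κ = c / 2 := by simp only [κ]; ring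
  linarith

/-! ### Barriers, linear decay and the gradient bound. -/

lemma exists_frontier_nearest {A : Set Plane} (hA : IsOpen A) (hb : Bornology.IsBounded A)
    {x : Plane} (hx : x ∈ A) :
    ∃ x₀ ∈ frontier A, Metric.infDist x Aᶜ = dist x x₀ ∧ 0 < dist x x₀ ∧
      Metric.ball x (dist x x₀) ⊆ A := by
  have hne : (Aᶜ).Nonempty := by
    rw [nonempty_compl]
    rintro rfl
    exact NormedSpace.unbounded_univ ℝ Plane hb
  obtain ⟨x₀, hx₀, he⟩ := hA.isClosed_compl.exists_infDist_eq_dist hne x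
  have hpos : 0 < dist x x₀ := dist_pos.2 fun h => hx₀ (h ▸ hx)
  have hball : Metric.ball x (dist x x₀) ⊆ A := by
    intro y hy
    by_contra hyA
    have := Metric.infDist_le_dist_of_mem (x := x) (show y ∈ Aᶜ from hyA)
    rw [he, dist_comm x y] at this
    exact absurd (Metric.mem_ball.1 hy) (not_lt.2 this)
  refine ⟨x₀, ?_, he, hpos, hball⟩
  rw [hA.frontier_eq]
  refine ⟨closure_mono hball ?_, hx₀⟩
  rw [closure_ball x hpos.ne', Metric.mem_closedBall, dist_comm]

/-- In the plane `Δ|x|⁻² = 4|x|⁻⁴`. For `K > 0` this is a strict supersolution away from `y`,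
vanishing where `|x - y|² = r`. -/
lemma barrier_lap {K r : ℝ} {x y : Plane} (hxy : x ≠ y) :
    ContDiffAt ℝ 2 (fun x => K * (r⁻¹ - (‖x - y‖ ^ 2)⁻¹)) x ∧
    lap (fun x => K * (r⁻¹ - (‖x - y‖ ^ 2)⁻¹)) x = - (4 * K / (‖x - y‖ ^ 2) ^ 2) := by
  have hpos : 0 < ‖x - y‖ ^ 2 := by
    have := norm_pos_iff.2 (sub_ne_zero.2 hxy); positivity
  have hn : ContDiffAt ℝ 2 (fun x : Plane => ‖x - y‖ ^ 2) x :=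
    ((contDiff_norm_sq ℝ).comp (contDiff_id.sub contDiff_const)).contDiffAt
  refine ⟨contDiffAt_const.mul (contDiffAt_const.sub (hn.inv hpos.ne')), ?_⟩
  have := lap_comp_norm_sq_sub (F := fun t => K * (r⁻¹ - t⁻¹)) (F' := fun t => K * (t ^ 2)⁻¹)
    (x := x) (y := y) (F'' := K * (-(2 * ‖x - y‖ ^ 2) / ((‖x - y‖ ^ 2) ^ 2) ^ 2)) (by
      filter_upwards [lt_mem_nhds hpos] with t ht
      have := ((hasDerivAt_inv ht.ne').const_sub r⁻¹).const_mul K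
      simpa using this) (by
      have := ((hasDerivAt_pow 2 (‖x - y‖ ^ 2)).fun_inv (by positivity)).const_mul K
      simpa using this)
  rw [this]
  field_simp
  ring

/-- The barrier around the exterior ball touching the boundary at the nearest point `x₀` is
nonnegative on `closure A`, dominates `ψ` by the maximum principle, and grows at most linearly away
from `x₀`. The uniform radius of the exterior balls makes `C` independent of the point. -/
lemma HasSmoothBoundary.exists_linear_decay {A : Set Plane} (hA : IsOpen A)
    (hb : Bornology.IsBounded A) (hs : HasSmoothBoundary A) :
    ∃ C > 0, ∀ (M : ℝ) (f ψ : Plane → ℝ), 0 < M → IsWeakPoissonSolution A f ψ →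
      IntegrableOn f A → (∀ᵐ x ∂(volume.restrict A), |f x| ≤ M) →
      ContinuousOn ψ (closure A) → (∀ x ∈ frontier A, ψ x = 0) →
      ∀ x ∈ A, ψ x ≤ C * M * Metric.infDist x Aᶜ := by
  obtain ⟨r, hr, hext⟩ := hs.exists_exterior_ball hA hb
  obtain ⟨R₁, hR₁⟩ := hb.closure.subset_closedBall 0
  set R₀ := 2 * |R₁| + r + 1
  have hR₀ : 0 < R₀ := by positivity
  refine ⟨(R₀ ^ 2) ^ 2 / r ^ 3, by positivity, ?_⟩
  intro M f ψ hM h hfi hf hc h0 x hx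
  obtain ⟨x₀, hx₀, hd, hdpos, -⟩ := exists_frontier_nearest hA hb hx
  rw [hd]
  obtain ⟨y, hy, hdisj⟩ := hext x₀ hx₀
  have hfar : ∀ z ∈ closure A, r ≤ ‖z - y‖ := by
    intro z hz
    by_contra hlt
    rw [not_le, ← dist_eq_norm] at hlt
    exact (hdisj.closure_right Metric.isOpen_ball).notMem_of_mem_left (Metric.mem_ball.2 hlt) hz
  have hnear : ∀ z ∈ closure A, ‖z - y‖ ≤ R₀ := by
    intro z hz
    have h1 : ‖z‖ ≤ R₁ := by simpa using hR₁ hz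
    have h2 : ‖x₀‖ ≤ R₁ := by simpa using hR₁ (frontier_subset_closure hx₀)
    calc ‖z - y‖ = ‖(z - x₀) + (x₀ - y)‖ := by congr 1; abel
      _ ≤ ‖z - x₀‖ + ‖x₀ - y‖ := norm_add_le _ _
      _ ≤ (‖z‖ + ‖x₀‖) + r := by
        gcongr
        · exact norm_sub_le _ _
        · rw [← dist_eq_norm, dist_comm]; exact hy.le
      _ ≤ R₀ := by
        have := le_abs_self R₁
        simp only [R₀]; linarith
  -- `R₀` bounds `|z - y|` on `closure A`, so `-Δw = 4K / |z - y|⁴ ≥ 2M`, exceeding the source bound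
  -- by the margin `M`.
  set K := M * (R₀ ^ 2) ^ 2 / 2
  have hK : 0 < K := by positivity
  set w : Plane → ℝ := fun z => K * ((r ^ 2)⁻¹ - (‖z - y‖ ^ 2)⁻¹)
  have hne : ∀ z ∈ closure A, z ≠ y := fun z hz hzy => by
    have := hfar z hz
    rw [hzy, sub_self, norm_zero] at this
    linarith
  have hw0 : ∀ z ∈ closure A, 0 ≤ w z := by
    intro z hz
    refine mul_nonneg hK.le (sub_nonneg.2 ?_)
    have := hfar z hz
    gcongr
  have hwc : ContinuousOn w (closure A) := fun z hz =>
    (barrier_lap (K := K) (r := r ^ 2) (hne z hz)).1.continuousAt.continuousWithinAt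
  have hle : ψ x ≤ w x := by
    by_contra hlt
    rw [not_le] at hlt
    obtain ⟨x₁, hx₁, hm⟩ := hb.isCompact_closure.exists_isMaxOn ⟨x, subset_closure hx⟩ (hc.sub hwc)
    have h1 : ψ x - w x ≤ ψ x₁ - w x₁ := hm (subset_closure hx)
    have hx₁A : x₁ ∈ A := by
      by_contra hn
      have hfr : x₁ ∈ frontier A := by rw [hA.frontier_eq]; exact ⟨hx₁, hn⟩
      have := h0 x₁ hfr
      have := hw0 x₁ hx₁
      linarith
    obtain ⟨R, hR, hRA⟩ := Metric.nhds_basis_closedBall.mem_iff.1 (hA.mem_nhds hx₁A)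
    refine h.not_touch hA hM.le hfi hf (hc.mono subset_closure) hR hM hRA
      (w := w) (fun z hz => (barrier_lap (hne z (subset_closure (hRA hz)))).1)
      (fun z hz => ?_) (fun z hz => hm (subset_closure (hRA hz)))
    have hzc := subset_closure (hRA hz)
    rw [(barrier_lap (K := K) (r := r ^ 2) (hne z hzc)).2, neg_neg, le_div_iff₀ (by
      have : 0 < ‖z - y‖ := hr.trans_le (hfar z hzc)
      positivity)]
    have h2 : (‖z - y‖ ^ 2) ^ 2 ≤ (R₀ ^ 2) ^ 2 := by
      have := hnear z hzc
      gcongr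
    calc (M + M) * (‖z - y‖ ^ 2) ^ 2 ≤ (M + M) * (R₀ ^ 2) ^ 2 := by gcongr
      _ = 4 * K := by simp only [K]; ring
  refine hle.trans ?_
  set s := ‖x - y‖
  have hs1 : r ≤ s := hfar x (subset_closure hx)
  have hs0 : 0 < s := hr.trans_le hs1
  have hs2 : s ≤ dist x x₀ + r := by
    calc s = dist x y := (dist_eq_norm _ _).symm
      _ ≤ dist x x₀ + dist x₀ y := dist_triangle _ _ _
      _ = _ := by rw [dist_comm x₀ y, hy]
  have h3 : (r ^ 2)⁻¹ - (s ^ 2)⁻¹ ≤ 2 * dist x x₀ / r ^ 3 := by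
    have e : (r ^ 2)⁻¹ - (s ^ 2)⁻¹ = (s - r) * (s + r) / (r ^ 2 * s ^ 2) := by
      field_simp; ring
    rw [e, div_le_div_iff₀ (by positivity) (by positivity)]
    have h5 : (s - r) * (s + r) ≤ dist x x₀ * (2 * s) := by
      have : s - r ≤ dist x x₀ := by linarith
      have : s + r ≤ 2 * s := by linarith
      gcongr
    calc (s - r) * (s + r) * r ^ 3 ≤ dist x x₀ * (2 * s) * r ^ 3 := by gcongr
      _ = 2 * dist x x₀ * (r ^ 2 * (s * r)) := by ring
      _ ≤ 2 * dist x x₀ * (r ^ 2 * s ^ 2) := by gcongr; nlinarith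
  calc w x = K * ((r ^ 2)⁻¹ - (s ^ 2)⁻¹) := rfl
    _ ≤ K * (2 * dist x x₀ / r ^ 3) := by gcongr
    _ = _ := by simp only [K]; ring

lemma IsWeakPoissonSolution.neg {A : Set Plane} (hA : IsOpen A) {f ψ : Plane → ℝ}
    (h : IsWeakPoissonSolution A f ψ) :
    IsWeakPoissonSolution A (fun x => - f x) (fun x => - ψ x) := by
  have hw : ∀ i, IsWeakPartial A i (fun x => - ψ x) (fun x => - weakGrad A ψ x i) := fun i =>
    (h.1.isWeakPartial i).clm_comp (-ContinuousLinearMap.id ℝ ℝ)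
  refine ⟨⟨h.1.1.neg, fun i => ⟨_, hw i, (h.1.memLp_weakGrad hA i).neg⟩⟩, fun φ hφ => ?_⟩
  have e : ∫ x in A, ∑ i, weakGrad A (fun x => - ψ x) x i * classicalPartial i φ x
      = ∫ x in A, - ∑ i, weakGrad A ψ x i * classicalPartial i φ x := by
    refine integral_congr_ae ?_
    filter_upwards [(hw 0).weakGrad_ae_eq hA, (hw 1).weakGrad_ae_eq hA] with x h0 h1
    simp only [Fin.sum_univ_two, h0, h1]; ring
  rw [e, integral_neg, h.2 φ hφ, ← integral_neg]
  exact integral_congr_ae (Eventually.of_forall fun x => by simp)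

/-- In polar coordinates the area factor cancels the singularity. -/
lemma integrable_inv_norm_ball (R : ℝ) :
    Integrable (fun x : Plane => (Iic R).indicator (fun t => t⁻¹) ‖x‖) := by
  rw [integrable_fun_norm_addHaar volume (f := (Iic R).indicator (fun t : ℝ => t⁻¹))]
  have : IntegrableOn ((Ioc 0 R).indicator fun _ : ℝ => (1 : ℝ)) (Ioi 0) :=
    ((integrable_indicator_iff measurableSet_Ioc).2
      (integrableOn_const (by simp))).integrableOn
  refine this.congr_fun (fun y hy => ?_) measurableSet_Ioi
  have hy : 0 < y := hy
  by_cases h : y ≤ R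
  · rw [indicator_of_mem (show y ∈ Ioc 0 R from ⟨hy, h⟩), indicator_of_mem (show y ∈ Iic R from h)]
    simp [hy.ne']
  · rw [indicator_of_notMem (fun h' : y ∈ Ioc 0 R => h h'.2),
      indicator_of_notMem (show y ∉ Iic R from h)]
    simp

/-- Weak solutions of the Poisson equation with vanishing boundary values in a smooth bounded
domain have bounded gradients and decay linearly at the boundary. -/
theorem HasSmoothBoundary.exists_poisson_bound {A : Set Plane} (hA : IsOpen A)
    (hb : Bornology.IsBounded A) (hs : HasSmoothBoundary A) :
    ∃ C > 0, ∀ (M : ℝ) (f ψ : Plane → ℝ), 0 < M → IsWeakPoissonSolution A f ψ →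
      IntegrableOn f A → (∀ᵐ x ∂(volume.restrict A), |f x| ≤ M) →
      ContinuousOn ψ (closure A) → (∀ x ∈ frontier A, ψ x = 0) →
      (∀ x ∈ A, |ψ x| ≤ C * M * Metric.infDist x Aᶜ) ∧
      ∀ i, ∀ᵐ x ∂(volume.restrict A), |weakGrad A ψ x i| ≤ C * M := by
  obtain ⟨C₁, hC₁, hdec⟩ := hs.exists_linear_decay hA hb
  obtain ⟨C₂, hC₂, hρ⟩ := exists_integral_abs_partial_rho_le
  obtain ⟨R₁, hR₁⟩ := hb.closure.subset_closedBall 0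
  set R := 2 * |R₁| + 1
  set I := ∫ x : Plane, (Iic R).indicator (fun t => t⁻¹) ‖x‖
  have hI : 0 ≤ I := integral_nonneg fun x => indicator_nonneg
    (f := fun t : ℝ => t⁻¹) (s := {t | t ≤ R ∧ 0 ≤ t}) (fun t ht => inv_nonneg.2 ht.2) ‖x‖ |>.trans (by
      by_cases h : ‖x‖ ≤ R
      · rw [indicator_of_mem (show ‖x‖ ∈ Iic R from h), indicator_of_mem
          (show ‖x‖ ∈ {t | t ≤ R ∧ 0 ≤ t} from ⟨h, norm_nonneg _⟩)]
      · rw [indicator_of_notMem (show ‖x‖ ∉ Iic R from h), indicator_of_notMem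
          (show ‖x‖ ∉ {t | t ≤ R ∧ 0 ≤ t} from fun h' => h h'.1)])
  have hkm := kernelMass_pos
  refine ⟨C₁ + (3 * C₁ * C₂ + kernelMass⁻¹ * I), by positivity, ?_⟩
  intro M f ψ hM h hfi hf hc h0
  have habs : ∀ x ∈ A, |ψ x| ≤ C₁ * M * Metric.infDist x Aᶜ := by
    intro x hx
    refine abs_le'.2 ⟨hdec M f ψ hM h hfi hf hc h0 x hx, ?_⟩
    exact hdec M _ _ hM (h.neg hA) hfi.neg (hf.mono fun y hy => by rwa [abs_neg]) hc.neg
      (fun y hy => by rw [h0 y hy, neg_zero]) x hx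
  refine ⟨fun x hx => (habs x hx).trans ?_, fun i => ?_⟩
  · have := Metric.infDist_nonneg (x := x) (s := Aᶜ)
    gcongr
    have : 0 ≤ 3 * C₁ * C₂ + kernelMass⁻¹ * I := by positivity
    linarith
  have hl := h.1.integrableOn_indicator hA
  have hlf := locallyIntegrable_indicator hA.measurableSet hfi
  have hmg : MemLp (A.indicator fun x => weakGrad A ψ x i) 2 volume :=
    (memLp_indicator_iff_restrict hA.measurableSet).2 (h.1.memLp_weakGrad hA i)
  have hlg := hmg.locallyIntegrable (by norm_num : (1 : ENNReal) ≤ 2)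
  have hlim := ae_restrict_of_ae (s := A) (mol_tendsto_ae hlg 0)
  filter_upwards [hlim, ae_restrict_mem hA.measurableSet] with x hx hxA
  simp only [smul_zero, add_zero, indicator_of_mem hxA] at hx
  obtain ⟨x₀, hx₀, hd, hdpos, hball⟩ := exists_frontier_nearest hA hb hxA
  -- Half the distance to the boundary: the closed ball of radius `r` stays in `A`, and by linear
  -- decay `|ψ| ≤ 3 C₁ M r` on it.
  set r := dist x x₀ / 2
  have hr : 0 < r := half_pos hdpos
  have hrA : Metric.closedBall x r ⊆ A :=
    (Metric.closedBall_subset_ball (half_lt_self hdpos)).trans hball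
  have hrR : r ≤ R := by
    have h1 : ‖x‖ ≤ R₁ := by simpa using hR₁ (subset_closure hxA)
    have h2 : ‖x₀‖ ≤ R₁ := by simpa using hR₁ (frontier_subset_closure hx₀)
    have h3 : dist x x₀ ≤ ‖x‖ + ‖x₀‖ := by rw [dist_eq_norm]; exact norm_sub_le _ _
    have := le_abs_self R₁
    have := abs_nonneg R₁
    simp only [r, R]; linarith
  refine le_of_tendsto hx.abs ?_
  filter_upwards [Ioo_mem_nhdsGT hr] with δ hδ
  have hδ0 : 0 < δ := hδ.1
  have hδA : Metric.closedBall x δ ⊆ A :=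
    (Metric.closedBall_subset_closedBall hδ.2.le).trans hrA
  rw [← (h.1.isWeakPartial i).classicalPartial_mol hA hl hδ0 hδA]
  -- Since `ΔQ = rho δ - rho r`, testing the equation with `∂ᵢQ(x - ·)` gives `∂ᵢ(mol δ ψ)(x) = ∫
  -- ∂ᵢ(rho r)(x - y) ψ(y) dy - ∫ ∂ᵢQ(x - y) f(y) dy`. In the first term a factor `r⁻¹` from the
  -- kernel meets the factor `r` from the decay of `ψ`. In the second, `|∂ᵢQ(z)|` is at most a
  -- multiple of `|z|⁻¹`, uniformly in `δ`.
  set Q := radialPotential r δ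
  have hQ : ContDiff ℝ (⊤ : ℕ∞) Q := radialPotential_contDiff hr hδ0
  have hQc : HasCompactSupport Q := radialPotential_hasCompactSupport hr hδ0
  have hQs : tsupport (classicalPartial i Q) ⊆ Metric.closedBall 0 r :=
    (tsupport_classicalPartial_subset i Q).trans
      (tsupport_radialPotential_subset hr hδ0 le_rfl hδ.2.le)
  have hQi : ContDiff ℝ (⊤ : ℕ∞) (classicalPartial i Q) := hQ.classicalPartial (by simp) i
  have hlapQ : ∀ z, lap (classicalPartial i Q) z
      = classicalPartial i (rho δ) z - classicalPartial i (rho r) z := by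
    intro z
    have hcomm : lap (classicalPartial i Q) z = classicalPartial i (lap Q) z := by
      have d : ∀ j, DifferentiableAt ℝ (classicalPartial j (classicalPartial j Q)) z := fun j =>
        ((hQ.classicalPartial (m := (⊤ : ℕ∞)) (by simp) j).classicalPartial
          (m := (⊤ : ℕ∞)) (by simp) j).differentiable (by simp) z
      have e : lap Q = fun z => classicalPartial 0 (classicalPartial 0 Q) z
          + classicalPartial 1 (classicalPartial 1 Q) z := by
        funext z; simp [lap, Fin.sum_univ_two]
      rw [e, classicalPartial_add (d 0) (d 1), lap, Fin.sum_univ_two]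
      have c2 : ∀ {g : Plane → ℝ}, ContDiff ℝ (⊤ : ℕ∞) g → ∀ y, ContDiffAt ℝ 2 g y :=
        fun hg y => (hg.of_le (m := ((2 : ℕ∞) : WithTop ℕ∞)) (by exact_mod_cast le_top)).contDiffAt
      have key : ∀ j, classicalPartial j (classicalPartial j (classicalPartial i Q)) z
          = classicalPartial i (classicalPartial j (classicalPartial j Q)) z := by
        intro j
        have e1 : classicalPartial j (classicalPartial i Q)
            = classicalPartial i (classicalPartial j Q) :=
          funext fun y => classicalPartial_comm (c2 hQ y) j i
        rw [e1]
        exact classicalPartial_comm (c2 (hQ.classicalPartial (by simp) j) z) j i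
      rw [key, key]
    rw [hcomm, show lap Q = fun z => rho δ z - rho r z from
      funext fun z => laplacian_radialPotential hr hδ0 z]
    exact classicalPartial_sub ((rho_contDiff δ).differentiable (by simp) z)
      ((rho_contDiff r).differentiable (by simp) z) i
  have hker := h.integral_lap_kernel hA hQi hQs hrA
  have intρ : ∀ s, 0 < s → Integrable fun y => classicalPartial i (rho s) (x - y) • A.indicator ψ y :=
    fun s hs => integrable_smul_of_locallyIntegrable
      (((rho_contDiff s).classicalPartial (m := 0) (by simp) i).continuous.comp
        (continuous_const.sub continuous_id))
      (comp_const_sub_hasCompactSupport ((rho_hasCompactSupport hs).classicalPartial i) x) hl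
  simp_rw [hlapQ, sub_smul] at hker
  rw [integral_sub (intρ δ hδ0) (intρ r hr)] at hker
  rw [classicalPartial_mol hδ0 hl, sub_eq_iff_eq_add.1 hker]
  have b1 : |∫ y, classicalPartial i Q (x - y) • A.indicator f y| ≤ kernelMass⁻¹ * I * M := by
    have hi := (integrable_inv_norm_ball R).comp_sub_left x
    rw [← Real.norm_eq_abs]
    calc _ ≤ ∫ y, kernelMass⁻¹ * (Iic R).indicator (fun t => t⁻¹) ‖x - y‖ * M := by
          refine norm_integral_le_of_norm_le ((hi.const_mul _).mul_const _) ?_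
          filter_upwards [ae_indicator_bound hA.measurableSet hM.le hf] with y hy
          rw [norm_smul]
          by_cases hz : x - y ∈ Metric.closedBall (0 : Plane) r
          · have hzR : ‖x - y‖ ≤ R := (by simpa using hz : ‖x - y‖ ≤ r).trans hrR
            rw [indicator_of_mem (show ‖x - y‖ ∈ Iic R from hzR)]
            gcongr
            rw [partial_radialPotential hr hδ0]
            calc _ ≤ |radialField δ i (x - y)| + |radialField r i (x - y)| :=
                norm_sub_le (radialField δ i (x - y)) (radialField r i (x - y))
              _ ≤ (2 * kernelMass)⁻¹ * ‖x - y‖⁻¹ + (2 * kernelMass)⁻¹ * ‖x - y‖⁻¹ :=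
                add_le_add (abs_radialField_le _ _ _) (abs_radialField_le _ _ _)
              _ = _ := by rw [mul_inv]; ring
          · rw [image_eq_zero_of_notMem_tsupport fun h' => hz (hQs h'), norm_zero, zero_mul]
            refine mul_nonneg (mul_nonneg (by positivity) ?_) hM.le
            by_cases h' : ‖x - y‖ ≤ R
            · rw [indicator_of_mem (show ‖x - y‖ ∈ Iic R from h')]; positivity
            · rw [indicator_of_notMem (show ‖x - y‖ ∉ Iic R from h')]
      _ = _ := by
          rw [integral_mul_const, integral_const_mul,
            integral_sub_left_eq_self (fun z => (Iic R).indicator (fun t => t⁻¹) ‖z‖) volume x]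
  have b2 : |∫ y, classicalPartial i (rho r) (x - y) • A.indicator ψ y| ≤ 3 * C₁ * C₂ * M := by
    have hi : Integrable fun z => |classicalPartial i (rho r) z| :=
      (((rho_contDiff r).classicalPartial (m := 0) (by simp) i).continuous.integrable_of_hasCompactSupport
        ((rho_hasCompactSupport hr).classicalPartial i)).abs
    have hi' := hi.comp_sub_left x
    rw [← Real.norm_eq_abs]
    calc _ ≤ ∫ y, |classicalPartial i (rho r) (x - y)| * (3 * C₁ * M * r) := by
          refine norm_integral_le_of_norm_le (hi'.mul_const _) (Eventually.of_forall fun y => ?_)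
          rw [norm_smul, Real.norm_eq_abs]
          by_cases hz : x - y ∈ Metric.closedBall (0 : Plane) r
          · have hyb : y ∈ Metric.closedBall x r := by
              rw [Metric.mem_closedBall, dist_comm, dist_eq_norm]; simpa using hz
            rw [indicator_of_mem (hrA hyb)]
            gcongr
            refine (habs y (hrA hyb)).trans ?_
            have h1 : Metric.infDist y Aᶜ ≤ dist y x₀ := Metric.infDist_le_dist_of_mem (by
              rw [hA.frontier_eq] at hx₀; exact hx₀.2)
            have h2 : dist y x₀ ≤ 3 * r := by
              calc dist y x₀ ≤ dist y x + dist x x₀ := dist_triangle _ _ _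
                _ ≤ r + 2 * r := by
                  gcongr
                  · exact hyb
                  · simp only [r]; linarith
                _ = _ := by ring
            calc C₁ * M * Metric.infDist y Aᶜ ≤ C₁ * M * (3 * r) := by gcongr; exact h1.trans h2
              _ = _ := by ring
          · rw [image_eq_zero_of_notMem_tsupport fun h' => hz
              (tsupport_rho_subset hr (tsupport_classicalPartial_subset i _ h'))]
            simp
      _ = (∫ y, |classicalPartial i (rho r) y|) * (3 * C₁ * M * r) := by
          rw [integral_mul_const,
            integral_sub_left_eq_self (fun z => |classicalPartial i (rho r) z|) volume x]
      _ ≤ (C₂ * r⁻¹) * (3 * C₁ * M * r) := by gcongr; exact hρ r hr i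
      _ = _ := by field_simp
  calc _ ≤ |∫ y, classicalPartial i Q (x - y) • A.indicator f y|
        + |∫ y, classicalPartial i (rho r) (x - y) • A.indicator ψ y| := by
        refine (abs_add_le _ _).trans ?_
        rw [abs_neg]
    _ ≤ kernelMass⁻¹ * I * M + 3 * C₁ * C₂ * M := add_le_add b1 b2
    _ ≤ _ := by nlinarith

end Regularity
end

noncomputable section

/-! ### Orthogonality of gradients and divergence-free fields -/

section Orthogonality

/-- A smooth cutoff which is supported away from the complement of `A`. -/
def innerCutoff (A : Set Plane) (δ : ℝ) : Plane → ℝ :=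
  mol (δ / 2) ({x | δ ≤ Metric.infDist x Aᶜ}.indicator fun _ => (1 : ℝ))

lemma locallyIntegrable_indicator_one {S : Set Plane} (hS : MeasurableSet S) :
    LocallyIntegrable (S.indicator fun _ => (1 : ℝ)) :=
  (locallyIntegrable_const (1 : ℝ)).indicator hS

lemma measurableSet_infDist_ge (A : Set Plane) (δ : ℝ) :
    MeasurableSet {x | δ ≤ Metric.infDist x Aᶜ} :=
  (isClosed_le continuous_const (Metric.continuous_infDist_pt _)).measurableSet

lemma innerCutoff_contDiff (A : Set Plane) {δ : ℝ} (hδ : 0 < δ) :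
    ContDiff ℝ (⊤ : ℕ∞) (innerCutoff A δ) :=
  mol_contDiff (half_pos hδ) (locallyIntegrable_indicator_one (measurableSet_infDist_ge A δ))

lemma infDist_le_add {A : Set Plane} {x y : Plane} {r : ℝ} (hy : y ∈ Metric.closedBall x r) :
    Metric.infDist x Aᶜ ≤ Metric.infDist y Aᶜ + r := by
  have := Metric.infDist_le_infDist_add_dist (s := Aᶜ) (x := x) (y := y)
  rw [dist_comm] at this
  linarith [Metric.mem_closedBall.1 hy]

lemma innerCutoff_eq_zero {A : Set Plane} {δ : ℝ} (hδ : 0 < δ) {x : Plane}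
    (hx : Metric.infDist x Aᶜ < δ / 2) : innerCutoff A δ x = 0 := by
  refine mol_eq_zero (half_pos hδ) fun y hy => indicator_of_notMem (fun h => ?_) _
  have h : δ ≤ Metric.infDist y Aᶜ := h
  rw [Metric.mem_closedBall, dist_comm] at hy
  have := infDist_le_add (A := A) (Metric.mem_closedBall.2 hy)
  linarith

lemma innerCutoff_eq_one {A : Set Plane} {δ : ℝ} (hδ : 0 < δ) {x : Plane}
    (hx : 2 * δ ≤ Metric.infDist x Aᶜ) : innerCutoff A δ x = 1 := by
  have := norm_mol_sub_le (half_pos hδ)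
    (locallyIntegrable_indicator_one (measurableSet_infDist_ge A δ)) (x := x) (c := (1 : ℝ))
    (C := 0) (Eventually.of_forall fun y hy => by
      have := infDist_le_add (A := A) hy
      rw [indicator_of_mem (show y ∈ {x | δ ≤ Metric.infDist x Aᶜ} from
        (by linarith : δ ≤ Metric.infDist y Aᶜ)), sub_self, norm_zero])
  exact sub_eq_zero.1 (norm_le_zero_iff.1 this)

lemma abs_innerCutoff_le (A : Set Plane) {δ : ℝ} (hδ : 0 < δ) (x : Plane) :
    |innerCutoff A δ x| ≤ 1 :=
  norm_mol_le (half_pos hδ) (locallyIntegrable_indicator_one (measurableSet_infDist_ge A δ))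
    (Eventually.of_forall fun y _ => by
      by_cases h : y ∈ {x | δ ≤ Metric.infDist x Aᶜ} <;> simp [h])

lemma exists_partial_innerCutoff_le : ∃ C > 0, ∀ (A : Set Plane) (δ : ℝ), 0 < δ →
    ∀ i x, |classicalPartial i (innerCutoff A δ) x| ≤ C * δ⁻¹ := by
  obtain ⟨C, hC, h⟩ := exists_integral_abs_partial_rho_le
  refine ⟨C * 2, by positivity, fun A δ hδ i x => ?_⟩
  have hi : Integrable fun z => |classicalPartial i (rho (δ / 2)) z| :=
    (((rho_contDiff _).classicalPartial (m := 0) (by simp) i).continuous.integrable_of_hasCompactSupport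
      ((rho_hasCompactSupport (half_pos hδ)).classicalPartial i)).abs
  rw [innerCutoff, classicalPartial_mol (half_pos hδ)
    (locallyIntegrable_indicator_one (measurableSet_infDist_ge A δ)), ← Real.norm_eq_abs]
  calc _ ≤ ∫ y, |classicalPartial i (rho (δ / 2)) (x - y)| := by
        refine norm_integral_le_of_norm_le (hi.comp_sub_left x) (Eventually.of_forall fun y => ?_)
        rw [norm_smul]
        refine mul_le_of_le_one_right (norm_nonneg _) ?_
        by_cases h : y ∈ {x | δ ≤ Metric.infDist x Aᶜ} <;> simp [h]
    _ = ∫ y, |classicalPartial i (rho (δ / 2)) y| :=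
        integral_sub_left_eq_self (fun z => |classicalPartial i (rho (δ / 2)) z|) volume x
    _ ≤ C * (δ / 2)⁻¹ := h _ (half_pos hδ) i
    _ = _ := by field_simp

lemma innerCutoff_isTestFunction {A : Set Plane} (hb : Bornology.IsBounded A) {δ : ℝ}
    (hδ : 0 < δ) : IsTestFunction A (innerCutoff A δ) := by
  have hcl : IsClosed {x | δ / 2 ≤ Metric.infDist x Aᶜ} :=
    isClosed_le continuous_const (Metric.continuous_infDist_pt _)
  have hsub : {x | δ / 2 ≤ Metric.infDist x Aᶜ} ⊆ A := by
    intro x hx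
    by_contra hxA
    have h0 : Metric.infDist x Aᶜ = 0 := Metric.infDist_zero_of_mem hxA
    have : δ / 2 ≤ Metric.infDist x Aᶜ := hx
    linarith
  have hts : tsupport (innerCutoff A δ) ⊆ {x | δ / 2 ≤ Metric.infDist x Aᶜ} := by
    refine closure_minimal (fun x hx => ?_) hcl
    by_contra h
    exact hx (innerCutoff_eq_zero hδ (not_le.1 h))
  exact ⟨innerCutoff_contDiff A hδ, (Metric.isCompact_of_isClosed_isBounded hcl
    (hb.subset hsub)).of_isClosed_subset (isClosed_tsupport _) hts, hts.trans hsub⟩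

lemma infDist_compl_pos {A : Set Plane} (hA : IsOpen A) (hb : Bornology.IsBounded A) {x : Plane}
    (hx : x ∈ A) : 0 < Metric.infDist x Aᶜ := by
  obtain ⟨x₀, -, h1, h2, -⟩ := exists_frontier_nearest hA hb hx
  rwa [h1]

lemma isFiniteMeasure_restrict {A : Set Plane} (hb : Bornology.IsBounded A) :
    IsFiniteMeasure (volume.restrict A) := ⟨by
  rw [Measure.restrict_apply_univ]; exact hb.measure_lt_top⟩

/-- A function of `H¹` vanishing linearly at the boundary has a gradient orthogonal to the
divergence-free fields. -/
lemma MemH1.integral_weakGrad_mul_eq_zero {A : Set Plane} (hA : IsOpen A)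
    (hb : Bornology.IsBounded A) {ψ : Plane → ℝ} (hψ : MemH1 A ψ) {C : ℝ} (hC : 0 ≤ C)
    (hdec : ∀ x ∈ A, |ψ x| ≤ C * Metric.infDist x Aᶜ) {Y : Fin 2 → Plane → ℝ}
    (hY : ∀ i, ContDiffOn ℝ (⊤ : ℕ∞) (Y i) A)
    (hdiv : ∀ x ∈ A, ∑ i, classicalPartial i (Y i) x = 0)
    (hY2 : ∀ i, MemLp (Y i) 2 (volume.restrict A)) :
    ∫ x in A, ∑ i, weakGrad A ψ x i * Y i x = 0 := by
  have := isFiniteMeasure_restrict hb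
  obtain ⟨C', hC', hχ⟩ := exists_partial_innerCutoff_le
  have hpos : ∀ᶠ δ : ℝ in 𝓝[>] 0, 0 < δ := self_mem_nhdsWithin
  have hsmall : ∀ x ∈ A, ∀ᶠ δ : ℝ in 𝓝[>] 0, 2 * δ < Metric.infDist x Aᶜ := by
    intro x hx
    have := infDist_compl_pos hA hb hx
    filter_upwards [Ioo_mem_nhdsGT (half_pos this)] with δ hδ
    linarith [hδ.2]
  have hgi : ∀ i, IntegrableOn (fun x => weakGrad A ψ x i * Y i x) A := fun i =>
    (hψ.memLp_weakGrad hA i).integrable_mul_two (hY2 i)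
  have hYi : ∀ i, IntegrableOn (Y i) A := fun i => (hY2 i).integrable (by norm_num)
  have L1 : Tendsto (fun δ : ℝ => ∫ x in A, innerCutoff A δ x * ∑ i, weakGrad A ψ x i * Y i x)
      (𝓝[>] 0) (𝓝 (∫ x in A, ∑ i, weakGrad A ψ x i * Y i x)) := by
    have hS : IntegrableOn (fun x => ∑ i, weakGrad A ψ x i * Y i x) A :=
      integrable_finsetSum _ fun i _ => hgi i
    refine tendsto_integral_filter_of_dominated_convergence
      (fun x => ‖∑ i, weakGrad A ψ x i * Y i x‖) ?_ ?_ hS.norm ?_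
    · exact hpos.mono fun δ hδ =>
        (innerCutoff_contDiff A hδ).continuous.aestronglyMeasurable.mul hS.1
    · refine hpos.mono fun δ hδ => Eventually.of_forall fun x => ?_
      rw [norm_mul]
      exact mul_le_of_le_one_left (norm_nonneg _) (abs_innerCutoff_le A hδ x)
    · filter_upwards [ae_restrict_mem hA.measurableSet] with x hx
      refine tendsto_const_nhds.congr' ?_
      filter_upwards [hsmall x hx, hpos] with δ hδ hδ0
      rw [innerCutoff_eq_one hδ0 hδ.le, one_mul]
  -- The cutoff varies only within distance `2δ` of the complement, where `|ψ| ≤ 2Cδ` compensates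
  -- `|∇χ| ≤ C'/δ`. The integrand is dominated by a multiple of `|Y|` and is eventually zero at each
  -- point.
  have L2 : Tendsto (fun δ : ℝ => ∫ x in A, ∑ i, ψ x * (classicalPartial i (innerCutoff A δ) x
      * Y i x)) (𝓝[>] 0) (𝓝 (∫ _ in A, (0 : ℝ))) := by
    refine tendsto_integral_filter_of_dominated_convergence
      (fun x => ∑ i, 2 * C * C' * |Y i x|) ?_ ?_ ?_ ?_
    · refine hpos.mono fun δ hδ => ?_
      refine Finset.aestronglyMeasurable_fun_sum _ fun i _ => ?_
      exact hψ.1.1.mul (((innerCutoff_contDiff A hδ).classicalPartial (m := 0)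
        (by simp) i).continuous.aestronglyMeasurable.mul (hY2 i).1)
    · refine hpos.mono fun δ hδ => ?_
      filter_upwards [ae_restrict_mem hA.measurableSet] with x hx
      refine (norm_sum_le _ _).trans (Finset.sum_le_sum fun i _ => ?_)
      rw [← mul_assoc, norm_mul, norm_mul, Real.norm_eq_abs, Real.norm_eq_abs, Real.norm_eq_abs]
      refine mul_le_mul_of_nonneg_right ?_ (abs_nonneg _)
      by_cases h : 2 * δ < Metric.infDist x Aᶜ
      · have he : innerCutoff A δ =ᶠ[𝓝 x] fun _ => 1 := by
          filter_upwards [(Metric.continuous_infDist_pt Aᶜ).continuousAt.eventually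
            (lt_mem_nhds h)] with y hy using innerCutoff_eq_one hδ hy.le
        rw [classicalPartial_eq_zero_of_eventuallyEq i he, abs_zero, mul_zero]
        positivity
      · rw [not_lt] at h
        calc _ ≤ (C * (2 * δ)) * (C' * δ⁻¹) := by
              exact mul_le_mul ((hdec x hx).trans (mul_le_mul_of_nonneg_left h hC))
                (hχ A δ hδ i x) (abs_nonneg _) (by positivity)
          _ = _ := by field_simp
    · exact integrable_finsetSum _ fun i _ => (hYi i).abs.const_mul _
    · filter_upwards [ae_restrict_mem hA.measurableSet] with x hx
      refine tendsto_const_nhds.congr' ?_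
      filter_upwards [hsmall x hx, hpos] with δ hδ hδ0
      have he : innerCutoff A δ =ᶠ[𝓝 x] fun _ => 1 := by
        filter_upwards [(Metric.continuous_infDist_pt Aᶜ).continuousAt.eventually
          (lt_mem_nhds hδ)] with y hy using innerCutoff_eq_one hδ0 hy.le
      simp [classicalPartial_eq_zero_of_eventuallyEq _ he]
  have key : ∀ᶠ δ : ℝ in 𝓝[>] 0,
      ∫ x in A, innerCutoff A δ x * ∑ i, weakGrad A ψ x i * Y i x
      = - ∫ x in A, ∑ i, ψ x * (classicalPartial i (innerCutoff A δ) x * Y i x) := by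
    filter_upwards [hpos] with δ hδ
    have hχt := innerCutoff_isTestFunction hb hδ
    have ht : ∀ i, IsTestFunction A fun x => innerCutoff A δ x * Y i x := fun i =>
      hχt.mul_left hA (hY i)
    have hw := fun i => (hψ.isWeakPartial i)
    have e1 : ∫ x in A, innerCutoff A δ x * ∑ i, weakGrad A ψ x i * Y i x
        = ∑ i, ∫ x in A, (innerCutoff A δ x * Y i x) • weakGrad A ψ x i := by
      rw [← integral_finsetSum _ fun i _ => (ht i).integrableOn_smul (hw i).2.1]
      refine integral_congr_ae (Eventually.of_forall fun x => ?_)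
      simp only [Finset.mul_sum, smul_eq_mul]
      exact Finset.sum_congr rfl fun i _ => by ring
    have e2 : ∀ i, ∫ x in A, (innerCutoff A δ x * Y i x) • weakGrad A ψ x i
        = - ∫ x in A, classicalPartial i (fun x => innerCutoff A δ x * Y i x) x • ψ x :=
      fun i => by rw [(hw i).2.2 _ (ht i), neg_neg]
    rw [e1, Finset.sum_congr rfl fun i _ => e2 i, Finset.sum_neg_distrib,
      ← integral_finsetSum _ fun i _ => ((ht i).classicalPartial i).integrableOn_smul (hw i).1]
    congr 1
    refine setIntegral_congr_fun hA.measurableSet fun x hx => ?_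
    have hp : ∀ i, classicalPartial i (fun x => innerCutoff A δ x * Y i x) x
        = innerCutoff A δ x * classicalPartial i (Y i) x
          + classicalPartial i (innerCutoff A δ) x * Y i x := fun i =>
      classicalPartial_smul (𝕜 := ℝ) (hχt.1.differentiable (by simp) x)
        (((hY i).contDiffAt (hA.mem_nhds hx)).differentiableAt (by simp)) i
    have hd := hdiv x hx
    simp only [hp, smul_eq_mul, Fin.sum_univ_two] at hd ⊢
    linear_combination (innerCutoff A δ x * ψ x) * hd
  have := tendsto_nhds_unique_of_eventuallyEq L1 L2.neg key
  simpa using this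

end Orthogonality

/-! ### The phase potential -/

section PhasePotential

/-- The indicator of the `r / 2`-neighbourhood of the hole, mollified at scale `r / 4`, remains `1`
within `r / 4` of the hole and vanishes beyond distance `r`. -/
lemma exists_hole_cutoff {D B : Set Plane} (h : IsAnnularPair D B) :
    ∃ η : Plane → ℝ, IsTestFunction D η ∧ ∀ᶠ x in 𝓝ˢ (closure B), η x = 1 := by
  have hK : IsCompact (closure B) :=
    (h.isBounded_outer.subset (subset_closure.trans h.closure_hole_subset)).isCompact_closure
  obtain ⟨r, hr, hrD⟩ := hK.exists_cthickening_subset_open h.isOpen_outer h.closure_hole_subset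
  set S := Metric.cthickening (r / 2) (closure B)
  have hS : IsCompact S := hK.cthickening
  have hδ : 0 < r / 4 := by positivity
  have hl := locallyIntegrable_indicator_one hS.measurableSet
  set η := mol (r / 4) (S.indicator fun _ => (1 : ℝ))
  have hts : tsupport η ⊆ Metric.cthickening r (closure B) := by
    refine closure_minimal (fun x hx => ?_) Metric.isClosed_cthickening
    by_contra hn
    refine hx (mol_eq_zero hδ fun y hy => indicator_of_notMem (fun hyS => hn ?_) _)
    have : x ∈ Metric.cthickening (r / 4) S := Metric.mem_cthickening_of_dist_le x y _ _ hyS (by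
      rw [dist_comm]; exact hy)
    exact Metric.cthickening_mono (by linarith) _
      (Metric.cthickening_cthickening_subset (by positivity) (by positivity) _ this)
  refine ⟨η, ⟨mol_contDiff hδ hl, hK.cthickening.of_isClosed_subset (isClosed_tsupport _) hts,
    hts.trans hrD⟩, ?_⟩
  have hop : Metric.thickening (r / 4) (closure B) ∈ 𝓝ˢ (closure B) :=
    Metric.thickening_mem_nhdsSet _ hδ
  filter_upwards [hop] with x hx
  have := norm_mol_sub_le hδ hl (x := x) (c := (1 : ℝ)) (C := 0)
    (Eventually.of_forall fun y hy => by
      have : y ∈ S := by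
        have h1 : y ∈ Metric.cthickening (r / 4) (Metric.cthickening (r / 4) (closure B)) :=
          Metric.mem_cthickening_of_dist_le y x _ _ (Metric.thickening_subset_cthickening _ _ hx) hy
        have := Metric.cthickening_cthickening_subset hδ.le hδ.le _ h1
        rwa [show r / 4 + r / 4 = r / 2 by ring] at this
      rw [indicator_of_mem this, sub_self, norm_zero])
  exact sub_eq_zero.1 (norm_le_zero_iff.1 this)

/-- Local Lipschitz constants bound `fderiv ℝ V`, also at points of nondifferentiability, where it
is zero by convention. -/
lemma exists_curl_bound {V : Plane → Plane} (hV : LocallyLipschitz V) {K : Set Plane}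
    (hK : IsCompact K) : ∃ C, ∀ x ∈ K, |curl V x| ≤ C := by
  have h := hK.induction_on (p := fun K => ∃ C, ∀ x ∈ K, ‖fderiv ℝ V x‖ ≤ C) ⟨0, by simp⟩
    (fun s t hst ⟨C, hC⟩ => ⟨C, fun x hx => hC x (hst hx)⟩)
    (fun s t ⟨C, hC⟩ ⟨C', hC'⟩ => ⟨max C C', fun x hx => hx.elim
      (fun h => (hC x h).trans (le_max_left _ _)) (fun h => (hC' x h).trans (le_max_right _ _))⟩)
    (fun x _ => by
      obtain ⟨C, t, ht, hl⟩ := hV x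
      refine ⟨interior t, mem_nhdsWithin_of_mem_nhds (interior_mem_nhds.2 ht), C, fun y hy => ?_⟩
      exact norm_fderiv_le_of_lipschitzOn ℝ (mem_interior_iff_mem_nhds.1 hy) hl)
  obtain ⟨C, hC⟩ := h
  refine ⟨C + C, fun x hx => ?_⟩
  have hb : ∀ i j : Fin 2, |classicalPartial i V x j| ≤ C := fun i j =>
    (abs_coord_le _ j).trans ((ContinuousLinearMap.le_opNorm _ _).trans (by
      simpa using hC x hx))
  exact (norm_sub_le (classicalPartial 0 V x 1) (classicalPartial 1 V x 0)).trans
    (add_le_add (hb 0 1) (hb 1 0))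

lemma measurable_curl (V : Plane → Plane) : Measurable (curl V) := by
  have h : ∀ i j : Fin 2, Measurable fun x => classicalPartial i V x j := fun i j =>
    (EuclideanSpace.proj j : Plane →L[ℝ] ℝ).continuous.measurable.comp
      (measurable_fderiv_apply_const ℝ V _)
  exact (h 0 1).sub (h 1 0)

lemma MemH1.sub_smooth {A : Set Plane} (hA : IsOpen A) {ψ η : Plane → ℝ} (hψ : MemH1 A ψ)
    (hη : ContDiff ℝ (⊤ : ℕ∞) η) (hc : HasCompactSupport η) (c : ℝ) :
    MemH1 A (fun x => ψ x - c * η x) ∧ ∀ i, IsWeakPartial A i (fun x => ψ x - c * η x)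
      (fun x => weakGrad A ψ x i - c * classicalPartial i η x) := by
  have hw : ∀ i, IsWeakPartial A i (fun x => ψ x - c * η x)
      (fun x => weakGrad A ψ x i - c * classicalPartial i η x) := by
    intro i
    have h1 : IsWeakPartial A i η (classicalPartial i η) :=
      (hη.of_le (by exact_mod_cast le_top)).contDiffOn.isWeakPartial hA i
    have h2 := (hψ.isWeakPartial i).add (h1.clm_comp ((-c) • ContinuousLinearMap.id ℝ ℝ))
    simpa [sub_eq_add_neg] using h2
  have hm : ∀ (g : Plane → ℝ), Continuous g → HasCompactSupport g →
      MemLp (fun x => c * g x) 2 (volume.restrict A) := fun g hg hgc =>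
    ((hg.memLp_of_hasCompactSupport hgc).restrict A).const_mul c
  refine ⟨⟨hψ.1.sub (hm η hη.continuous hc), fun i => ⟨_, hw i, ?_⟩⟩, hw⟩
  exact (hψ.memLp_weakGrad hA i).sub
    (hm _ (hη.classicalPartial (m := 0) (by simp) i).continuous (hc.classicalPartial i))

/-- The phase potentials with boundary value `c` on the hole have gradients bounded linearly in
the rotation speed and in `c`, and they are tested by `c` times a cutoff. -/
theorem exists_phasePotential_bound {D B : Set Plane} (hDB : IsAnnularPair D B)
    {V : Plane → Plane} (hV : LocallyLipschitz V) {η : Plane → ℝ} (hη : IsTestFunction D η)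
    (hη1 : ∀ᶠ x in 𝓝ˢ (closure B), η x = 1) :
    ∃ C > 0, ∀ (Ω : ℝ) (d : ℤ) (Φ : Plane → ℝ), 0 < Ω → IsPhasePotential D B V Ω d Φ →
      ∃ c : ℝ, (∀ i, ∀ᵐ x ∂(volume.restrict (annulus D B)),
          |weakGrad (annulus D B) Φ x i| ≤ C * (Ω + |c|)) ∧
        ∀ Y : Fin 2 → Plane → ℝ, (∀ i, ContDiffOn ℝ (⊤ : ℕ∞) (Y i) (annulus D B)) →
          (∀ x ∈ annulus D B, ∑ i, classicalPartial i (Y i) x = 0) →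
          (∀ i, MemLp (Y i) 2 (volume.restrict (annulus D B))) →
          ∫ x in annulus D B, ∑ i, weakGrad (annulus D B) Φ x i * Y i x
            = c * ∫ x in annulus D B, ∑ i, classicalPartial i η x * Y i x := by
  set A := annulus D B with hAdef
  have hA : IsOpen A := isOpen_annulus hDB
  have hb : Bornology.IsBounded A := isBounded_annulus hDB
  have := isFiniteMeasure_restrict hb
  obtain ⟨C, hC, hreg⟩ := (hasSmoothBoundary_annulus hDB).exists_poisson_bound hA hb
  obtain ⟨C₁, hC₁⟩ := exists_curl_bound hV hb.isCompact_closure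
  have hηp : ∀ i, ContDiff ℝ (⊤ : ℕ∞) (classicalPartial i η) := fun i =>
    hη.1.classicalPartial (by simp) i
  have hlapc : Continuous (lap η) := continuous_finsetSum _ fun i _ =>
    ((hηp i).classicalPartial (m := 0) (by simp) i).continuous
  have hlaps : HasCompactSupport (lap η) := by
    have : lap η = fun x => classicalPartial 0 (classicalPartial 0 η) x
        + classicalPartial 1 (classicalPartial 1 η) x := by
      funext x; simp [lap, Fin.sum_univ_two]
    rw [this]
    exact ((hη.2.1.classicalPartial 0).classicalPartial 0).add
      ((hη.2.1.classicalPartial 1).classicalPartial 1)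
  obtain ⟨C₂, hC₂⟩ := hlapc.bounded_above_of_compact_support hlaps
  have hpb : ∃ C₃, ∀ i x, |classicalPartial i η x| ≤ C₃ := by
    obtain ⟨a, ha⟩ := (hηp 0).continuous.bounded_above_of_compact_support (hη.2.1.classicalPartial 0)
    obtain ⟨b, hb⟩ := (hηp 1).continuous.bounded_above_of_compact_support (hη.2.1.classicalPartial 1)
    refine ⟨max a b, fun i x => ?_⟩
    fin_cases i
    · exact (ha x).trans (le_max_left _ _)
    · exact (hb x).trans (le_max_right _ _)
  obtain ⟨C₃, hC₃⟩ := hpb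
  set M₁ := |C₁| + |C₂| + 1
  refine ⟨C * M₁ + |C₃|, by positivity, ?_⟩
  intro Ω d Φ hΩ hΦ
  obtain ⟨c, hc⟩ := hΦ.hole_boundary
  refine ⟨c, ?_⟩
  -- Subtracting `c η` removes the boundary value on the hole: `ψ` vanishes on the whole boundary,
  -- and its source `Ω curl V + c Δη` is `O(Ω + |c|)`.
  set ψ : Plane → ℝ := fun x => Φ x - c * η x
  set f : Plane → ℝ := fun x => Ω * curl V x + c * lap η x
  obtain ⟨hψ, hψw⟩ := hΦ.equation.1.sub_smooth hA hη.1 hη.2.1 c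
  have hψg : ∀ i, ∀ᵐ x ∂(volume.restrict A), weakGrad A ψ x i
      = weakGrad A Φ x i - c * classicalPartial i η x := fun i => (hψw i).weakGrad_ae_eq hA
  have hcurl : IntegrableOn (fun x => Ω * curl V x) A := by
    refine Measure.integrableOn_of_bounded (M := Ω * |C₁|) hb.measure_lt_top.ne
      ((measurable_curl V).const_mul Ω).aestronglyMeasurable ?_
    filter_upwards [ae_restrict_mem hA.measurableSet] with x hx
    rw [norm_mul, Real.norm_of_nonneg hΩ.le]
    gcongr
    exact (hC₁ x (subset_closure hx)).trans (le_abs_self _)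
  have hlapi : IntegrableOn (fun x => c * lap η x) A :=
    ((hlapc.integrable_of_hasCompactSupport hlaps).integrableOn).const_mul c
  have hfi : IntegrableOn f A := hcurl.add hlapi
  have hfb : ∀ᵐ x ∂(volume.restrict A), |f x| ≤ (Ω + |c|) * M₁ := by
    filter_upwards [ae_restrict_mem hA.measurableSet] with x hx
    calc |f x| ≤ |Ω * curl V x| + |c * lap η x| := abs_add_le _ _
      _ ≤ Ω * M₁ + |c| * M₁ := by
        rw [abs_mul, abs_mul, abs_of_pos hΩ]
        have h1 := (hC₁ x (subset_closure hx)).trans (le_abs_self _)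
        have h2 : |lap η x| ≤ |C₂| := (hC₂ x).trans (le_abs_self _)
        have := abs_nonneg C₁
        have := abs_nonneg C₂
        gcongr <;> simp only [M₁] <;> linarith
      _ = _ := by ring
  have hηA : ContDiffOn ℝ 1 η A := (hη.1.of_le (by exact_mod_cast le_top)).contDiffOn
  have hpoisson : IsWeakPoissonSolution A f ψ := by
    refine ⟨hψ, fun φ hφ => ?_⟩
    have hφi := fun i => hφ.classicalPartial i
    have iΦ : ∀ i, IntegrableOn (fun x => weakGrad A Φ x i * classicalPartial i φ x) A := fun i =>
      ((hφi i).integrableOn_smul (hΦ.equation.1.isWeakPartial i).2.1).congr_fun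
        (fun x _ => by simp only [smul_eq_mul]; ring) hA.measurableSet
    have lη : ∀ i, LocallyIntegrableOn (classicalPartial i η) A := fun i =>
      (hηp i).continuous.continuousOn.locallyIntegrableOn hA.measurableSet
    have iη : ∀ i, IntegrableOn (fun x => classicalPartial i φ x • classicalPartial i η x) A :=
      fun i => (hφi i).integrableOn_smul (lη i)
    have iηη : ∀ i, IntegrableOn (fun x => φ x • classicalPartial i (classicalPartial i η) x) A :=
      fun i => hφ.integrableOn_smul (((hηp i).classicalPartial (m := 0)
        (by simp) i).continuous.continuousOn.locallyIntegrableOn hA.measurableSet)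
    have e1 : ∫ x in A, ∑ i, weakGrad A ψ x i * classicalPartial i φ x
        = (∫ x in A, ∑ i, weakGrad A Φ x i * classicalPartial i φ x)
          - c * ∫ x in A, ∑ i, classicalPartial i φ x • classicalPartial i η x := by
      rw [← integral_const_mul, ← integral_sub (integrable_finsetSum _ fun i _ => iΦ i)
        ((integrable_finsetSum _ fun i _ => iη i).const_mul c)]
      refine integral_congr_ae ?_
      filter_upwards [hψg 0, hψg 1] with x h0 h1
      simp only [Fin.sum_univ_two, h0, h1, smul_eq_mul]; ring
    have e2 : ∫ x in A, ∑ i, classicalPartial i φ x • classicalPartial i η x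
        = - ∫ x in A, φ x * lap η x := by
      rw [integral_finsetSum _ fun i _ => iη i]
      have : ∀ i, ∫ x in A, classicalPartial i φ x • classicalPartial i η x
          = - ∫ x in A, φ x • classicalPartial i (classicalPartial i η) x := fun i =>
        setIntegral_classicalPartial_smul hA (hφ.1.of_le (by exact_mod_cast le_top)) hφ.2.1
          hφ.2.2 ((hηp i).of_le (by exact_mod_cast le_top)).contDiffOn i
      rw [Finset.sum_congr rfl fun i _ => this i, Finset.sum_neg_distrib,
        ← integral_finsetSum _ fun i _ => iηη i]
      congr 1
      exact integral_congr_ae (Eventually.of_forall fun x => by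
        simp only [lap, Finset.mul_sum, smul_eq_mul])
    have j1 : IntegrableOn (fun x => Ω * curl V x * φ x) A :=
      (hφ.integrableOn_smul hcurl.locallyIntegrableOn).congr_fun
        (fun x _ => by simp only [smul_eq_mul]; ring) hA.measurableSet
    have j2 : IntegrableOn (fun x => c * (φ x * lap η x)) A :=
      (hφ.integrableOn_smul (hlapc.continuousOn.locallyIntegrableOn
        hA.measurableSet)).const_mul c
    rw [e1, e2, hΦ.equation.2 φ hφ, mul_neg, sub_neg_eq_add, ← integral_const_mul,
      ← integral_add j1 j2]
    exact integral_congr_ae (Eventually.of_forall fun x => by simp only [f]; ring)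
  have hcont : ContinuousOn ψ (closure A) :=
    hΦ.continuousOn.sub (continuousOn_const.mul hη.1.continuous.continuousOn)
  have hbd : ∀ x ∈ frontier A, ψ x = 0 := by
    intro x hx
    rcases frontier_annulus_subset hDB hx with h | h
    · have : η x = 0 := image_eq_zero_of_notMem_tsupport fun h' =>
        frontier_outer_disjoint hDB h (hη.2.2 h')
      simp only [ψ, hΦ.outer_boundary x h, this, mul_zero, sub_zero]
    · have : η x = 1 := (eventually_nhdsSet_iff_forall.1 hη1 x
        (frontier_subset_closure h)).self_of_nhds
      simp only [ψ, hc x h, this, mul_one, sub_self]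
  have hMpos : 0 < (Ω + |c|) * M₁ := by positivity
  obtain ⟨hdec, hgrad⟩ := hreg _ f ψ hMpos hpoisson hfi hfb hcont hbd
  refine ⟨fun i => ?_, fun Y hY hdiv hY2 => ?_⟩
  · filter_upwards [hgrad i, hψg i] with x h1 h2
    have h3 : weakGrad A Φ x i = weakGrad A ψ x i + c * classicalPartial i η x := by
      rw [h2]; ring
    rw [h3]
    calc _ ≤ |weakGrad A ψ x i| + |c * classicalPartial i η x| := abs_add_le _ _
      _ ≤ C * ((Ω + |c|) * M₁) + (Ω + |c|) * |C₃| := by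
        rw [abs_mul]
        exact add_le_add h1 (mul_le_mul (by linarith) ((hC₃ i x).trans (le_abs_self _))
          (abs_nonneg _) (by positivity))
      _ = _ := by ring
  -- `∇ψ` is orthogonal to `Y`, so only the part `c ∇η` of `∇Φ` contributes.
  · have h0 := hψ.integral_weakGrad_mul_eq_zero hA hb (C := C * ((Ω + |c|) * M₁)) (by positivity)
      hdec hY hdiv hY2
    have iΦ : ∀ i, IntegrableOn (fun x => weakGrad A Φ x i * Y i x) A := fun i =>
      (hΦ.equation.1.memLp_weakGrad hA i).integrable_mul_two (hY2 i)
    have iη : ∀ i, IntegrableOn (fun x => classicalPartial i η x * Y i x) A := fun i =>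
      (((hηp i).continuous.memLp_of_hasCompactSupport
        (hη.2.1.classicalPartial i)).restrict A).integrable_mul_two (hY2 i)
    have e1 : ∫ x in A, ∑ i, weakGrad A ψ x i * Y i x
        = (∫ x in A, ∑ i, weakGrad A Φ x i * Y i x)
          - c * ∫ x in A, ∑ i, classicalPartial i η x * Y i x := by
      rw [← integral_const_mul, ← integral_sub (integrable_finsetSum _ fun i _ => iΦ i)
        ((integrable_finsetSum _ fun i _ => iη i).const_mul c)]
      refine integral_congr_ae ?_
      filter_upwards [hψg 0, hψg 1] with x h0 h1
      simp only [Fin.sum_univ_two, h0, h1]; ring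
    linarith

end PhasePotential
end

noncomputable section

/-! ### The angle function and stream functions -/

/-- Near `x` the values of `f` differ from `f x` by less than one, so `f` equals `f x` plus the
principal logarithm of `g / g x`, which is smooth since the quotient is close to `1`. -/
lemma ContinuousOn.contDiffOn_of_exp_eq {U : Set Plane} (hU : IsOpen U) {f g : Plane → ℂ}
    (hf : ContinuousOn f U) (hg : ContDiffOn ℝ (⊤ : ℕ∞) g U)
    (h : ∀ x ∈ U, Complex.exp (f x) = g x) : ContDiffOn ℝ (⊤ : ℕ∞) f U := by
  intro x hx
  have hg0 : ∀ y ∈ U, g y ≠ 0 := fun y hy => h y hy ▸ Complex.exp_ne_zero _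
  have hfx : ContinuousAt f x := hf.continuousAt (hU.mem_nhds hx)
  have hgx : ContDiffAt ℝ (⊤ : ℕ∞) g x := hg.contDiffAt (hU.mem_nhds hx)
  have hlog : ContDiffAt ℝ (⊤ : ℕ∞) (fun y => f x + Complex.log (g y / g x)) x := by
    refine contDiffAt_const.add (ContDiffAt.comp x (g := Complex.log) ?_ ?_)
    · refine (Complex.contDiffAt_log ?_).restrict_scalars ℝ
      rw [div_self (hg0 x hx)]; simp
    · simp only [div_eq_mul_inv]
      exact hgx.mul contDiffAt_const
  refine (hlog.congr_of_eventuallyEq ?_).contDiffWithinAt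
  have hnear : ∀ᶠ y in 𝓝 x, ‖f y - f x‖ < 1 := by
    have : Tendsto (fun y => ‖f y - f x‖) (𝓝 x) (𝓝 0) :=
      tendsto_iff_norm_sub_tendsto_zero.1 hfx
    exact this.eventually (gt_mem_nhds one_pos)
  filter_upwards [hnear, hU.mem_nhds hx] with y hy hyU
  have him : |(f y - f x).im| < 1 := (Complex.abs_im_le_norm _).trans_lt hy
  have hpi := Real.pi_gt_three
  rw [← h y hyU, ← h x hx, ← Complex.exp_sub, Complex.log_exp]
  · ring
  · linarith [(abs_lt.1 him).1]
  · linarith [(abs_lt.1 him).2]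

/-- A simply connected domain carries a smooth branch of the angle around any outer point. -/
lemma IsSimplyConnected.exists_angle {D : Set Plane} (hD : IsSimplyConnected D) (hDo : IsOpen D)
    {a : Plane} (ha : a ∉ D) : ∃ θ : Plane → ℝ, ContDiffOn ℝ (⊤ : ℕ∞) θ D ∧
      ∀ x ∈ D, classicalPartial 0 θ x = -((x - a) 1 / ‖x - a‖ ^ 2) ∧
        classicalPartial 1 θ x = (x - a) 0 / ‖x - a‖ ^ 2 := by
  set T : Plane →L[ℝ] ℂ := Complex.ofRealCLM.comp (EuclideanSpace.proj (0 : Fin 2))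
    + Complex.I • Complex.ofRealCLM.comp (EuclideanSpace.proj (1 : Fin 2)) with hT
  have hTx : ∀ x : Plane, T x = (x 0 : ℂ) + Complex.I * (x 1 : ℂ) := fun x => by simp [hT]
  have hTre : ∀ x : Plane, (T x).re = x 0 := fun x => by simp [hTx]
  have hTim : ∀ x : Plane, (T x).im = x 1 := fun x => by simp [hTx]
  set g : Plane → ℂ := fun x => T (x - a) with hgdef
  have hgc : ContDiff ℝ (⊤ : ℕ∞) g := T.contDiff.comp (contDiff_id.sub contDiff_const)
  have hg0 : 0 ∉ g '' D := by
    rintro ⟨x, hx, h0⟩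
    have h1 : x - a = 0 := by
      have hr := hTre (x - a)
      have hi := hTim (x - a)
      have h0' : T (x - a) = 0 := h0
      rw [h0'] at hr hi
      ext i; fin_cases i
      · exact hr.symm
      · exact hi.symm
    exact ha (sub_eq_zero.1 h1 ▸ hx)
  -- On a simply connected set the nonvanishing map `x ↦ x - a`, read in `ℂ`, has a continuous
  -- logarithm. The angle is its imaginary part.
  obtain ⟨f, hf, hfg⟩ := Complex.exists_continuousOn_eqOn_exp_comp hD hDo
    hgc.continuous.continuousOn hg0
  have hfs : ContDiffOn ℝ (⊤ : ℕ∞) f D :=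
    hf.contDiffOn_of_exp_eq hDo hgc.contDiffOn hfg
  have hpart : ∀ x ∈ D, ∀ i, T (EuclideanSpace.single i 1) = g x * classicalPartial i f x := by
    intro x hx i
    have hd : HasFDerivAt f (fderiv ℝ f x) x :=
      ((hfs.contDiffAt (hDo.mem_nhds hx)).differentiableAt (by simp)).hasFDerivAt
    have h1 : HasFDerivAt (fun y => Complex.exp (f y)) (Complex.exp (f x) • fderiv ℝ f x) x :=
      hd.cexp
    have h2 : HasFDerivAt g T x :=
      T.hasFDerivAt.comp x ((hasFDerivAt_id x).sub_const a)
    have h3 : (fun y => Complex.exp (f y)) =ᶠ[𝓝 x] g := by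
      filter_upwards [hDo.mem_nhds hx] with y hy using hfg hy
    have h4 := (h2.congr_of_eventuallyEq h3).unique h1
    rw [h4, ← hfg hx]; rfl
  refine ⟨fun x => (f x).im, Complex.imCLM.contDiff.comp_contDiffOn hfs, fun x hx => ?_⟩
  have hd : DifferentiableAt ℝ f x :=
    (hfs.contDiffAt (hDo.mem_nhds hx)).differentiableAt (by simp)
  have him : ∀ i, classicalPartial i (fun y => (f y).im) x = (classicalPartial i f x).im := by
    intro i
    have : HasFDerivAt (fun y => (f y).im) (Complex.imCLM.comp (fderiv ℝ f x)) x :=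
      Complex.imCLM.hasFDerivAt.comp x hd.hasFDerivAt
    simp [classicalPartial, this.fderiv]
  have hgx : g x ≠ 0 := fun h => hg0 ⟨x, hx, h⟩
  have hnorm : Complex.normSq (g x) = ‖x - a‖ ^ 2 := by
    rw [Complex.normSq_apply, plane_norm_sq]
    simp only [hgdef, hTre, hTim]; ring
  have hval : ∀ i, classicalPartial i f x = T (EuclideanSpace.single i 1) / g x := fun i => by
    rw [hpart x hx i]; field_simp
  constructor
  · rw [him, hval, Complex.div_im, hnorm, hTre, hTim]
    simp [hgdef, hTim, hTre]
  · rw [him, hval, Complex.div_im, hnorm, hTre, hTim]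
    simp [hgdef, hTim, hTre]

lemma fderiv_eq_zero_of_classicalPartial {F : Type*} [NormedAddCommGroup F] [NormedSpace ℝ F]
    {f : Plane → F} {x : Plane} (h : ∀ i, classicalPartial i f x = 0) : fderiv ℝ f x = 0 := by
  ext v; simp [fderiv_apply_eq_sum_partial, h]

lemma eventuallyEq_const_of_notMem_tsupport {f : Plane → ℝ} (hf : Differentiable ℝ f) {x : Plane}
    (h : ∀ i, x ∉ tsupport (classicalPartial i f)) : ∃ δ > 0, ∀ y ∈ Metric.closedBall x δ,
      f y = f x ∧ ∀ i, classicalPartial i f y = 0 := by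
  have h1 : ∀ᶠ y in 𝓝 x, ∀ i, classicalPartial i f y = 0 :=
    eventually_all.2 fun i => notMem_tsupport_iff_eventuallyEq.1 (h i)
  obtain ⟨δ, hδ, hball⟩ := Metric.eventually_nhds_iff_ball.1 h1
  refine ⟨δ / 2, half_pos hδ, fun y hy => ?_⟩
  have hy' : y ∈ Metric.ball x δ := Metric.closedBall_subset_ball (half_lt_self hδ) hy
  refine ⟨Metric.isOpen_ball.is_const_of_fderiv_eq_zero (𝕜 := ℝ)
    (convex_ball x δ).isPreconnected hf.differentiableOn
    (fun z hz => fderiv_eq_zero_of_classicalPartial (hball z hz)) hy' (Metric.mem_ball_self hδ),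
    hball y hy'⟩

/-- Integrating by parts moves the derivatives of `θ` onto `∂φ`, where the mixed second derivatives
cancel. Only the gradient of `φ` needs support in `U`: in the applications `φ` can be a nonzero
constant in the hole. -/
lemma integral_jacobian_eq_zero {U : Set Plane} (hU : IsOpen U) {φ θ : Plane → ℝ}
    (hφ : ContDiff ℝ (⊤ : ℕ∞) φ) (hc : HasCompactSupport φ)
    (hs : ∀ i, tsupport (classicalPartial i φ) ⊆ U) (hθ : ContDiffOn ℝ (⊤ : ℕ∞) θ U) :
    ∫ x in U, (classicalPartial 0 φ x * classicalPartial 1 θ x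
      - classicalPartial 1 φ x * classicalPartial 0 θ x) = 0 := by
  have hpφ : ∀ i, ContDiff ℝ (⊤ : ℕ∞) (classicalPartial i φ) := fun i =>
    hφ.classicalPartial (by simp) i
  have h5 : ∀ i j, ∫ x in U, classicalPartial i φ x * classicalPartial j θ x
      = - ∫ x in U, classicalPartial j (classicalPartial i φ) x * θ x := by
    intro i j
    have := setIntegral_classicalPartial_smul hU ((hpφ i).of_le (by exact_mod_cast le_top))
      (hc.classicalPartial i) (hs i) (hθ.of_le (by exact_mod_cast le_top)) j
    simp only [smul_eq_mul] at this
    rw [this, neg_neg]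
  have i5 : ∀ i j, IntegrableOn (fun x => classicalPartial i φ x * classicalPartial j θ x) U := by
    intro i j
    have ht : IsTestFunction U fun x => classicalPartial i φ x * classicalPartial j θ x :=
      IsTestFunction.mul_left hU ⟨hpφ i, hc.classicalPartial i, hs i⟩
        (hθ.classicalPartial hU (by simp) j)
    exact (ht.1.continuous.integrable_of_hasCompactSupport ht.2.1).integrableOn
  rw [integral_sub (i5 0 1) (i5 1 0), h5, h5]
  have : ∀ x, classicalPartial 1 (classicalPartial 0 φ) x
      = classicalPartial 0 (classicalPartial 1 φ) x := fun x =>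
    classicalPartial_comm (contDiff_infty.1 hφ 2).contDiffAt 1 0
  simp [this]

lemma radialField_sub_contDiff {δ : ℝ} (hδ : 0 < δ) (i : Fin 2) (a : Plane) :
    ContDiff ℝ (⊤ : ℕ∞) fun x : Plane => radialField δ i (x - a) :=
  (radialField_contDiff hδ i).comp (contDiff_id.sub contDiff_const)

lemma classicalPartial_radialField_sub (δ : ℝ) (i : Fin 2) (a x : Plane) :
    classicalPartial i (fun x : Plane => radialField δ i (x - a)) x
      = classicalPartial i (radialField δ i) (x - a) := by
  simp only [classicalPartial]
  rw [fderiv_comp_sub (f := radialField δ i)]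

/-- The radial field has divergence `rho δ (· - a)`, of unit mass and supported where `φ` equals `φ
a`. The pairing thus reads off a value of `φ` from its gradient alone. -/
lemma integral_partial_mul_radialField {U : Set Plane} {φ : Plane → ℝ}
    (hφ : ContDiff ℝ (⊤ : ℕ∞) φ) (hc : HasCompactSupport φ)
    (hs : ∀ i, tsupport (classicalPartial i φ) ⊆ U) {a : Plane} {δ : ℝ} (hδ : 0 < δ)
    (hloc : ∀ y ∈ Metric.closedBall a δ, φ y = φ a) :
    ∫ x in U, ∑ i, classicalPartial i φ x * radialField δ i (x - a) = - φ a := by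
  have hr := fun i => radialField_sub_contDiff hδ i a
  have hpφ : ∀ i, ContDiff ℝ (⊤ : ℕ∞) (classicalPartial i φ) := fun i =>
    hφ.classicalPartial (by simp) i
  have h1 : ∫ x, φ x * rho δ (x - a) = φ a := by
    have : ∀ x, φ x * rho δ (x - a) = φ a * rho δ (a - x) := by
      intro x
      rw [rho_sub_comm δ a x]
      by_cases hx : δ ≤ ‖x - a‖
      · rw [rho_eq_zero hδ hx]; ring
      · rw [hloc x (by rw [mem_closedBall_iff_norm]; exact (not_le.1 hx).le)]
    simp_rw [this]
    rw [integral_const_mul, integral_rho_sub hδ, mul_one]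
  have h2 : ∀ i, ∫ x in U, classicalPartial i φ x * radialField δ i (x - a)
      = - ∫ x, φ x * classicalPartial i (radialField δ i) (x - a) := by
    intro i
    have := setIntegral_classicalPartial_smul isOpen_univ (hφ.of_le (by exact_mod_cast le_top)) hc
      (subset_univ _) ((hr i).of_le (by exact_mod_cast le_top)).contDiffOn i
    simp only [Measure.restrict_univ, smul_eq_mul, classicalPartial_radialField_sub] at this
    rw [setIntegral_eq_of_tsupport_subset
      ((tsupport_mul_subset_left (f := classicalPartial i φ)).trans (hs i)), this]
  have hiint : ∀ i, Integrable fun x => φ x * classicalPartial i (radialField δ i) (x - a) := by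
    intro i
    refine Continuous.integrable_of_hasCompactSupport ?_ hc.mul_right
    refine hφ.continuous.mul ?_
    exact (((radialField_contDiff hδ i).classicalPartial (m := 0) (by simp) i).continuous).comp
      (continuous_id.sub continuous_const)
  have iD : ∀ i, IntegrableOn (fun x => classicalPartial i φ x * radialField δ i (x - a)) U :=
    fun i => (((hpφ i).continuous.mul (hr i).continuous).integrable_of_hasCompactSupport
      (hc.classicalPartial i).mul_right).integrableOn
  rw [← h1]
  simp_rw [← divergence_radialField hδ, Finset.mul_sum]
  rw [integral_finsetSum _ fun i _ => hiint i, integral_finsetSum _ fun i _ => iD i,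
    ← Finset.sum_neg_distrib]
  exact Finset.sum_congr rfl fun i _ => h2 i

/-- A compactly supported function which is locally constant outside a simply connected domain
vanishes there. -/
lemma IsSimplyConnected.eq_zero_of_notMem {D : Set Plane} (hD : IsSimplyConnected D)
    (hDo : IsOpen D) {φ : Plane → ℝ} (hφ : ContDiff ℝ (⊤ : ℕ∞) φ) (hc : HasCompactSupport φ)
    (hs : ∀ i, tsupport (classicalPartial i φ) ⊆ D) {a : Plane} (ha : a ∉ D) : φ a = 0 := by
  obtain ⟨δ, hδ, hloc⟩ := eventuallyEq_const_of_notMem_tsupport (hφ.differentiable (by simp))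
    (x := a) fun i h => ha (hs i h)
  obtain ⟨θ, hθ, hθp⟩ := hD.exists_angle hDo ha
  have h3 := integral_partial_mul_radialField hφ hc hs hδ fun y hy => (hloc y hy).1
  -- Off the `δ`-ball the radial field is a multiple of `(x - a) / |x - a|²`, which is the gradient
  -- of the angle rotated. So the pairing that computes `φ a` is also a Jacobian integral, which
  -- vanishes.
  have h4 : ∀ x ∈ D, ∑ i, classicalPartial i φ x * radialField δ i (x - a)
      = (2 * kernelMass)⁻¹ * (classicalPartial 0 φ x * classicalPartial 1 θ x
        - classicalPartial 1 φ x * classicalPartial 0 θ x) := by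
    intro x hx
    rw [Fin.sum_univ_two]
    by_cases hxa : δ ≤ ‖x - a‖
    · rw [radialField_of_le hδ _ hxa, radialField_of_le hδ _ hxa, (hθp x hx).1, (hθp x hx).2]
      ring
    · have := (hloc x (by rw [mem_closedBall_iff_norm]; exact (not_le.1 hxa).le)).2
      simp [this]
  rw [setIntegral_congr_fun hDo.measurableSet h4, integral_const_mul,
    integral_jacobian_eq_zero hDo hφ hc hs hθ, mul_zero] at h3
  linarith

lemma isPreconnected_norm_gt {R : ℝ} (hR : 0 < R) : IsPreconnected {x : Plane | R < ‖x‖} := by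
  have hrank : 1 < Module.rank ℝ Plane := by
    rw [← Module.finrank_eq_rank, finrank_euclideanSpace_fin]; norm_num
  have h1 : IsPreconnected (Ioi R ×ˢ Metric.sphere (0 : Plane) 1) :=
    isPreconnected_Ioi.prod (isPreconnected_sphere hrank _ _)
  have h2 := h1.image (fun p : ℝ × Plane => p.1 • p.2)
    (continuous_fst.smul continuous_snd).continuousOn
  convert h2 using 1
  ext x
  constructor
  · intro hx
    have hx' : R < ‖x‖ := hx
    have h0 : ‖x‖ ≠ 0 := (hR.trans hx').ne'
    refine ⟨(‖x‖, ‖x‖⁻¹ • x), ⟨hx', ?_⟩, ?_⟩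
    · simp [norm_smul, h0]
    · simp [smul_smul, h0]
  · rintro ⟨⟨r, y⟩, ⟨hr, hy⟩, rfl⟩
    have hr' : R < r := hr
    have hy' : ‖y‖ = 1 := by simpa using hy
    simp only [mem_ofPred_eq, norm_smul, hy', mul_one, Real.norm_eq_abs]
    exact hr'.trans_le (le_abs_self r)

/-- A compactly supported divergence-free field on an annulus has a stream function, constant
near the hole. -/
lemma IsAnnularPair.exists_streamFunction {D B : Set Plane} (hDB : IsAnnularPair D B)
    {Y : Fin 2 → Plane → ℝ} (hY : ∀ i, IsTestFunction (annulus D B) (Y i))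
    (hdiv : ∀ x, ∑ i, classicalPartial i (Y i) x = 0) :
    ∃ φ : Plane → ℝ, ∃ c : ℝ, IsTestFunction D φ ∧ (∀ᶠ x in 𝓝ˢ (closure B), φ x = c) ∧
      ∀ x, Y 0 x = - classicalPartial 1 φ x ∧ Y 1 x = classicalPartial 0 φ x := by
  have hd : ∀ i, Differentiable ℝ (Y i) := fun i => (hY i).1.differentiable (by simp)
  -- The form `Y₁ dx₀ - Y₀ dx₁` is closed because `Y` is divergence-free; the Poincaré lemma in the
  -- plane gives a primitive.
  set ω : Plane → Plane →L[ℝ] ℝ := fun x => Y 1 x • EuclideanSpace.proj (0 : Fin 2)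
    - Y 0 x • EuclideanSpace.proj (1 : Fin 2) with hω
  have hωc : ContDiff ℝ (⊤ : ℕ∞) ω :=
    ((hY 1).1.smul contDiff_const).sub ((hY 0).1.smul contDiff_const)
  have hωd : ∀ a x y, fderiv ℝ ω a x y = fderiv ℝ (Y 1) a x * y 0 - fderiv ℝ (Y 0) a x * y 1 := by
    intro a x y
    have h : HasFDerivAt ω ((fderiv ℝ (Y 1) a).smulRight (EuclideanSpace.proj (0 : Fin 2))
        - (fderiv ℝ (Y 0) a).smulRight (EuclideanSpace.proj (1 : Fin 2))) a :=
      ((hd 1 a).hasFDerivAt.smul_const (EuclideanSpace.proj (0 : Fin 2) : Plane →L[ℝ] ℝ)).sub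
        ((hd 0 a).hasFDerivAt.smul_const (EuclideanSpace.proj (1 : Fin 2) : Plane →L[ℝ] ℝ))
    rw [h.fderiv]; simp
  obtain ⟨φ₀, hφ₀⟩ := convex_univ.exists_forall_hasFDerivAt_of_fderiv_symmetric isOpen_univ
    (hωc.differentiable (by simp)).differentiableOn (fun a _ x y => by
      have := hdiv a
      rw [Fin.sum_univ_two] at this
      rw [hωd, hωd]
      simp only [fderiv_apply_eq_sum_partial, Fin.sum_univ_two, smul_eq_mul]
      linear_combination (x 1 * y 0 - x 0 * y 1) * this)
  have hφ₀' : ∀ x, HasFDerivAt φ₀ (ω x) x := fun x => hφ₀ x (mem_univ x)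
  have hφ₀d : Differentiable ℝ φ₀ := fun x => (hφ₀' x).differentiableAt
  have hfd : fderiv ℝ φ₀ = ω := funext fun x => (hφ₀' x).fderiv
  have hφ₀c : ContDiff ℝ (⊤ : ℕ∞) φ₀ := contDiff_infty_iff_fderiv.2 ⟨hφ₀d, hfd ▸ hωc⟩
  obtain ⟨R, hR, hRY⟩ : ∃ R > 0, ∀ i, tsupport (Y i) ⊆ Metric.closedBall 0 R := by
    have hb : Bornology.IsBounded (⋃ i, tsupport (Y i)) :=
      (isCompact_iUnion fun i => (hY i).2.1).isBounded
    obtain ⟨R, hR, h⟩ := hb.subset_closedBall_lt 0 0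
    exact ⟨R, hR, fun i => (subset_iUnion _ i).trans h⟩
  have hω0 : ∀ x, (∀ i, x ∉ tsupport (Y i)) → ω x = 0 := by
    intro x hx
    simp [hω, image_eq_zero_of_notMem_tsupport (hx 0), image_eq_zero_of_notMem_tsupport (hx 1)]
  have hopen : IsOpen {x : Plane | R < ‖x‖} := isOpen_lt continuous_const continuous_norm
  -- The primitive is constant on the connected exterior of a large ball, and subtracting that
  -- constant makes its support compact.
  obtain ⟨c₀, hc₀⟩ := hopen.exists_is_const_of_fderiv_eq_zero (𝕜 := ℝ) (isPreconnected_norm_gt hR)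
    hφ₀d.differentiableOn (fun x hx => by
      rw [hfd]
      refine hω0 x fun i h => ?_
      have h' := hRY i h
      rw [mem_closedBall_zero_iff] at h'
      exact absurd hx (not_lt.2 h'))
  set φ : Plane → ℝ := fun x => φ₀ x - c₀ with hφdef
  have hφ : ContDiff ℝ (⊤ : ℕ∞) φ := hφ₀c.sub contDiff_const
  have hφd : ∀ x, fderiv ℝ φ x = ω x := fun x => by
    simp only [hφdef]; rw [fderiv_sub_const, hfd]
  have hφc : HasCompactSupport φ := HasCompactSupport.intro (isCompact_closedBall 0 R)
    fun x hx => by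
      rw [mem_closedBall_zero_iff, not_le] at hx
      simp only [hφdef, hc₀ x hx, sub_self]
  have hp0 : ∀ x, classicalPartial 0 φ x = Y 1 x := fun x => by
    simp [classicalPartial, hφd, hω]
  have hp1 : ∀ x, classicalPartial 1 φ x = - Y 0 x := fun x => by
    simp [classicalPartial, hφd, hω]
  have hts : ∀ i, tsupport (classicalPartial i φ) ⊆ annulus D B := by
    rw [Fin.forall_fin_two]; constructor
    · rw [show classicalPartial _ φ = Y 1 from funext hp0]; exact (hY 1).2.2
    · rw [show classicalPartial _ φ = fun x => - Y 0 x from funext hp1]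
      exact (closure_mono (by simp)).trans (hY 0).2.2
  -- Compact support alone does not give this, as it says nothing about bounded components of the
  -- complement of `D`. Simple connectedness enters through the angle function.
  have hDs : tsupport φ ⊆ D := by
    intro a h
    by_contra ha
    obtain ⟨δ, hδ, hloc⟩ := eventuallyEq_const_of_notMem_tsupport (hφ.differentiable (by simp))
      (x := a) fun i h => ha (hts i h).1
    have h0 := hDB.simplyConnected_outer.eq_zero_of_notMem hDB.isOpen_outer hφ hφc
      (fun i => (hts i).trans sdiff_subset) ha
    refine (notMem_tsupport_iff_eventuallyEq.2 ?_) h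
    filter_upwards [Metric.closedBall_mem_nhds a hδ] with y hy
    rw [(hloc y hy).1, h0]; rfl
  have hBconn : IsPreconnected B := hDB.simplyConnected_hole.isPathConnected.isConnected.isPreconnected
  obtain ⟨c, hc⟩ := hDB.isOpen_hole.exists_is_const_of_fderiv_eq_zero (𝕜 := ℝ) hBconn
    (hφ.differentiable (by simp)).differentiableOn (fun x hx => by
      rw [hφd]
      exact hω0 x fun i h => ((hY i).2.2 h).2 (subset_closure hx))
  refine ⟨φ, c, ⟨hφ, hφc, hDs⟩, ?_, fun x => ⟨by rw [hp1, neg_neg], (hp0 x).symm⟩⟩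
  rw [eventually_nhdsSet_iff_forall]
  intro x hx
  obtain ⟨δ, hδ, hloc⟩ := eventuallyEq_const_of_notMem_tsupport (hφ.differentiable (by simp))
    (x := x) fun i h => (hts i h).2 hx
  obtain ⟨b, hb, hbx⟩ := Metric.mem_closure_iff.1 hx δ hδ
  have hbc : φ x = c := by
    rw [← hc b hb, (hloc b (by rw [Metric.mem_closedBall, dist_comm]; exact hbx.le)).1]
  filter_upwards [Metric.closedBall_mem_nhds x hδ] with y hy
  rw [(hloc y hy).1, hbc]

end

noncomputable section

/-! ### Fields without circulation are gradients -/

lemma isTestFunction_zero (U : Set Plane) : IsTestFunction U fun _ => 0 :=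
  ⟨contDiff_const, HasCompactSupport.zero, by
    rw [show tsupport (fun _ : Plane => (0 : ℝ)) = ∅ from tsupport_eq_empty_iff.2 rfl]
    exact empty_subset _⟩

lemma IsTestFunction.const_mul {U : Set Plane} {φ : Plane → ℝ} (h : IsTestFunction U φ) (c : ℝ) :
    IsTestFunction U fun x => c * φ x :=
  ⟨contDiff_const.mul h.1, h.2.1.mul_left, (tsupport_mul_subset_right).trans h.2.2⟩

/-- The space of smooth compactly supported vector fields. -/
def testFields (A : Set Plane) : Submodule ℝ (Fin 2 → Plane → ℝ) where
  carrier := {Y | ∀ i, IsTestFunction A (Y i)}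
  add_mem' h h' i := (h i).add (h' i)
  zero_mem' _ := isTestFunction_zero A
  smul_mem' c _ h i := (h i).const_mul c

lemma testFields_differentiable {A : Set Plane} (Y : testFields A) (i : Fin 2) :
    Differentiable ℝ (Y.1 i) := (Y.2 i).1.differentiable (by simp)

/-- The divergence of a test field. -/
def divergence (A : Set Plane) : testFields A →ₗ[ℝ] (Plane → ℝ) where
  toFun Y x := ∑ i, classicalPartial i (Y.1 i) x
  map_add' Y Z := by
    funext x
    simp only [Pi.add_apply, ← Finset.sum_add_distrib]
    exact Finset.sum_congr rfl fun i _ =>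
      classicalPartial_add (testFields_differentiable Y i x) (testFields_differentiable Z i x) i
  map_smul' c Y := by
    funext x
    simp only [Pi.smul_apply, RingHom.id_apply, smul_eq_mul, Finset.mul_sum]
    refine Finset.sum_congr rfl fun i _ => ?_
    change classicalPartial i (fun y => c • Y.1 i y) x = _
    simp only [classicalPartial]
    rw [fderiv_fun_const_smul (testFields_differentiable Y i x)]
    rfl

/-- The pairing of test fields with a locally integrable field. -/
def fieldPairing {A : Set Plane} {X : Fin 2 → Plane → ℝ}
    (hX : ∀ i, LocallyIntegrableOn (X i) A) : testFields A →ₗ[ℝ] ℝ where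
  toFun Y := ∫ x in A, ∑ i, Y.1 i x * X i x
  map_add' Y Z := by
    have h : ∀ (Y : testFields A) i, IntegrableOn (fun x => Y.1 i x * X i x) A := fun Y i =>
      (Y.2 i).integrableOn_smul (hX i)
    rw [← integral_add (integrable_finsetSum _ fun i _ => h Y i)
      (integrable_finsetSum _ fun i _ => h Z i)]
    refine integral_congr_ae (Eventually.of_forall fun x => ?_)
    simp only [← Finset.sum_add_distrib, ← add_mul]
    rfl
  map_smul' c Y := by
    rw [RingHom.id_apply, smul_eq_mul, ← integral_const_mul]
    refine integral_congr_ae (Eventually.of_forall fun x => ?_)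
    simp only [Finset.mul_sum, ← mul_assoc]
    rfl

/-- Linear algebra: a functional vanishing on the kernel of the divergence factors through it and
extends to all functions. No continuity is involved. -/
lemma exists_divergence_functional {A : Set Plane} {X : Fin 2 → Plane → ℝ}
    (hX : ∀ i, LocallyIntegrableOn (X i) A)
    (h : ∀ Y : Fin 2 → Plane → ℝ, (∀ i, IsTestFunction A (Y i)) →
      (∀ x, ∑ i, classicalPartial i (Y i) x = 0) → ∫ x in A, ∑ i, Y i x * X i x = 0) :
    ∃ L : (Plane → ℝ) →ₗ[ℝ] ℝ, ∀ Y : Fin 2 → Plane → ℝ, (∀ i, IsTestFunction A (Y i)) →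
      L (fun x => ∑ i, classicalPartial i (Y i) x) = ∫ x in A, ∑ i, Y i x * X i x := by
  have hmem : fieldPairing hX ∈ LinearMap.range (divergence A).dualMap := by
    rw [LinearMap.range_dualMap_eq_dualAnnihilator_ker, Submodule.mem_dualAnnihilator]
    intro Y hY
    exact h Y.1 Y.2 fun x => congrFun (LinearMap.mem_ker.1 hY) x
  obtain ⟨L, hL⟩ := hmem
  exact ⟨L, fun Y hY => LinearMap.congr_fun hL (⟨Y, hY⟩ : testFields A)⟩

/-- The kernel `rho δ` averaged over the segment from `b` to `b + h`. -/
def segmentKernel (δ : ℝ) (b h y : Plane) : ℝ := ∫ t in (0 : ℝ)..1, rho δ (y - (b + t • h))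

lemma continuous_segment (b h : Plane) : Continuous fun t : ℝ => b + t • h :=
  continuous_const.add (continuous_id.smul continuous_const)

/-- This is the convolution of `rho δ` with the image of Lebesgue measure on the unit interval under
the parametrization of the segment. -/
lemma segmentKernel_contDiff {δ : ℝ} (hδ : 0 < δ) (b h : Plane) :
    ContDiff ℝ (⊤ : ℕ∞) (segmentKernel δ b h) := by
  set μ : Measure Plane := (volume.restrict (Ioc (0 : ℝ) 1)).map fun t => b + t • h with hμ
  have : IsFiniteMeasure μ := by rw [hμ]; infer_instance
  have e : segmentKernel δ b h
      = convolution (fun _ => (1 : ℝ)) (rho δ) (ContinuousLinearMap.lsmul ℝ ℝ) μ := by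
    funext y
    simp only [convolution, segmentKernel, ContinuousLinearMap.lsmul_apply, one_smul]
    rw [intervalIntegral.integral_of_le zero_le_one, hμ,
      integral_map (continuous_segment b h).aemeasurable]
    exact ((rho_contDiff δ).continuous.comp
      (continuous_const.sub continuous_id)).aestronglyMeasurable
  rw [e]
  exact (rho_hasCompactSupport hδ).contDiff_convolution_right _
    (integrable_const (1 : ℝ)).locallyIntegrable (rho_contDiff δ)

/-- The fundamental theorem of calculus along the segment. Consequently the field `segmentKernel δ b
h • h` has as divergence the difference of the kernels at the two endpoints. -/
lemma fderiv_segmentKernel {δ : ℝ} (hδ : 0 < δ) (b h y : Plane) :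
    fderiv ℝ (segmentKernel δ b h) y h = rho δ (y - b) - rho δ (y - (b + h)) := by
  set κ : ℝ → ℝ := fun t => rho δ (y - (b + t • h)) with hκ
  have hκc : Continuous κ :=
    (rho_contDiff δ).continuous.comp (continuous_const.sub (continuous_segment b h))
  have e : ∀ s : ℝ, segmentKernel δ b h (y + s • h)
      = (∫ t in (0 : ℝ)..(1 - s), κ t) - ∫ t in (0 : ℝ)..(0 - s), κ t := by
    intro s
    rw [intervalIntegral.integral_interval_sub_left (hκc.intervalIntegrable _ _)
      (hκc.intervalIntegrable _ _), ← intervalIntegral.integral_comp_sub_right κ s]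
    refine intervalIntegral.integral_congr fun t _ => ?_
    simp only [hκ]
    congr 1
    rw [sub_smul]; abel
  have hP : ∀ r, HasDerivAt (fun r => ∫ t in (0 : ℝ)..r, κ t) (κ r) r := fun r =>
    intervalIntegral.integral_hasDerivAt_right (hκc.intervalIntegrable _ _)
      hκc.stronglyMeasurable.stronglyMeasurableAtFilter hκc.continuousAt
  have hs : ∀ c : ℝ, HasDerivAt (fun s : ℝ => c - s) (-1) 0 := fun c =>
    (hasDerivAt_id (0 : ℝ)).const_sub c
  have h1 : HasDerivAt (fun s : ℝ => segmentKernel δ b h (y + s • h))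
      (κ (1 - 0) * -1 - κ (0 - 0) * -1) 0 := by
    rw [funext e]
    exact ((hP (1 - 0)).comp (0 : ℝ) (hs 1)).sub ((hP (0 - 0)).comp (0 : ℝ) (hs 0))
  have hd : HasFDerivAt (segmentKernel δ b h) (fderiv ℝ (segmentKernel δ b h) y) (y + (0 : ℝ) • h) := by
    rw [zero_smul, add_zero]
    exact ((segmentKernel_contDiff hδ b h).differentiable (by simp) y).hasFDerivAt
  have hl : HasDerivAt (fun s : ℝ => y + s • h) h 0 := by
    simpa using ((hasDerivAt_id (0 : ℝ)).smul_const h).const_add y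
  have h2 := hd.comp_hasDerivAt (0 : ℝ) hl
  have := h2.unique h1
  rw [this]
  simp only [hκ, sub_zero, one_smul, zero_smul, add_zero]
  ring

lemma segmentKernel_isTestFunction {A : Set Plane} {δ : ℝ} (hδ : 0 < δ) {b h : Plane}
    (hA : Metric.closedBall b (δ + ‖h‖) ⊆ A) : IsTestFunction A (segmentKernel δ b h) := by
  have hsub : tsupport (segmentKernel δ b h) ⊆ Metric.closedBall b (δ + ‖h‖) := by
    refine closure_minimal (fun y hy => ?_) Metric.isClosed_closedBall
    by_contra hn
    rw [mem_closedBall_iff_norm, not_le] at hn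
    apply hy
    rw [segmentKernel]
    refine (intervalIntegral.integral_congr fun t ht => ?_).trans intervalIntegral.integral_zero
    rw [uIcc_of_le zero_le_one] at ht
    refine rho_eq_zero hδ ?_
    have h1 : ‖y - b‖ ≤ ‖y - (b + t • h)‖ + ‖t • h‖ := by
      refine le_trans (le_of_eq ?_) (norm_add_le _ _)
      congr 1; abel
    have h2 : ‖t • h‖ ≤ ‖h‖ := by
      rw [norm_smul, Real.norm_eq_abs, abs_of_nonneg ht.1]
      exact mul_le_of_le_one_left (norm_nonneg _) ht.2
    linarith
  exact ⟨segmentKernel_contDiff hδ b h,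
    (isCompact_closedBall b _).of_isClosed_subset (isClosed_tsupport _) hsub, hsub.trans hA⟩

lemma integral_segmentKernel_mul {δ : ℝ} (hδ : 0 < δ) (b h : Plane) {f : Plane → ℝ}
    (hf : Integrable f) :
    ∫ y, segmentKernel δ b h y * f y = ∫ t in (0 : ℝ)..1, mol δ f (b + t • h) := by
  obtain ⟨C, hC, hρ⟩ := exists_rho_le
  have hint : Integrable (Function.uncurry fun (y : Plane) (t : ℝ) => rho δ (y - (b + t • h)) * f y)
      (volume.prod (volume.restrict (Ioc (0 : ℝ) 1))) := by
    have h1 : Integrable (fun z : Plane × ℝ => f z.1)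
        (volume.prod (volume.restrict (Ioc (0 : ℝ) 1))) := hf.comp_fst _
    refine h1.bdd_mul (c := C * (δ ^ 2)⁻¹) ?_ ?_
    · refine Continuous.aestronglyMeasurable ?_
      exact (rho_contDiff δ).continuous.comp
        (continuous_fst.sub ((continuous_segment b h).comp continuous_snd))
    · refine Eventually.of_forall fun z => ?_
      rw [Real.norm_eq_abs, abs_of_nonneg (rho_nonneg _ _)]
      exact hρ δ hδ _
  rw [intervalIntegral.integral_of_le zero_le_one]
  simp only [mol, smul_eq_mul]
  have := integral_integral_swap hint
  rw [← show (∫ t in Ioc (0 : ℝ) 1, ∫ y, rho δ (y - (b + t • h)) * f y)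
    = ∫ t in Ioc (0 : ℝ) 1, ∫ y, rho δ (b + t • h - y) * f y by simp_rw [rho_sub_comm δ (b + _)],
    ← this]
  refine integral_congr_ae (Eventually.of_forall fun y => ?_)
  simp only [segmentKernel]
  rw [intervalIntegral.integral_of_le zero_le_one, integral_mul_const]

lemma closedBall_subset_of_lt_infDist {A : Set Plane} {x : Plane} {r : ℝ}
    (h : r < Metric.infDist x Aᶜ) : Metric.closedBall x r ⊆ A := fun y hy => by
  by_contra hn
  have := Metric.infDist_le_dist_of_mem (x := x) (s := Aᶜ) hn
  rw [dist_comm] at this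
  linarith [Metric.mem_closedBall.1 hy]

lemma hasFDerivAt_of_integral_segment {ψ : Plane → ℝ} {m : Fin 2 → Plane → ℝ}
    (hm : ∀ i, Continuous (m i)) {b : Plane} {r : ℝ} (hr : 0 < r)
    (h : ∀ v : Plane, ‖v‖ < r → ψ (b + v) - ψ b = ∑ i, v i * ∫ t in (0 : ℝ)..1, m i (b + t • v)) :
    HasFDerivAt ψ (∑ i, m i b • (EuclideanSpace.proj i : Plane →L[ℝ] ℝ)) b := by
  rw [hasFDerivAt_iff_isLittleO_nhds_zero, Asymptotics.isLittleO_iff]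
  intro c hc
  have hcont : ∀ᶠ z in 𝓝 b, ∀ i, |m i z - m i b| < c / 2 := by
    refine eventually_all.2 fun i => ?_
    have := Metric.tendsto_nhds.1 ((hm i).tendsto b) (c / 2) (half_pos hc)
    simpa only [Real.dist_eq] using this
  obtain ⟨s, hs, hball⟩ := Metric.eventually_nhds_iff_ball.1 hcont
  filter_upwards [Metric.ball_mem_nhds (0 : Plane) (lt_min hr hs)] with v hv
  rw [mem_ball_zero_iff, lt_min_iff] at hv
  rw [h v hv.1]
  have e : (∑ i, v i * ∫ t in (0 : ℝ)..1, m i (b + t • v))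
      - (∑ i, m i b • (EuclideanSpace.proj i : Plane →L[ℝ] ℝ)) v
      = ∑ i, v i * ∫ t in (0 : ℝ)..1, (m i (b + t • v) - m i b) := by
    rw [sum_apply, ← Finset.sum_sub_distrib]
    refine Finset.sum_congr rfl fun i _ => ?_
    have hci : Continuous fun t : ℝ => m i (b + t • v) := (hm i).comp (continuous_segment b v)
    rw [intervalIntegral.integral_sub (hci.intervalIntegrable _ _)
      (continuous_const.intervalIntegrable _ _)]
    simp
    ring
  rw [e]
  have hb : ∀ i, |v i * ∫ t in (0 : ℝ)..1, (m i (b + t • v) - m i b)| ≤ ‖v‖ * (c / 2) := by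
    intro i
    rw [abs_mul]
    refine mul_le_mul (abs_coord_le v i) ?_ (abs_nonneg _) (norm_nonneg _)
    have := intervalIntegral.norm_integral_le_of_norm_le_const (a := (0 : ℝ)) (b := 1)
      (C := c / 2) (f := fun t : ℝ => m i (b + t • v) - m i b) (fun t ht => by
        rw [uIoc_of_le zero_le_one] at ht
        refine (hball _ ?_ i).le
        rw [mem_ball_iff_norm, add_sub_cancel_left, norm_smul, Real.norm_eq_abs,
          abs_of_pos ht.1]
        exact (mul_le_of_le_one_left (norm_nonneg _) ht.2).trans_lt hv.2)
    simpa using this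
  refine (norm_sum_le _ _).trans ((Finset.sum_le_sum fun i _ => hb i).trans (le_of_eq ?_))
  simp; ring

/-- An integrable field which is orthogonal to the gradients of test functions and to the
divergence-free test fields is the gradient of a (harmonic) function. -/
lemma exists_primitive {A : Set Plane} (hA : IsOpen A) (hb : Bornology.IsBounded A)
    {X : Fin 2 → Plane → ℝ} (hX : ∀ i, IntegrableOn (X i) A)
    (hdiv : ∀ Y : Fin 2 → Plane → ℝ, (∀ i, IsTestFunction A (Y i)) →
      (∀ x, ∑ i, classicalPartial i (Y i) x = 0) → ∫ x in A, ∑ i, Y i x * X i x = 0)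
    (hgrad : ∀ Q : Plane → ℝ, IsTestFunction A Q →
      ∫ x in A, ∑ i, classicalPartial i Q x * X i x = 0) :
    ∃ ψ : Plane → ℝ, ContDiffOn ℝ (⊤ : ℕ∞) ψ A ∧
      ∀ i, X i =ᵐ[volume.restrict A] classicalPartial i ψ := by
  -- For `X = ∇ψ` one would have `∫ Y·X = -∫ ψ div Y`, so `L` stands for integration against `-ψ`.
  -- On a kernel centred at `b` it should give `-ψ b`, by the mean value property of harmonic
  -- functions.
  obtain ⟨L, hL⟩ := exists_divergence_functional (fun i => (hX i).locallyIntegrableOn) hdiv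
  set X' : Fin 2 → Plane → ℝ := fun i => A.indicator (X i) with hX'
  have hXi : ∀ i, Integrable (X' i) := fun i => (integrable_indicator_iff hA.measurableSet).2 (hX i)
  set K : ℝ → Plane → Plane → ℝ := fun δ b y => rho δ (y - b) with hK
  -- The mean value property: the difference of two kernels is the Laplacian of a radial potential,
  -- that is the divergence of a gradient, and `X` is orthogonal to gradients.
  have hindep : ∀ δ δ' b, 0 < δ → 0 < δ' → δ < Metric.infDist b Aᶜ → δ' < Metric.infDist b Aᶜ →
      L (K δ b) = L (K δ' b) := by
    intro δ δ' b hδ hδ' h h'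
    set Q : Plane → ℝ := fun y => radialPotential δ δ' (b - y) with hQ
    have hQt : IsTestFunction A Q := isTestFunction_comp_const_sub (radialPotential_contDiff hδ hδ')
      (tsupport_radialPotential_subset hδ hδ' (le_max_left _ _) (le_max_right _ _))
      (closedBall_subset_of_lt_infDist (max_lt h h'))
    have h1 := hL (fun i => classicalPartial i Q) fun i => hQt.classicalPartial i
    rw [hgrad Q hQt] at h1
    have e : (fun x => ∑ i, classicalPartial i (classicalPartial i Q) x) = K δ' b - K δ b := by
      funext y
      have hr := radialPotential_contDiff hδ hδ'
      have hp : ∀ i, classicalPartial i Q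
          = fun y => - classicalPartial i (radialPotential δ δ') (b - y) := fun i =>
        funext fun y => classicalPartial_comp_const_sub (hr.differentiable (by simp)) b y i
      have hpp : ∀ i, classicalPartial i (classicalPartial i Q) y
          = classicalPartial i (classicalPartial i (radialPotential δ δ')) (b - y) := by
        intro i
        have hd := ((contDiff_infty.1 hr 2).classicalPartial (m := 1) (by norm_num) i).differentiable
          (by simp)
        have := classicalPartial_comp_const_sub hd b y i
        rw [hp i]
        simp only [classicalPartial] at this ⊢
        rw [fderiv_fun_neg, neg_apply, this, neg_neg]
      simp only [hpp, laplacian_radialPotential hδ hδ', hK, Pi.sub_apply]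
      rw [rho_sub_comm δ' b, rho_sub_comm δ b]
    rw [e, map_sub, sub_eq_zero] at h1
    exact h1.symm
  set ψ : Plane → ℝ := fun b => - L (K (Metric.infDist b Aᶜ / 2) b) with hψ
  have hpos := fun b (hbA : b ∈ A) => infDist_compl_pos hA hb hbA
  have hψδ : ∀ δ b, 0 < δ → δ < Metric.infDist b Aᶜ → ψ b = - L (K δ b) := by
    intro δ b hδ h
    have h0 : 0 < Metric.infDist b Aᶜ := hδ.trans h
    simp only [hψ]
    rw [hindep _ δ b (half_pos h0) hδ (half_lt_self h0) h]
  -- The kernels at `b` and `b + v` differ by the divergence of a field along the segment, so the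
  -- increment of `ψ` is the integral of the mollified `X` over it. The condition `2 * δ` leaves
  -- room for both the radius `δ` and `‖v‖ < δ`.
  have hderiv : ∀ δ b, 0 < δ → 2 * δ < Metric.infDist b Aᶜ →
      HasFDerivAt ψ (∑ i, mol δ (X' i) b • (EuclideanSpace.proj i : Plane →L[ℝ] ℝ)) b := by
    intro δ b hδ h
    refine hasFDerivAt_of_integral_segment
      (fun i => (mol_contDiff hδ (hXi i).locallyIntegrable).continuous) hδ fun v hv => ?_
    have hbv : δ < Metric.infDist (b + v) Aᶜ := by
      have := infDist_le_add (A := A) (x := b) (y := b + v) (r := ‖v‖) (by simp)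
      linarith
    have hseg : IsTestFunction A (segmentKernel δ b v) := segmentKernel_isTestFunction hδ
      (closedBall_subset_of_lt_infDist (by linarith))
    have h1 := hL (fun i y => v i * segmentKernel δ b v y) fun i => hseg.const_mul (v i)
    have e : (fun x => ∑ i, classicalPartial i (fun y => v i * segmentKernel δ b v y) x)
        = K δ b - K δ (b + v) := by
      funext x
      have hd := (segmentKernel_contDiff hδ b v).differentiable (by simp) x
      have : ∀ i, classicalPartial i (fun y => v i * segmentKernel δ b v y) x
          = v i • classicalPartial i (segmentKernel δ b v) x := by
        intro i
        simp only [classicalPartial]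
        rw [fderiv_const_mul hd]; rfl
      simp only [this]
      rw [← fderiv_apply_eq_sum_partial, fderiv_segmentKernel hδ]
      rfl
    rw [e, map_sub] at h1
    rw [hψδ δ b hδ (by linarith), hψδ δ (b + v) hδ hbv,
      show -L (K δ (b + v)) - -L (K δ b) = L (K δ b) - L (K δ (b + v)) by ring, h1,
      integral_finsetSum (f := fun i x => v i * segmentKernel δ b v x * X i x) _ fun i _ =>
        (hseg.const_mul (v i)).integrableOn_smul (hX i).locallyIntegrableOn]
    refine Finset.sum_congr rfl fun i _ => ?_
    rw [← integral_segmentKernel_mul hδ b v (hXi i), ← integral_const_mul]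
    have := integral_smul_indicator hA.measurableSet (fun y => v i * segmentKernel δ b v y) (X i)
    simp only [smul_eq_mul] at this
    rw [← this]
    simp only [mul_assoc, hX']
  have hpart : ∀ δ b, 0 < δ → 2 * δ < Metric.infDist b Aᶜ → ∀ i,
      classicalPartial i ψ b = mol δ (X' i) b := by
    intro δ b hδ h i
    rw [classicalPartial, (hderiv δ b hδ h).fderiv]
    fin_cases i <;> simp
  refine ⟨ψ, ?_, fun i => ?_⟩
  · refine (contDiffOn_infty_iff_fderiv_of_isOpen hA).2 ⟨fun b hbA => ?_, fun b hbA => ?_⟩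
    · have := hpos b hbA
      exact (hderiv (Metric.infDist b Aᶜ / 4) b (by positivity)
        (by linarith)).differentiableAt.differentiableWithinAt
    · have h0 := hpos b hbA
      set δ := Metric.infDist b Aᶜ / 4 with hδdef
      have hδ : 0 < δ := by positivity
      have hev : ∀ᶠ y in 𝓝 b, 2 * δ < Metric.infDist y Aᶜ :=
        (Metric.continuous_infDist_pt Aᶜ).continuousAt.eventually (lt_mem_nhds (by
          change 2 * δ < Metric.infDist b Aᶜ; linarith))
      have hsm : ContDiff ℝ (⊤ : ℕ∞)
          fun y => ∑ i, mol δ (X' i) y • (EuclideanSpace.proj i : Plane →L[ℝ] ℝ) :=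
        ContDiff.sum fun i _ => (mol_contDiff hδ (hXi i).locallyIntegrable).smul contDiff_const
      refine (hsm.contDiffAt.congr_of_eventuallyEq ?_).contDiffWithinAt
      filter_upwards [hev] with y hy using (hderiv δ y hδ hy).fderiv
  · have h1 : ∀ᵐ x ∂(volume.restrict A), Tendsto (fun δ : ℝ => mol δ (X' i) (x + δ • (0 : Plane)))
        (𝓝[>] 0) (𝓝 (X' i x)) :=
      ae_restrict_of_ae (mol_tendsto_ae (hXi i).locallyIntegrable 0)
    filter_upwards [h1, ae_restrict_mem hA.measurableSet] with x hx hxA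
    simp only [smul_zero, add_zero] at hx
    have h2 : Tendsto (fun δ : ℝ => mol δ (X' i) x) (𝓝[>] 0) (𝓝 (classicalPartial i ψ x)) := by
      refine tendsto_const_nhds.congr' ?_
      have h0 := hpos x hxA
      filter_upwards [Ioo_mem_nhdsGT (half_pos h0)] with δ hδ
      exact hpart δ x hδ.1 (by linarith [hδ.2]) i
    have h3 := tendsto_nhds_unique hx h2
    rwa [show X' i x = X i x from indicator_of_mem hxA _] at h3

end

noncomputable section

/-! ### Circle-valued maps and their phases -/

lemma memLp_mul_of_bounded {A : Set Plane} {f g : Plane → ℂ}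
    (hf : AEStronglyMeasurable f (volume.restrict A)) {C : ℝ}
    (hb : ∀ᵐ x ∂(volume.restrict A), ‖f x‖ ≤ C) (hg : MemLp g 2 (volume.restrict A)) :
    MemLp (fun x => f x * g x) 2 (volume.restrict A) :=
  hg.mul (memLp_top_of_bound hf C hb)

lemma isWeakPartial_const {F : Type*} [NormedAddCommGroup F] [NormedSpace ℝ F] {A : Set Plane}
    (hA : IsOpen A) (c : F) (i : Fin 2) : IsWeakPartial A i (fun _ => c) (fun _ => 0) := by
  have h := ContDiffOn.isWeakPartial hA (a := fun _ => c) contDiffOn_const i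
  have e : classicalPartial i (fun _ : Plane => c) = fun _ => 0 := by
    funext x; simp [classicalPartial]
  rwa [e] at h

/-- Differentiating `|u|² = 1` gives `Re (ū ∂ᵢu) = 0`, so `ū ∂ᵢu` is `i` times the pre-Jacobian;
multiplying by `u` recovers the gradient. -/
lemma circleMaps.weakGrad_eq {A : Set Plane} (hA : IsOpen A) {u : Plane → ℂ}
    (hu : u ∈ circleMaps A) (i : Fin 2) : ∀ᵐ x ∂(volume.restrict A),
      weakGrad A u x i = Complex.I * preJacobian A u x i * u x ∧
        ‖weakGrad A u x i‖ = |preJacobian A u x i| := by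
  have mg := hu.1.memLp_weakGrad hA i
  have hw := hu.1.isWeakPartial i
  have h1 := hw.conj.mul hA hw (MemLp.conj hu.1.1) (MemLp.conj mg) hu.1.1 mg
  have hone : (fun x => conj (u x) * u x) =ᵐ[volume.restrict A] fun _ => (1 : ℂ) := by
    filter_upwards [hu.2] with x hx
    rw [mul_comm, Complex.mul_conj, Complex.normSq_eq_norm_sq, hx]; simp
  have h2 := (h1.congr_ae hA hone EventuallyEq.rfl).ae_eq hA (isWeakPartial_const hA 1 i)
  filter_upwards [h2, hone, hu.2] with x h0 h1 hx
  set g := weakGrad A u x i with hg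
  have hre : (conj (u x) * g).re = 0 := by
    have := congrArg Complex.re h0
    simp only [Complex.add_re, Complex.mul_re, Complex.conj_re, Complex.conj_im,
      Complex.zero_re] at this ⊢
    linarith
  have hj : conj (u x) * g = Complex.I * (preJacobian A u x i : ℂ) := by
    apply Complex.ext
    · rw [hre]; simp
    · simp [preJacobian, hg]
  constructor
  · rw [← hj, mul_comm (conj (u x)), mul_assoc, h1, mul_one]
  · have := congrArg norm hj
    rw [norm_mul, norm_mul, Complex.norm_I, one_mul, RCLike.norm_conj, hx, one_mul] at this
    simpa using this

lemma circleMaps.memLp_preJacobian {A : Set Plane} (hA : IsOpen A) {u : Plane → ℂ}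
    (hu : u ∈ circleMaps A) (i : Fin 2) :
    MemLp (fun x => preJacobian A u x i) 2 (volume.restrict A) := by
  have mg := hu.1.memLp_weakGrad hA i
  refine mg.of_le ?_ ((circleMaps.weakGrad_eq hA hu i).mono fun x hx => by
    rw [Real.norm_eq_abs, hx.2])
  exact Complex.continuous_im.comp_aestronglyMeasurable ((MemLp.conj hu.1.1).1.mul mg.1)

lemma circleMaps.energyH_eq {A : Set Plane} (hA : IsOpen A) (V : Plane → Plane) (Ω : ℝ)
    {u : Plane → ℂ} (hu : u ∈ circleMaps A) : energyH A V Ω u =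
      ∫ x in A, ((1 / 2) * ∑ i, preJacobian A u x i ^ 2 - Ω * ∑ i, V x i * preJacobian A u x i) := by
  refine integral_congr_ae ?_
  have h := eventually_all.2 fun i => circleMaps.weakGrad_eq hA hu i
  filter_upwards [h] with x hx
  congr 2
  exact Finset.sum_congr rfl fun i _ => by rw [(hx i).2, sq_abs]

lemma LocallyLipschitz.memLp_coord {V : Plane → Plane} (hV : LocallyLipschitz V) {A : Set Plane}
    (hb : Bornology.IsBounded A) : (∃ M, 0 < M ∧ ∀ x ∈ A, ∀ i, |V x i| ≤ M) ∧
      ∀ i, MemLp (fun x => V x i) 2 (volume.restrict A) := by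
  have := isFiniteMeasure_restrict hb
  obtain ⟨M, hM⟩ := hb.isCompact_closure.exists_bound_of_continuousOn hV.continuous.continuousOn
  have hM' : ∀ x ∈ A, ∀ i, |V x i| ≤ max M 1 := fun x hx i =>
    (abs_coord_le _ i).trans ((hM x (subset_closure hx)).trans (le_max_left _ _))
  have hc : ∀ i, Continuous fun x => V x i := fun i =>
    (EuclideanSpace.proj (𝕜 := ℝ) i).continuous.comp hV.continuous
  refine ⟨⟨max M 1, by positivity, hM'⟩, fun i => MemLp.of_bound (hc i).aestronglyMeasurable
    (max M 1) ?_⟩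
  have hcl : ∀ x ∈ closure A, ‖V x i‖ ≤ max M 1 := fun x hx =>
    (abs_coord_le _ i).trans ((hM x hx).trans (le_max_left _ _))
  exact ae_restrict_of_ae_restrict_of_subset subset_closure
    (ae_restrict_of_forall_mem isClosed_closure.measurableSet hcl)

/-- Rotating a circle-valued map by a phase adds the gradient of the phase to its pre-Jacobian. -/
lemma circleMaps.mul_phase {A : Set Plane} (hA : IsOpen A) (hb : Bornology.IsBounded A)
    {u : Plane → ℂ} (hu : u ∈ circleMaps A) {ψ : Plane → ℝ} (hψ : ContDiffOn ℝ (⊤ : ℕ∞) ψ A)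
    (hψ2 : ∀ i, MemLp (classicalPartial i ψ) 2 (volume.restrict A)) (t : ℝ) :
    (fun x => Complex.exp (Complex.I * ((t * ψ x : ℝ) : ℂ)) * u x) ∈ circleMaps A ∧
      ∀ i, ∀ᵐ x ∂(volume.restrict A), preJacobian A
        (fun x => Complex.exp (Complex.I * ((t * ψ x : ℝ) : ℂ)) * u x) x i
          = preJacobian A u x i + t * classicalPartial i ψ x := by
  have := isFiniteMeasure_restrict hb
  set e : Plane → ℂ := fun x => Complex.exp (Complex.I * ((t * ψ x : ℝ) : ℂ)) with he
  have hnorm : ∀ x, ‖e x‖ = 1 := fun x => by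
    simp only [he]; rw [mul_comm]; exact Complex.norm_exp_ofReal_mul_I _
  have hin : ContDiffOn ℝ (⊤ : ℕ∞) (fun x => Complex.I * ((t * ψ x : ℝ) : ℂ)) A :=
    contDiffOn_const.mul (Complex.ofRealCLM.contDiff.comp_contDiffOn (contDiffOn_const.mul hψ))
  have hes : ContDiffOn ℝ (⊤ : ℕ∞) e A := hin.cexp
  have hpe : ∀ i, ∀ x ∈ A, classicalPartial i e x
      = (Complex.I * ((t * classicalPartial i ψ x : ℝ) : ℂ)) * e x := by
    intro i x hx
    have hd : HasFDerivAt ψ (fderiv ℝ ψ x) x :=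
      ((hψ.contDiffAt (hA.mem_nhds hx)).differentiableAt (by simp)).hasFDerivAt
    have h1 : HasFDerivAt (fun x => ((t * ψ x : ℝ) : ℂ))
        (Complex.ofRealCLM.comp (t • fderiv ℝ ψ x)) x :=
      Complex.ofRealCLM.hasFDerivAt.comp x (hd.const_mul t)
    have h2 : HasFDerivAt e _ x := (h1.const_mul Complex.I).cexp
    simp only [classicalPartial, h2.fderiv]
    simp [he]
    ring
  have hme : AEStronglyMeasurable e (volume.restrict A) :=
    hes.continuousOn.aestronglyMeasurable hA.measurableSet
  have me : MemLp e 2 (volume.restrict A) :=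
    MemLp.of_bound hme 1 (Eventually.of_forall fun x => (hnorm x).le)
  have mpe : ∀ i, MemLp (classicalPartial i e) 2 (volume.restrict A) := by
    intro i
    have h1 : MemLp (fun x => t * classicalPartial i ψ x) 2 (volume.restrict A) :=
      (hψ2 i).const_mul t
    refine h1.of_le ((hes.classicalPartial (m := 0) hA (by simp)
      i).continuousOn.aestronglyMeasurable hA.measurableSet) ?_
    refine ae_restrict_of_forall_mem hA.measurableSet fun x hx => le_of_eq ?_
    rw [hpe i x hx, norm_mul, hnorm, mul_one, norm_mul, Complex.norm_I, one_mul, Complex.norm_real]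
  have hwe : ∀ i, IsWeakPartial A i e (classicalPartial i e) := fun i =>
    (hes.of_le (by exact_mod_cast le_top)).isWeakPartial hA i
  have hprod : ∀ i, IsWeakPartial A i (fun x => e x * u x)
      (fun x => e x * weakGrad A u x i + classicalPartial i e x * u x) := fun i =>
    (hwe i).mul hA (hu.1.isWeakPartial i) me (mpe i) hu.1.1 (hu.1.memLp_weakGrad hA i)
  have hmem : MemH1 A fun x => e x * u x := by
    refine ⟨memLp_mul_of_bounded hme (Eventually.of_forall fun x => (hnorm x).le) hu.1.1,
      fun i => ⟨_, hprod i, ?_⟩⟩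
    refine (memLp_mul_of_bounded hme (Eventually.of_forall fun x => (hnorm x).le)
      (hu.1.memLp_weakGrad hA i)).add ?_
    have := memLp_mul_of_bounded hu.1.1.1 (C := 1) (hu.2.mono fun x hx => hx.le) (mpe i)
    simpa only [mul_comm] using this
  refine ⟨⟨hmem, hu.2.mono fun x hx => by rw [norm_mul, hnorm, hx, one_mul]⟩, fun i => ?_⟩
  filter_upwards [(hprod i).weakGrad_ae_eq hA, hu.2, ae_restrict_mem hA.measurableSet]
    with x hx hux hxA
  have h1 : conj (e x) * e x = 1 := by
    rw [mul_comm, Complex.mul_conj, Complex.normSq_eq_norm_sq, hnorm]; simp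
  have h2 : conj (u x) * u x = 1 := by
    rw [mul_comm, Complex.mul_conj, Complex.normSq_eq_norm_sq, hux]; simp
  have key : conj (e x * u x) * weakGrad A (fun x => e x * u x) x i
      = conj (u x) * weakGrad A u x i + Complex.I * ((t * classicalPartial i ψ x : ℝ) : ℂ) := by
    rw [hx, hpe i x hxA, map_mul]
    linear_combination (conj (u x) * weakGrad A u x i
      + Complex.I * ((t * classicalPartial i ψ x : ℝ) : ℂ) * (conj (u x) * u x)) * h1
      + Complex.I * ((t * classicalPartial i ψ x : ℝ) : ℂ) * h2
  change (conj (e x * u x) * weakGrad A (fun x => e x * u x) x i).im = _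
  rw [key]
  simp [preJacobian]

/-- For small `t` of sign opposite to `a` the linear term wins. Using `|b| + 1` avoids a division by
zero. -/
lemma eq_zero_of_forall_quadratic_nonneg {a b : ℝ} (h : ∀ t : ℝ, 0 ≤ t * a + t ^ 2 * b) :
    a = 0 := by
  by_contra ha
  have hB : 0 < |b| + 1 := by positivity
  have h1 := h (-(a / (2 * (|b| + 1))))
  have h2 : (-(a / (2 * (|b| + 1)))) ^ 2 * b ≤ (a / (2 * (|b| + 1))) ^ 2 * (|b| + 1) := by
    rw [neg_sq]
    exact mul_le_mul_of_nonneg_left (by linarith [le_abs_self b]) (sq_nonneg _)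
  have h3 : (a / (2 * (|b| + 1))) ^ 2 * (|b| + 1) = a ^ 2 / (4 * (|b| + 1)) := by
    field_simp; ring
  have h4 : -(a / (2 * (|b| + 1))) * a = - (2 * (a ^ 2 / (4 * (|b| + 1)))) := by
    field_simp; ring
  have h5 : 0 < a ^ 2 / (4 * (|b| + 1)) := by positivity
  linarith

/-- The Euler-Lagrange equation of `energyH`, tested with phases. -/
lemma IsVortexlessMinimizer.integral_eq_zero {A : Set Plane} (hA : IsOpen A)
    (hb : Bornology.IsBounded A) {V : Plane → Plane} (hV : LocallyLipschitz V) {Ω : ℝ}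
    {u : Plane → ℂ} (hu : IsVortexlessMinimizer A V Ω u) {ψ : Plane → ℝ}
    (hψ : ContDiffOn ℝ (⊤ : ℕ∞) ψ A)
    (hψ2 : ∀ i, MemLp (classicalPartial i ψ) 2 (volume.restrict A)) :
    ∫ x in A, ∑ i, (preJacobian A u x i - Ω * V x i) * classicalPartial i ψ x = 0 := by
  have mj := fun i => circleMaps.memLp_preJacobian hA hu.1 i
  have mV := (hV.memLp_coord hb).2
  have i0 : Integrable (fun x => (1 / 2) * ∑ i, preJacobian A u x i ^ 2
      - Ω * ∑ i, V x i * preJacobian A u x i) (volume.restrict A) :=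
    ((integrable_finsetSum _ fun i _ => (mj i).integrable_sq).const_mul _).sub
      ((integrable_finsetSum _ fun i _ => (mV i).integrable_mul_two (mj i)).const_mul _)
  have i1 : Integrable (fun x => ∑ i, (preJacobian A u x i - Ω * V x i) * classicalPartial i ψ x)
      (volume.restrict A) := integrable_finsetSum _ fun i _ =>
    ((mj i).sub ((mV i).const_mul Ω)).integrable_mul_two (hψ2 i)
  have i2 : Integrable (fun x => (1 / 2) * ∑ i, classicalPartial i ψ x ^ 2)
      (volume.restrict A) := (integrable_finsetSum _ fun i _ => (hψ2 i).integrable_sq).const_mul _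
  refine eq_zero_of_forall_quadratic_nonneg
    (b := ∫ x in A, (1 / 2) * ∑ i, classicalPartial i ψ x ^ 2) fun t => ?_
  -- The competitor `e^{itψ} u` has pre-Jacobian `j + t ∇ψ`, so its energy is exactly quadratic in
  -- `t`.
  obtain ⟨hw, hwj⟩ := circleMaps.mul_phase hA hb hu.1 hψ hψ2 t
  have hle := hu.2 _ hw
  rw [circleMaps.energyH_eq hA V Ω hu.1, circleMaps.energyH_eq hA V Ω hw] at hle
  have e : ∫ x in A, ((1 / 2) * ∑ i, preJacobian A
        (fun x => Complex.exp (Complex.I * ((t * ψ x : ℝ) : ℂ)) * u x) x i ^ 2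
      - Ω * ∑ i, V x i * preJacobian A
        (fun x => Complex.exp (Complex.I * ((t * ψ x : ℝ) : ℂ)) * u x) x i)
      = ∫ x in A, (((1 / 2) * ∑ i, preJacobian A u x i ^ 2
          - Ω * ∑ i, V x i * preJacobian A u x i)
        + (t * (∑ i, (preJacobian A u x i - Ω * V x i) * classicalPartial i ψ x)
          + t ^ 2 * ((1 / 2) * ∑ i, classicalPartial i ψ x ^ 2))) := by
    refine integral_congr_ae ?_
    filter_upwards [eventually_all.2 hwj] with x hx
    simp only [hx, Fin.sum_univ_two]
    ring
  have i3 : Integrable (fun x =>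
      t * (∑ i, (preJacobian A u x i - Ω * V x i) * classicalPartial i ψ x)
        + t ^ 2 * ((1 / 2) * ∑ i, classicalPartial i ψ x ^ 2)) (volume.restrict A) :=
    (i1.const_mul t).add (i2.const_mul _)
  rw [e, integral_add i0 i3,
    integral_add (i1.const_mul t) (i2.const_mul _), integral_const_mul, integral_const_mul] at hle
  linarith

/-- A minimizer has at most the energy of a constant map. -/
lemma IsVortexlessMinimizer.bounds {A : Set Plane} (hA : IsOpen A) (hb : Bornology.IsBounded A)
    {V : Plane → Plane} (hV : LocallyLipschitz V) {Ω : ℝ} {u : Plane → ℂ}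
    (hu : IsVortexlessMinimizer A V Ω u) :
    ∫ x in A, ∑ i, preJacobian A u x i ^ 2 ≤ 4 * Ω ^ 2 * ∫ x in A, ∑ i, V x i ^ 2 := by
  have := isFiniteMeasure_restrict hb
  have mj := fun i => circleMaps.memLp_preJacobian hA hu.1 i
  have mV := (hV.memLp_coord hb).2
  have hone : (fun _ : Plane => (1 : ℂ)) ∈ circleMaps A :=
    ⟨⟨memLp_const 1, fun i => ⟨_, isWeakPartial_const hA 1 i, memLp_const 0⟩⟩,
      Eventually.of_forall fun _ => norm_one⟩
  have h1 : energyH A V Ω (fun _ => 1) = 0 := by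
    have h0 := eventually_all.2 fun i => (isWeakPartial_const hA (1 : ℂ) i).weakGrad_ae_eq hA
    rw [energyH, integral_eq_zero_of_ae]
    filter_upwards [h0] with x hx
    simp [preJacobian, hx]
  have hle := hu.2 _ hone
  rw [h1, circleMaps.energyH_eq hA V Ω hu.1] at hle
  have ij : Integrable (fun x => ∑ i, preJacobian A u x i ^ 2) (volume.restrict A) :=
    integrable_finsetSum _ fun i _ => (mj i).integrable_sq
  have iV : Integrable (fun x => ∑ i, V x i ^ 2) (volume.restrict A) :=
    integrable_finsetSum _ fun i _ => (mV i).integrable_sq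
  have iVj : Integrable (fun x => ∑ i, V x i * preJacobian A u x i) (volume.restrict A) :=
    integrable_finsetSum _ fun i _ => (mV i).integrable_mul_two (mj i)
  -- Pointwise this is `|j / 2 - Ω V|² ≥ 0`.
  have h2 : ∫ x in A, ((1 / 4) * ∑ i, preJacobian A u x i ^ 2 - Ω ^ 2 * ∑ i, V x i ^ 2)
      ≤ ∫ x in A, ((1 / 2) * ∑ i, preJacobian A u x i ^ 2
        - Ω * ∑ i, V x i * preJacobian A u x i) := by
    refine integral_mono ((ij.const_mul _).sub (iV.const_mul _))
      ((ij.const_mul _).sub (iVj.const_mul _)) fun x => ?_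
    simp only [Fin.sum_univ_two]
    nlinarith [sq_nonneg (preJacobian A u x 0 / 2 - Ω * V x 0),
      sq_nonneg (preJacobian A u x 1 / 2 - Ω * V x 1)]
  rw [integral_sub (ij.const_mul _) (iV.const_mul _), integral_const_mul, integral_const_mul] at h2
  linarith

end

noncomputable section

/-! ### The pre-Jacobian of a minimizer -/

lemma tsupport_partial_cutoff_subset {D B : Set Plane} {η : Plane → ℝ} (hη : IsTestFunction D η)
    {c : ℝ} (hη1 : ∀ᶠ x in 𝓝ˢ (closure B), η x = c) (i : Fin 2) :
    tsupport (classicalPartial i η) ⊆ annulus D B := by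
  intro x hx
  refine ⟨hη.2.2 (tsupport_classicalPartial_subset i η hx), fun hxB => ?_⟩
  refine (notMem_tsupport_iff_eventuallyEq.2 ?_) hx
  have h := (eventually_nhdsSet_iff_forall.1 hη1 x hxB).eventually_nhds
  filter_upwards [h] with y hy
  exact classicalPartial_eq_zero_of_eventuallyEq i hy

lemma IsTestFunction.memLp {U A : Set Plane} {φ : Plane → ℝ} (h : IsTestFunction U φ) :
    MemLp φ 2 (volume.restrict A) :=
  (h.1.continuous.memLp_of_hasCompactSupport h.2.1).restrict A

/-- The rotated gradient of a phase potential is orthogonal to gradients. -/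
lemma IsPhasePotential.integral_rot_eq_zero {D B : Set Plane} (hDB : IsAnnularPair D B)
    {Φ η : Plane → ℝ} (hη : IsTestFunction D η) (hη1 : ∀ᶠ x in 𝓝ˢ (closure B), η x = 1) {c : ℝ}
    (hc : ∀ Y : Fin 2 → Plane → ℝ, (∀ i, ContDiffOn ℝ (⊤ : ℕ∞) (Y i) (annulus D B)) →
      (∀ x ∈ annulus D B, ∑ i, classicalPartial i (Y i) x = 0) →
      (∀ i, MemLp (Y i) 2 (volume.restrict (annulus D B))) →
      ∫ x in annulus D B, ∑ i, weakGrad (annulus D B) Φ x i * Y i x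
        = c * ∫ x in annulus D B, ∑ i, classicalPartial i η x * Y i x)
    {ψ : Plane → ℝ} (hψ : ContDiffOn ℝ (⊤ : ℕ∞) ψ (annulus D B))
    (hψ2 : ∀ i, MemLp (classicalPartial i ψ) 2 (volume.restrict (annulus D B))) :
    ∫ x in annulus D B, ∑ i, rot (weakGrad (annulus D B) Φ x) i * classicalPartial i ψ x = 0 := by
  have hA := isOpen_annulus hDB
  have hp := fun i => hψ.classicalPartial (m := (⊤ : ℕ∞)) hA (by simp) i
  -- The rotated gradient of `ψ` is divergence-free, and its pairing with `∇η` vanishes as a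
  -- Jacobian integral.
  have h := hc ![classicalPartial 1 ψ, fun x => - classicalPartial 0 ψ x]
    (by
      rw [Fin.forall_fin_two]
      exact ⟨hp 1, (hp 0).neg⟩)
    (fun x hx => by
      rw [Fin.sum_univ_two]
      have h1 : classicalPartial 1 (fun x => - classicalPartial 0 ψ x) x
          = - classicalPartial 1 (classicalPartial 0 ψ) x := by
        change fderiv ℝ (fun x => - classicalPartial 0 ψ x) x _ = _
        rw [fderiv_fun_neg, neg_apply]
        rfl
      have h2 := classicalPartial_comm ((contDiffOn_infty.1 hψ 2).contDiffAt (hA.mem_nhds hx)) 0 1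
      simp only [Matrix.cons_val_zero, Matrix.cons_val_one, h1, h2]
      ring)
    (by
      rw [Fin.forall_fin_two]
      exact ⟨hψ2 1, (hψ2 0).neg⟩)
  have h3 := integral_jacobian_eq_zero hA hη.1 hη.2.1 (tsupport_partial_cutoff_subset hη hη1) hψ
  simp only [Fin.sum_univ_two, Matrix.cons_val_zero, Matrix.cons_val_one, mul_neg,
    ← sub_eq_add_neg] at h
  rw [h3, mul_zero] at h
  rw [← h]
  refine integral_congr_ae (Eventually.of_forall fun x => ?_)
  simp only [Fin.sum_univ_two, rot, Matrix.cons_val_zero, Matrix.cons_val_one]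
  ring

lemma memLp_rot_weakGrad {A : Set Plane} (hA : IsOpen A) {Φ : Plane → ℝ} (h : MemH1 A Φ)
    (i : Fin 2) : MemLp (fun x => rot (weakGrad A Φ x) i) 2 (volume.restrict A) := by
  fin_cases i
  · exact (h.memLp_weakGrad hA 1).neg
  · exact h.memLp_weakGrad hA 0

lemma HasCirculation.integral_sub_eq_zero {D B : Set Plane} {X Z : Plane → Fin 2 → ℝ} {c : ℝ}
    (hX : HasCirculation D B X c) (hZ : HasCirculation D B Z c)
    (mX : ∀ i, MemLp (fun x => X x i) 2 (volume.restrict (annulus D B)))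
    (mZ : ∀ i, MemLp (fun x => Z x i) 2 (volume.restrict (annulus D B)))
    {η : Plane → ℝ} (hη : IsTestFunction D η) (hη1 : ∀ᶠ x in 𝓝ˢ (closure B), η x = 1) :
    ∫ x in annulus D B, ∑ i, (X x i - Z x i) * rot (fun k => classicalPartial k η x) i = 0 := by
  have mη : ∀ i, MemLp (fun x => rot (fun k => classicalPartial k η x) i) 2
      (volume.restrict (annulus D B)) := by
    rw [Fin.forall_fin_two]
    exact ⟨(hη.classicalPartial 1).memLp.neg, (hη.classicalPartial 0).memLp⟩
  have h1 := hX η hη hη1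
  have h2 := hZ η hη hη1
  have e : ∀ x, ∑ i, (X x i - Z x i) * rot (fun k => classicalPartial k η x) i
      = (∑ i, X x i * rot (fun k => classicalPartial k η x) i)
        - ∑ i, Z x i * rot (fun k => classicalPartial k η x) i := fun x => by
    simp only [sub_mul, Finset.sum_sub_distrib]
  simp_rw [e]
  rw [integral_sub (integrable_finsetSum _ fun i _ => (mX i).integrable_mul_two (mη i))
    (integrable_finsetSum _ fun i _ => (mZ i).integrable_mul_two (mη i))]
  linarith

/-- The pre-Jacobian of a minimizer is determined by the phase potential of the same degree, and
its size is controlled by the angular speed. -/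
theorem exists_preJacobian_bound {D B : Set Plane} (hDB : IsAnnularPair D B)
    {V : Plane → Plane} (hV : LocallyLipschitz V) :
    ∃ C > 0, ∀ (Ω : ℝ) (d : ℤ) (u : Plane → ℂ) (Φ : Plane → ℝ), 0 < Ω →
      IsVortexlessMinimizer (annulus D B) V Ω u → HasDegree D B u d →
      IsPhasePotential D B V Ω d Φ →
      (∀ i, ∀ᵐ x ∂(volume.restrict (annulus D B)),
        preJacobian (annulus D B) u x i = rot (weakGrad (annulus D B) Φ x) i + Ω * V x i) ∧
      ∀ i, ∀ᵐ x ∂(volume.restrict (annulus D B)), |preJacobian (annulus D B) u x i| ≤ C * Ω := by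
  set A := annulus D B with hAdef
  have hA : IsOpen A := isOpen_annulus hDB
  have hb : Bornology.IsBounded A := isBounded_annulus hDB
  have := isFiniteMeasure_restrict hb
  obtain ⟨⟨M, hM, hVM⟩, mV⟩ := hV.memLp_coord hb
  obtain ⟨η, hη, hη1⟩ := exists_hole_cutoff hDB
  obtain ⟨C₁, hC₁, hpot⟩ := exists_phasePotential_bound hDB hV hη hη1
  -- A radial field centred in the hole is bounded and divergence-free on `A`, and its pairing with
  -- `∇η` is `-1`. It serves to measure the constant `c` attached to `Φ`.
  obtain ⟨b, hbB⟩ := hDB.simplyConnected_hole.nonempty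
  obtain ⟨δ, hδ, hball⟩ := Metric.nhds_basis_closedBall.mem_iff.1 (hDB.isOpen_hole.mem_nhds hbB)
  have hfar : ∀ x ∈ A, δ ≤ ‖x - b‖ := fun x hx => by
    by_contra h
    exact hx.2 (subset_closure (hball (mem_closedBall_iff_norm.2 (not_le.1 h).le)))
  set R : Fin 2 → Plane → ℝ := fun i x => radialField δ i (x - b) with hR
  set N : ℝ := (2 * kernelMass)⁻¹ * δ⁻¹ with hN
  have hkm := kernelMass_pos
  have hNpos : 0 < N := by positivity
  have hRN : ∀ i, ∀ x ∈ A, |R i x| ≤ N := fun i x hx => by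
    refine (abs_radialField_le δ i _).trans ?_
    exact mul_le_mul_of_nonneg_left (inv_anti₀ hδ (hfar x hx)) (by positivity)
  have hRc : ∀ i, ContDiffOn ℝ (⊤ : ℕ∞) (R i) A := fun i =>
    (radialField_sub_contDiff hδ i b).contDiffOn
  have hRm : ∀ i, MemLp (R i) 2 (volume.restrict A) := fun i =>
    MemLp.of_bound (radialField_sub_contDiff hδ i b).continuous.aestronglyMeasurable N
      (ae_restrict_of_forall_mem hA.measurableSet fun x hx => hRN i x hx)
  have hRdiv : ∀ x ∈ A, ∑ i, classicalPartial i (R i) x = 0 := fun x hx => by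
    simp only [hR, classicalPartial_radialField_sub, divergence_radialField hδ]
    exact rho_eq_zero hδ (hfar x hx)
  have hηB : ∀ y ∈ B, η y = 1 := fun y hy =>
    (eventually_nhdsSet_iff_forall.1 hη1 y (subset_closure hy)).self_of_nhds
  have hηR : ∫ x in A, ∑ i, classicalPartial i η x * R i x = -1 := by
    rw [integral_partial_mul_radialField hη.1 hη.2.1 (tsupport_partial_cutoff_subset hη hη1) hδ
      fun y hy => (hηB y (hball hy)).trans (hηB b hbB).symm, hηB b hbB]
  set vol : ℝ := ∫ _ in A, (1 : ℝ) with hvol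
  have hvol0 : 0 ≤ vol := integral_nonneg fun _ => zero_le_one
  set S : ℝ := ∫ x in A, ∑ i, V x i ^ 2 with hS
  have hS0 : 0 ≤ S := integral_nonneg fun x => Finset.sum_nonneg fun i _ => sq_nonneg _
  set K : ℝ := N * (vol * (1 + 2 * M) + 2 * S) with hK
  have hK0 : 0 ≤ K := by positivity
  refine ⟨C₁ * (1 + K) + M, by positivity, fun Ω d u Φ hΩ hu hd hΦ => ?_⟩
  obtain ⟨c, hgrad, hc⟩ := hpot Ω d Φ hΩ hΦ
  have mj := fun i => circleMaps.memLp_preJacobian hA hu.1 i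
  have mr := fun i => memLp_rot_weakGrad hA hΦ.equation.1 i
  have mZ : ∀ i, MemLp (fun x => rot (weakGrad A Φ x) i + Ω * V x i) 2 (volume.restrict A) :=
    fun i => (mr i).add ((mV i).const_mul Ω)
  -- `X` is orthogonal to gradients and to divergence-free test fields. Together these make it a
  -- gradient, hence orthogonal to itself.
  set X : Fin 2 → Plane → ℝ := fun i x =>
    preJacobian A u x i - (rot (weakGrad A Φ x) i + Ω * V x i) with hX
  have mX : ∀ i, MemLp (X i) 2 (volume.restrict A) := fun i => (mj i).sub (mZ i)
  have hgradX : ∀ ψ : Plane → ℝ, ContDiffOn ℝ (⊤ : ℕ∞) ψ A →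
      (∀ i, MemLp (classicalPartial i ψ) 2 (volume.restrict A)) →
      ∫ x in A, ∑ i, classicalPartial i ψ x * X i x = 0 := by
    intro ψ hψ hψ2
    have h1 := hu.integral_eq_zero hA hb hV hψ hψ2
    have h2 := IsPhasePotential.integral_rot_eq_zero hDB hη hη1 hc hψ hψ2
    have e : ∀ x, ∑ i, classicalPartial i ψ x * X i x
        = (∑ i, (preJacobian A u x i - Ω * V x i) * classicalPartial i ψ x)
          - ∑ i, rot (weakGrad A Φ x) i * classicalPartial i ψ x := fun x => by
      simp only [hX, Fin.sum_univ_two]; ring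
    have mjV : ∀ i, MemLp (fun x => preJacobian A u x i - Ω * V x i) 2 (volume.restrict A) :=
      fun i => (mj i).sub ((mV i).const_mul Ω)
    simp_rw [e]
    rw [integral_sub (integrable_finsetSum _ fun i _ => (mjV i).integrable_mul_two (hψ2 i))
      (integrable_finsetSum _ fun i _ => (mr i).integrable_mul_two (hψ2 i)), h1, h2, sub_zero]
  have hcirc : ∀ η' : Plane → ℝ, IsTestFunction D η' → (∀ᶠ x in 𝓝ˢ (closure B), η' x = 1) →
      ∫ x in A, ∑ i, X i x * rot (fun k => classicalPartial k η' x) i = 0 := fun η' h h' =>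
    HasCirculation.integral_sub_eq_zero hd hΦ.flux mj mZ h h'
  have hdivX : ∀ Y : Fin 2 → Plane → ℝ, (∀ i, IsTestFunction A (Y i)) →
      (∀ x, ∑ i, classicalPartial i (Y i) x = 0) → ∫ x in A, ∑ i, Y i x * X i x = 0 := by
    intro Y hY hYdiv
    obtain ⟨φ, c₀, hφ, hφc, hφY⟩ := hDB.exists_streamFunction hY hYdiv
    -- Both `η` and `φ + (1 - c₀) η` equal `1` near the hole. Combining their circulation identities
    -- tests `X` against `∇^⊥φ = Y`.
    have hsum : IsTestFunction D fun x => φ x + (1 - c₀) * η x := hφ.add (hη.const_mul _)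
    have h1 := hcirc _ hsum (by
      filter_upwards [hφc, hη1] with x h h'
      rw [h, h']; ring)
    have h2 := hcirc η hη hη1
    have hp : ∀ k x, classicalPartial k (fun x => φ x + (1 - c₀) * η x) x
        = classicalPartial k φ x + (1 - c₀) * classicalPartial k η x := by
      intro k x
      have dη := hη.1.differentiable (by simp) x
      rw [classicalPartial_add (hφ.1.differentiable (by simp) x) (dη.const_mul _)]
      congr 1
      simp only [classicalPartial]
      rw [fderiv_const_mul dη]; rfl
    have mη : ∀ i, MemLp (fun x => rot (fun k => classicalPartial k η x) i) 2
        (volume.restrict A) := by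
      rw [Fin.forall_fin_two]
      exact ⟨(hη.classicalPartial 1).memLp.neg, (hη.classicalPartial 0).memLp⟩
    have e : ∀ x, ∑ i, Y i x * X i x
        = (∑ i, X i x * rot (fun k => classicalPartial k (fun x => φ x + (1 - c₀) * η x) x) i)
          - (1 - c₀) * ∑ i, X i x * rot (fun k => classicalPartial k η x) i := by
      intro x
      simp only [Fin.sum_univ_two, hp, rot, Matrix.cons_val_zero, Matrix.cons_val_one,
        (hφY x).1, (hφY x).2]
      ring
    have mη' : ∀ i, MemLp (fun x => rot (fun k => classicalPartial k
        (fun x => φ x + (1 - c₀) * η x) x) i) 2 (volume.restrict A) := by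
      rw [Fin.forall_fin_two]
      exact ⟨(hsum.classicalPartial 1).memLp.neg, (hsum.classicalPartial 0).memLp⟩
    simp_rw [e]
    rw [integral_sub (integrable_finsetSum _ fun i _ => (mX i).integrable_mul_two (mη' i))
      ((integrable_finsetSum _ fun i _ => (mX i).integrable_mul_two (mη i)).const_mul _),
      integral_const_mul, h1, h2]
    ring
  have hXint : ∀ i, IntegrableOn (X i) A := fun i => (mX i).integrable (by norm_num)
  obtain ⟨ψ, hψ, hXψ⟩ := exists_primitive hA hb hXint hdivX fun Q hQ =>
    hgradX Q hQ.1.contDiffOn fun i => (hQ.classicalPartial i).memLp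
  have hψ2 : ∀ i, MemLp (classicalPartial i ψ) 2 (volume.restrict A) := fun i =>
    (mX i).ae_eq (hXψ i)
  have hX0 : ∀ᵐ x ∂(volume.restrict A), ∑ i, X i x ^ 2 = 0 := by
    have h1 := hgradX ψ hψ hψ2
    have h2 : ∫ x in A, ∑ i, X i x ^ 2 = 0 := by
      rw [← h1]
      refine integral_congr_ae ?_
      filter_upwards [eventually_all.2 hXψ] with x hx
      exact Finset.sum_congr rfl fun i _ => by rw [← hx i, sq]
    exact (integral_eq_zero_iff_of_nonneg
      (fun x => Finset.sum_nonneg fun i _ => sq_nonneg (X i x))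
      (integrable_finsetSum _ fun i _ => (mX i).integrable_sq)).1 h2
  have hj : ∀ i, ∀ᵐ x ∂(volume.restrict A),
      preJacobian A u x i = rot (weakGrad A Φ x) i + Ω * V x i := by
    intro i
    filter_upwards [hX0] with x hx
    have := (Finset.sum_eq_zero_iff_of_nonneg fun i _ => sq_nonneg (X i x)).1 hx i
      (Finset.mem_univ i)
    exact sub_eq_zero.1 (pow_eq_zero_iff two_ne_zero |>.1 this)
  -- Pairing with `R` gives `-c = ∫ ∇Φ·R`. By the identity just proved, `∇Φ` is `j - Ω V` up to a
  -- rotation, and `j` is `O(Ω)` in `L²` by comparison with a constant map. Young's inequality with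
  -- weight `Ω` passes from `|j|` to `|j|²`.
  have hcK : |c| ≤ K * Ω := by
    have h1 := hc R hRc hRdiv hRm
    rw [hηR] at h1
    have ij : Integrable (fun x => ∑ i, preJacobian A u x i ^ 2) (volume.restrict A) :=
      integrable_finsetSum _ fun i _ => (mj i).integrable_sq
    have h2 : |∫ x in A, ∑ i, weakGrad A Φ x i * R i x|
        ≤ ∫ x in A, (N * (Ω * (1 + 2 * M)) * 1
          + N * (Ω⁻¹ / 2) * ∑ i, preJacobian A u x i ^ 2) := by
      have hdom : Integrable (fun x => N * (Ω * (1 + 2 * M)) * 1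
          + N * (Ω⁻¹ / 2) * ∑ i, preJacobian A u x i ^ 2) (volume.restrict A) :=
        ((integrable_const (1 : ℝ)).const_mul _).add (ij.const_mul _)
      rw [← Real.norm_eq_abs]
      refine norm_integral_le_of_norm_le hdom ?_
      filter_upwards [hj 0, hj 1, ae_restrict_mem hA.measurableSet] with x h0 h1 hx
      simp only [rot, Matrix.cons_val_zero, Matrix.cons_val_one] at h0 h1
      have hyoung : ∀ a : ℝ, |a| ≤ Ω / 2 + Ω⁻¹ / 2 * a ^ 2 := by
        intro a
        have h3 : 0 ≤ Ω⁻¹ / 2 * (Ω - |a|) ^ 2 := by positivity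
        have h4 : Ω⁻¹ / 2 * (Ω - |a|) ^ 2 = Ω / 2 + Ω⁻¹ / 2 * a ^ 2 - |a| := by
          rw [← sq_abs a]; field_simp; ring
        linarith
      have hVb : ∀ i, |Ω * V x i| ≤ Ω * M := fun i => by
        rw [abs_mul, abs_of_pos hΩ]
        exact mul_le_mul_of_nonneg_left (hVM x hx i) hΩ.le
      have g0 : |weakGrad A Φ x 0| ≤ |preJacobian A u x 1| + Ω * M := by
        rw [show weakGrad A Φ x 0 = preJacobian A u x 1 - Ω * V x 1 by linarith]
        exact (abs_sub _ _).trans (add_le_add_right (hVb 1) _)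
      have g1 : |weakGrad A Φ x 1| ≤ |preJacobian A u x 0| + Ω * M := by
        rw [show weakGrad A Φ x 1 = Ω * V x 0 - preJacobian A u x 0 by linarith, add_comm]
        exact (abs_sub _ _).trans (add_le_add_left (hVb 0) _)
      rw [Fin.sum_univ_two, Fin.sum_univ_two, Real.norm_eq_abs]
      calc _ ≤ |weakGrad A Φ x 0 * R 0 x| + |weakGrad A Φ x 1 * R 1 x| := abs_add_le _ _
        _ ≤ (|preJacobian A u x 1| + Ω * M) * N + (|preJacobian A u x 0| + Ω * M) * N := by
          rw [abs_mul, abs_mul]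
          exact add_le_add (mul_le_mul g0 (hRN 0 x hx) (abs_nonneg _) (by positivity))
            (mul_le_mul g1 (hRN 1 x hx) (abs_nonneg _) (by positivity))
        _ ≤ ((Ω / 2 + Ω⁻¹ / 2 * preJacobian A u x 1 ^ 2) + Ω * M) * N
            + ((Ω / 2 + Ω⁻¹ / 2 * preJacobian A u x 0 ^ 2) + Ω * M) * N := by
          gcongr <;> exact hyoung _
        _ = _ := by ring
    have h3 : ∫ x in A, (N * (Ω * (1 + 2 * M)) * 1
          + N * (Ω⁻¹ / 2) * ∑ i, preJacobian A u x i ^ 2)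
        ≤ N * (Ω * (1 + 2 * M)) * vol + N * (Ω⁻¹ / 2) * (4 * Ω ^ 2 * S) := by
      rw [integral_add ((integrable_const (1 : ℝ)).const_mul _) (ij.const_mul _),
        integral_const_mul, integral_const_mul]
      have := hu.bounds hA hb hV
      gcongr
    rw [h1] at h2
    have h4 : |c * -1| = |c| := by simp
    rw [h4] at h2
    refine (h2.trans h3).trans (le_of_eq ?_)
    rw [hK]; field_simp; ring
  refine ⟨hj, fun i => ?_⟩
  have hgr : ∀ᵐ x ∂(volume.restrict A), |rot (weakGrad A Φ x) i| ≤ C₁ * (Ω + |c|) := by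
    fin_cases i
    · filter_upwards [hgrad 1] with x hx
      simpa [rot] using hx
    · filter_upwards [hgrad 0] with x hx
      simpa [rot] using hx
  filter_upwards [hj i, hgr, ae_restrict_mem hA.measurableSet] with x h1 h2 hx
  rw [h1]
  have h3 : |Ω * V x i| ≤ Ω * M := by
    rw [abs_mul, abs_of_pos hΩ]
    exact mul_le_mul_of_nonneg_left (hVM x hx i) hΩ.le
  have h4 : C₁ * (Ω + |c|) ≤ C₁ * (Ω + K * Ω) := by gcongr
  refine (abs_add_le _ _).trans ?_
  linarith

end

noncomputable section

/-! ### The energy decomposition -/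

/-- For `U = u`, `g = ∂u` and `j` the pre-Jacobian of the unimodular map `z`, the product `z̄ (g - i
j U)` is the derivative of `z̄ u`. Multiplication by `z̄` is an isometry, so it drops out of both
expressions. -/
lemma norm_sq_and_im_of_phase {z : ℂ} (hz : ‖z‖ = 1) (U g : ℂ) (j : ℝ) :
    ‖conj z * (g - Complex.I * j * U)‖ ^ 2
        = ‖g‖ ^ 2 - 2 * j * (conj U * g).im + j ^ 2 * ‖U‖ ^ 2 ∧
      (conj (conj z * U) * (conj z * (g - Complex.I * j * U))).im
        = (conj U * g).im - j * ‖U‖ ^ 2 := by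
  have h1 : z * conj z = 1 := by
    rw [Complex.mul_conj, Complex.normSq_eq_norm_sq, hz]; simp
  constructor
  · rw [norm_mul, RCLike.norm_conj, hz, one_mul]
    simp only [Complex.sq_norm, Complex.normSq_apply, Complex.sub_re, Complex.sub_im,
      Complex.mul_re, Complex.mul_im, Complex.I_re, Complex.I_im, Complex.ofReal_re,
      Complex.ofReal_im, Complex.conj_re, Complex.conj_im]
    ring
  · have e : conj (conj z * U) * (conj z * (g - Complex.I * j * U))
        = conj U * (g - Complex.I * j * U) := by
      rw [map_mul, Complex.conj_conj]
      linear_combination (conj U * (g - Complex.I * j * U)) * h1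
    rw [e]
    simp only [Complex.sq_norm, Complex.normSq_apply, Complex.sub_re, Complex.sub_im,
      Complex.mul_re, Complex.mul_im, Complex.I_re, Complex.I_im, Complex.ofReal_re,
      Complex.ofReal_im, Complex.conj_re, Complex.conj_im]
    ring

/-- Dividing by a circle-valued map with bounded gradient preserves `H¹`. -/
lemma circleMaps.memH1_conj_mul {A : Set Plane} (hA : IsOpen A) {z u : Plane → ℂ}
    (hz : z ∈ circleMaps A) {C : ℝ}
    (hC : ∀ i, ∀ᵐ x ∂(volume.restrict A), |preJacobian A z x i| ≤ C) (hu : MemH1 A u) :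
    MemH1 A (fun x => conj (z x) * u x) ∧ ∀ i, ∀ᵐ x ∂(volume.restrict A),
      weakGrad A (fun x => conj (z x) * u x) x i
        = conj (z x) * (weakGrad A u x i - Complex.I * preJacobian A z x i * u x) := by
  have mz := MemLp.conj hz.1.1
  have mgz := fun i => MemLp.conj (hz.1.memLp_weakGrad hA i)
  have mgu := fun i => hu.memLp_weakGrad hA i
  have hprod : ∀ i, IsWeakPartial A i (fun x => conj (z x) * u x)
      (fun x => conj (z x) * weakGrad A u x i + conj (weakGrad A z x i) * u x) := fun i =>
    (hz.1.isWeakPartial i).conj.mul hA (hu.isWeakPartial i) mz (mgz i) hu.1 (mgu i)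
  have bz : ∀ᵐ x ∂(volume.restrict A), ‖conj (z x)‖ ≤ 1 :=
    hz.2.mono fun x hx => by rw [RCLike.norm_conj, hx]
  refine ⟨⟨memLp_mul_of_bounded mz.1 bz hu.1, fun i => ⟨_, hprod i, ?_⟩⟩, fun i => ?_⟩
  · refine (memLp_mul_of_bounded mz.1 bz (mgu i)).add
      (memLp_mul_of_bounded (mgz i).1 (C := C) ?_ hu.1)
    filter_upwards [circleMaps.weakGrad_eq hA hz i, hC i] with x h1 h2
    rw [RCLike.norm_conj, h1.2]; exact h2
  · filter_upwards [(hprod i).weakGrad_ae_eq hA, circleMaps.weakGrad_eq hA hz i] with x h1 h2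
    rw [h1, h2.1]
    simp only [map_mul, Complex.conj_I, Complex.conj_ofReal]
    ring

/-- The reduced functional without its normalizing factor. -/
def reducedEnergy (A : Set Plane) (Φ : Plane → ℝ) (ε : ℝ) (v : Plane → ℂ) : ℝ :=
  ∫ x in A, ((1 / 2) * ∑ i, ‖weakGrad A v x i‖ ^ 2
    + (1 / (4 * ε ^ 2)) * (1 - ‖v x‖ ^ 2) ^ 2
    + ∑ i, rot (weakGrad A Φ x) i * preJacobian A v x i)

set_option maxHeartbeats 400000 in
-- The substitution `u = z v` with explicit remainder: `E` is the integral of `h (|u|² - 1)`, with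
-- `h` the energy density of the minimizer, and `P` is the potential energy of `u`. The lower bound
-- on the energy is the coercivity that recovers `P`. The constant depends on the domain and on `V`
-- only, so `ε`, `Ω` and the degree may vary along a sequence.
theorem exists_energy_decomposition {D B : Set Plane} (hDB : IsAnnularPair D B)
    {V : Plane → Plane} (hV : LocallyLipschitz V) :
    ∃ C > 0, ∀ (ε Ω : ℝ) (d : ℤ) (z : Plane → ℂ) (Φ : Plane → ℝ) (u : Plane → ℂ),
      0 < ε → 0 < Ω → IsVortexlessMinimizer (annulus D B) V Ω z → HasDegree D B z d →
      IsPhasePotential D B V Ω d Φ → MemH1 (annulus D B) u →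
      MemH1 (annulus D B) (fun x => conj (z x) * u x) ∧ ∃ E P : ℝ, 0 ≤ P ∧
        energyJ (annulus D B) V ε Ω u = minH (annulus D B) V Ω
          + reducedEnergy (annulus D B) Φ ε (fun x => conj (z x) * u x) + E ∧
        |E| ≤ C * (ε * Ω ^ 3 + ε * Ω * P) ∧
        P * (1 - C * (ε * Ω)) - C * Ω ^ 2 * (1 + ε * Ω) ≤ energyJ (annulus D B) V ε Ω u ∧
        |minH (annulus D B) V Ω| ≤ C * Ω ^ 2 := by
  set A := annulus D B with hAdef
  have hA : IsOpen A := isOpen_annulus hDB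
  have hb : Bornology.IsBounded A := isBounded_annulus hDB
  have := isFiniteMeasure_restrict hb
  obtain ⟨⟨M, hM, hVM⟩, mV⟩ := hV.memLp_coord hb
  obtain ⟨C₁, hC₁, hjac⟩ := exists_preJacobian_bound hDB hV
  set vol : ℝ := ∫ _ in A, (1 : ℝ) with hvol
  have hvol0 : 0 ≤ vol := integral_nonneg fun _ => zero_le_one
  set C₂ : ℝ := C₁ ^ 2 + 2 * M * C₁ with hC₂
  have hC₂0 : 0 < C₂ := by positivity
  obtain ⟨Q, hQ, hQ1, hQ2, hQ3, hQ4⟩ : ∃ Q > 0, 2 * C₂ * (1 + vol) ≤ Q ∧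
      2 * M ^ 2 * (1 + vol) ≤ Q ∧ M ^ 2 * vol ≤ Q ∧ C₂ * vol ≤ Q := by
    have p1 := mul_nonneg hC₂0.le hvol0
    have p2 := mul_nonneg (sq_nonneg M) hvol0
    refine ⟨2 * (C₂ + M ^ 2) * (1 + vol), by positivity, ?_, ?_, ?_, ?_⟩ <;>
      linarith [sq_nonneg M]
  refine ⟨Q, hQ, fun ε Ω d z Φ u hε hΩ hz hd hΦ hu => ?_⟩
  obtain ⟨hj, hjb⟩ := hjac Ω d z Φ hΩ hz hd hΦ
  obtain ⟨hv, hgv⟩ := circleMaps.memH1_conj_mul hA hz.1 hjb hu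
  refine ⟨hv, ?_⟩
  set v : Plane → ℂ := fun x => conj (z x) * u x with hvdef
  have mg := fun i => hu.memLp_weakGrad hA i
  have mj := fun i => circleMaps.memLp_preJacobian hA hz.1 i
  -- Integrability of the potential term is needed to split the integrals: a nonintegrable function
  -- has integral zero by convention.
  have i4 := MemH1.integrable_norm_pow_four hA hb (hasSmoothBoundary_annulus hDB) hu
  have i2 : Integrable (fun x => ‖u x‖ ^ 2) (volume.restrict A) := hu.1.norm.integrable_sq
  have i1 : Integrable (fun _ : Plane => (1 : ℝ)) (volume.restrict A) := integrable_const 1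
  have ia : Integrable (fun x => ‖u x‖ ^ 2 - 1) (volume.restrict A) := i2.sub i1
  have ia2 : Integrable (fun x => (‖u x‖ ^ 2 - 1) ^ 2) (volume.restrict A) := by
    have := (i4.sub (i2.const_mul 2)).add i1
    refine this.congr (Eventually.of_forall fun x => ?_)
    simp only [Pi.add_apply, Pi.sub_apply]
    ring
  have ig : ∀ i, Integrable (fun x => ‖weakGrad A u x i‖ ^ 2) (volume.restrict A) := fun i =>
    (mg i).norm.integrable_sq
  have ip : ∀ i, Integrable (fun x => preJacobian A u x i) (volume.restrict A) := fun i =>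
    ((MemLp.conj hu.1).integrable_mul_two (mg i)).im
  have iVp : ∀ i, Integrable (fun x => V x i * preJacobian A u x i) (volume.restrict A) := fun i =>
    (ip i).bdd_mul (c := M) (mV i).1
      (ae_restrict_of_forall_mem hA.measurableSet fun x hx => hVM x hx i)
  set fJ : Plane → ℝ := fun x => (1 / 2) * ∑ i, ‖weakGrad A u x i‖ ^ 2
    + (1 / (4 * ε ^ 2)) * (‖u x‖ ^ 2 - 1) ^ 2 - Ω * ∑ i, V x i * preJacobian A u x i with hfJ
  have iJ : Integrable fJ (volume.restrict A) :=
    (((integrable_finsetSum _ fun i _ => ig i).const_mul _).add (ia2.const_mul _)).sub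
      ((integrable_finsetSum _ fun i _ => iVp i).const_mul _)
  set h : Plane → ℝ := fun x => (1 / 2) * ∑ i, preJacobian A z x i ^ 2
    - Ω * ∑ i, V x i * preJacobian A z x i with hh
  have ih : Integrable h (volume.restrict A) :=
    ((integrable_finsetSum _ fun i _ => (mj i).integrable_sq).const_mul _).sub
      ((integrable_finsetSum _ fun i _ => (mV i).integrable_mul_two (mj i)).const_mul _)
  have hhb : ∀ᵐ x ∂(volume.restrict A), ‖h x‖ ≤ C₂ * Ω ^ 2 := by
    filter_upwards [eventually_all.2 hjb, ae_restrict_mem hA.measurableSet] with x h1 hx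
    have hsq : ∀ i, preJacobian A z x i ^ 2 ≤ (C₁ * Ω) ^ 2 := fun i => by
      rw [← sq_abs]; exact pow_le_pow_left₀ (abs_nonneg _) (h1 i) 2
    have hVj : ∀ i, |V x i * preJacobian A z x i| ≤ M * (C₁ * Ω) := fun i => by
      rw [abs_mul]
      exact mul_le_mul (hVM x hx i) (h1 i) (abs_nonneg _) hM.le
    have a0 := abs_le.1 (hVj 0)
    have a1 := abs_le.1 (hVj 1)
    have s : |V x 0 * preJacobian A z x 0 + V x 1 * preJacobian A z x 1| ≤ 2 * (M * (C₁ * Ω)) :=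
      abs_le.2 ⟨by linarith, by linarith⟩
    simp only [hh, Fin.sum_univ_two, Real.norm_eq_abs]
    refine (abs_sub _ _).trans ?_
    rw [abs_mul Ω, abs_of_pos hΩ, abs_of_nonneg (by positivity :
      0 ≤ 1 / 2 * (preJacobian A z x 0 ^ 2 + preJacobian A z x 1 ^ 2))]
    have := mul_le_mul_of_nonneg_left s hΩ.le
    have h0 := hsq 0
    have h1 := hsq 1
    rw [hC₂]
    nlinarith
  have iah : Integrable (fun x => h x * (‖u x‖ ^ 2 - 1)) (volume.restrict A) :=
    ia.bdd_mul (c := C₂ * Ω ^ 2) ih.1 hhb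
  set P : ℝ := ∫ x in A, (1 / (4 * ε ^ 2)) * (‖u x‖ ^ 2 - 1) ^ 2 with hP
  have hP0 : 0 ≤ P := integral_nonneg fun x => by positivity
  -- Young's inequality, weighted so that multiplication by `Ω²` produces `ε Ω³` and `ε Ω P`.
  have hyoung : ∀ x, |‖u x‖ ^ 2 - 1| ≤ (ε * Ω / 2) * 1
      + (2 * ε / Ω) * ((1 / (4 * ε ^ 2)) * (‖u x‖ ^ 2 - 1) ^ 2) := fun x => by
    have h3 : 0 ≤ 1 / (2 * (ε * Ω)) * (ε * Ω - |‖u x‖ ^ 2 - 1|) ^ 2 := by positivity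
    have h4 : 1 / (2 * (ε * Ω)) * (ε * Ω - |‖u x‖ ^ 2 - 1|) ^ 2 = (ε * Ω / 2) * 1
      + (2 * ε / Ω) * ((1 / (4 * ε ^ 2)) * (‖u x‖ ^ 2 - 1) ^ 2) - |‖u x‖ ^ 2 - 1| := by
      rw [← sq_abs (‖u x‖ ^ 2 - 1)]; field_simp; ring
    linarith
  have hL1 : ∫ x in A, |‖u x‖ ^ 2 - 1| ≤ (ε * Ω / 2) * vol + (2 * ε / Ω) * P := by
    have := integral_mono ia.abs ((i1.const_mul (ε * Ω / 2)).add
      ((ia2.const_mul (1 / (4 * ε ^ 2))).const_mul (2 * ε / Ω))) hyoung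
    simp only [Pi.add_apply] at this
    rwa [integral_add (i1.const_mul _) ((ia2.const_mul _).const_mul _), integral_const_mul,
      integral_const_mul (2 * ε / Ω)] at this
  have hmin : minH A V Ω = ∫ x in A, h x := by
    rw [← circleMaps.energyH_eq hA V Ω hz.1]
    exact IsLeast.csInf_eq ⟨⟨z, hz.1, rfl⟩, by rintro _ ⟨w, hw, rfl⟩; exact hz.2 w hw⟩
  -- Because `∇^⊥Φ = j - Ω V`, the products of the two pre-Jacobians cancel, and the terms quadratic
  -- in `|u|` collect to `-h |u|²`.
  have hred : reducedEnergy A Φ ε v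
      = ∫ x in A, (fJ x - (h x + h x * (‖u x‖ ^ 2 - 1))) := by
    refine integral_congr_ae ?_
    filter_upwards [eventually_all.2 hj, eventually_all.2 hgv, hz.1.2] with x h1 h2 h3
    have hnv : ‖v x‖ = ‖u x‖ := by
      rw [hvdef, norm_mul, RCLike.norm_conj, h3, one_mul]
    have hk := fun i => norm_sq_and_im_of_phase h3 (u x) (weakGrad A u x i) (preJacobian A z x i)
    have hw : ∀ i, ‖weakGrad A v x i‖ ^ 2 = ‖weakGrad A u x i‖ ^ 2
        - 2 * preJacobian A z x i * preJacobian A u x i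
        + preJacobian A z x i ^ 2 * ‖u x‖ ^ 2 := fun i => by
      rw [h2 i]; exact (hk i).1
    have hpv : ∀ i, preJacobian A v x i
        = preJacobian A u x i - preJacobian A z x i * ‖u x‖ ^ 2 := fun i => by
      rw [preJacobian, h2 i]; exact (hk i).2
    have hr : ∀ i, rot (weakGrad A Φ x) i = preJacobian A z x i - Ω * V x i := fun i => by
      linarith [h1 i]
    simp only [hw, hpv, hr, hnv, hfJ, hh, Fin.sum_univ_two]
    ring
  have hsum : Integrable (fun x => h x + h x * (‖u x‖ ^ 2 - 1)) (volume.restrict A) := ih.add iah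
  rw [integral_sub iJ hsum, integral_add ih iah, ← hmin] at hred
  have hJ : energyJ A V ε Ω u = ∫ x in A, fJ x := rfl
  have hbound : ∀ K : ℝ, 0 ≤ K → K * Ω ^ 2 * ((ε * Ω / 2) * vol + (2 * ε / Ω) * P)
      ≤ 2 * K * (1 + vol) * (ε * Ω ^ 3 + ε * Ω * P) := by
    intro K hK
    have e : K * Ω ^ 2 * ((ε * Ω / 2) * vol + (2 * ε / Ω) * P)
        = K * (vol / 2 * (ε * Ω ^ 3) + 2 * (ε * Ω * P)) := by field_simp
    rw [e]
    have p1 : 0 ≤ ε * Ω ^ 3 := by positivity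
    have p2 : 0 ≤ ε * Ω * P := by positivity
    have : vol / 2 * (ε * Ω ^ 3) + 2 * (ε * Ω * P)
        ≤ 2 * (1 + vol) * (ε * Ω ^ 3 + ε * Ω * P) := by nlinarith [mul_nonneg hvol0 p1, mul_nonneg hvol0 p2]
    calc _ ≤ K * (2 * (1 + vol) * (ε * Ω ^ 3 + ε * Ω * P)) := mul_le_mul_of_nonneg_left this hK
      _ = _ := by ring
  refine ⟨∫ x in A, h x * (‖u x‖ ^ 2 - 1), P, hP0, by rw [hred, hJ]; ring, ?_, ?_, ?_⟩
  · have hdom : |∫ x in A, h x * (‖u x‖ ^ 2 - 1)|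
        ≤ ∫ x in A, C₂ * Ω ^ 2 * |‖u x‖ ^ 2 - 1| := by
      rw [← Real.norm_eq_abs]
      refine norm_integral_le_of_norm_le (ia.abs.const_mul _) ?_
      filter_upwards [hhb] with x hx
      rw [norm_mul, Real.norm_eq_abs (‖u x‖ ^ 2 - 1)]
      exact mul_le_mul_of_nonneg_right hx (abs_nonneg _)
    rw [integral_const_mul] at hdom
    refine (hdom.trans (mul_le_mul_of_nonneg_left hL1 (by positivity))).trans
      ((hbound C₂ hC₂0.le).trans ?_)
    have : 0 ≤ ε * Ω ^ 3 + ε * Ω * P := by positivity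
    exact mul_le_mul_of_nonneg_right hQ1 this
  -- The gradient term absorbs the rotation term up to `-M² Ω² |u|²`, and `|u|² ≤ 1 + ||u|² - 1|` is
  -- controlled by the potential.
  · have hlow : ∫ x in A, ((1 / (4 * ε ^ 2)) * (‖u x‖ ^ 2 - 1) ^ 2
        - M ^ 2 * Ω ^ 2 * (1 + |‖u x‖ ^ 2 - 1|)) ≤ ∫ x in A, fJ x := by
      refine integral_mono_ae ((ia2.const_mul _).sub ((i1.add ia.abs).const_mul _)) iJ ?_
      filter_upwards [ae_restrict_mem hA.measurableSet] with x hx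
      have hp : ∀ i, |Ω * (V x i * preJacobian A u x i)|
          ≤ 1 / 2 * ‖weakGrad A u x i‖ ^ 2 + 1 / 2 * (M ^ 2 * Ω ^ 2 * ‖u x‖ ^ 2) := by
        intro i
        have h1 : |preJacobian A u x i| ≤ ‖u x‖ * ‖weakGrad A u x i‖ := by
          refine (Complex.abs_im_le_norm _).trans ?_
          rw [norm_mul, RCLike.norm_conj]
        have h2 : |Ω * (V x i * preJacobian A u x i)| ≤ Ω * (M * (‖u x‖ * ‖weakGrad A u x i‖)) := by
          rw [abs_mul, abs_mul, abs_of_pos hΩ]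
          exact mul_le_mul_of_nonneg_left (mul_le_mul (hVM x hx i) h1 (abs_nonneg _) hM.le) hΩ.le
        refine h2.trans ?_
        nlinarith [sq_nonneg (‖weakGrad A u x i‖ - M * Ω * ‖u x‖)]
      have h0 := (abs_le.1 (hp 0)).2
      have h1 := (abs_le.1 (hp 1)).2
      have h2 : M ^ 2 * Ω ^ 2 * ‖u x‖ ^ 2 ≤ M ^ 2 * Ω ^ 2 * (1 + |‖u x‖ ^ 2 - 1|) :=
        mul_le_mul_of_nonneg_left (by linarith [le_abs_self (‖u x‖ ^ 2 - 1)]) (by positivity)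
      simp only [hfJ, Fin.sum_univ_two]
      linarith
    have i1a : Integrable (fun x => 1 + |‖u x‖ ^ 2 - 1|) (volume.restrict A) := i1.add ia.abs
    rw [integral_sub (ia2.const_mul _) (i1a.const_mul _), integral_const_mul (M ^ 2 * Ω ^ 2),
      integral_add i1 ia.abs] at hlow
    rw [hJ]
    have h3 := mul_le_mul_of_nonneg_left hL1 (by positivity : 0 ≤ M ^ 2 * Ω ^ 2)
    have h4 := h3.trans (hbound (M ^ 2) (sq_nonneg M))
    have r1 := mul_le_mul_of_nonneg_right hQ2 (by positivity : 0 ≤ ε * Ω ^ 3 + ε * Ω * P)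
    have r2 := mul_le_mul_of_nonneg_right hQ3 (sq_nonneg Ω)
    linarith
  · rw [hmin, ← Real.norm_eq_abs]
    have hdom : ‖∫ x in A, h x‖ ≤ ∫ x in A, C₂ * Ω ^ 2 * (1 : ℝ) :=
      norm_integral_le_of_norm_le (i1.const_mul _) (hhb.mono fun x hx => by rwa [mul_one])
    rw [integral_const_mul] at hdom
    refine hdom.trans ?_
    have := mul_le_mul_of_nonneg_right hQ4 (sq_nonneg Ω)
    linarith

end

noncomputable section

/-! ### Asymptotics -/

/-- Here `τ = ε Ω` and `W = Ω²`. Coercivity gives `¾ P ≤ J + 2 C W`, and an upper bound on either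
energy gives `J ≤ (|K| + 2 C) W + P / 4`, so `P` can be absorbed. -/
lemma potential_le_of_upper_bound {C τ W P J I H E K : ℝ} (hC : 0 < C)
    (hτ1 : τ ≤ 1) (hτC : C * τ ≤ 1 / 4) (hW : 0 ≤ W) (hP : 0 ≤ P) (hJ : J = H + I + E)
    (hE : |E| ≤ C * (τ * W + τ * P)) (hlow : P * (1 - C * τ) - C * W * (1 + τ) ≤ J)
    (hH : |H| ≤ C * W) (h : J ≤ K * W ∨ I ≤ K * W) : P ≤ (8 * C + 2 * |K|) * W := by
  have hK : K * W ≤ |K| * W := mul_le_mul_of_nonneg_right (le_abs_self K) hW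
  have hKW : 0 ≤ |K| * W := by positivity
  have hCW : 0 ≤ C * W := by positivity
  have h1 : P * (C * τ) ≤ P * (1 / 4) := mul_le_mul_of_nonneg_left hτC hP
  have h2 : C * W * τ ≤ C * W * 1 := mul_le_mul_of_nonneg_left hτ1 hCW
  have h3 : J ≤ |K| * W + 2 * (C * W) + P / 4 := by
    rcases h with h | h
    · linarith
    · have := (abs_le.1 hE).2
      have := (abs_le.1 hH).2
      linarith
  linarith

lemma eventually_potential_le {C : ℝ} (hC : 0 < C) {ε Ω J I H E P : ℕ → ℝ}
    (hε : ∀ n, 0 < ε n) (hΩ : ∀ n, 0 < Ω n) (hP : ∀ n, 0 ≤ P n)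
    (hJ : ∀ n, J n = H n + I n + E n)
    (hE : ∀ n, |E n| ≤ C * (ε n * Ω n ^ 3 + ε n * Ω n * P n))
    (hlow : ∀ n, P n * (1 - C * (ε n * Ω n)) - C * Ω n ^ 2 * (1 + ε n * Ω n) ≤ J n)
    (hH : ∀ n, |H n| ≤ C * Ω n ^ 2) (h1 : Tendsto (fun n => ε n * Ω n) atTop (𝓝 0))
    {K : ℝ} (h : (∀ n, J n ≤ K * Ω n ^ 2) ∨ ∀ n, I n ≤ K * Ω n ^ 2) :
    ∃ K', ∀ᶠ n in atTop, |E n| ≤ K' * (ε n * Ω n ^ 3) ∧ ε n * Ω n ≤ 1 := by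
  refine ⟨C * (1 + (8 * C + 2 * |K|)), ?_⟩
  filter_upwards [h1.eventually (gt_mem_nhds one_pos),
    h1.eventually (gt_mem_nhds (by positivity : 0 < 1 / (4 * C)))] with n hn1 hn2
  have hτ : 0 < ε n * Ω n := mul_pos (hε n) (hΩ n)
  have hCτ : C * (ε n * Ω n) ≤ 1 / 4 :=
    (mul_le_mul_of_nonneg_left hn2.le hC.le).trans (le_of_eq (by field_simp))
  have hPn := potential_le_of_upper_bound hC hn1.le hCτ (sq_nonneg (Ω n)) (hP n) (hJ n)
    (by rw [show ε n * Ω n * Ω n ^ 2 = ε n * Ω n ^ 3 by ring]; exact hE n) (hlow n) (hH n)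
    (h.imp (fun h => h n) fun h => h n)
  refine ⟨(hE n).trans ?_, hn1.le⟩
  have := mul_le_mul_of_nonneg_left hPn hτ.le
  calc _ ≤ C * (ε n * Ω n ^ 3 + ε n * Ω n * ((8 * C + 2 * |K|) * Ω n ^ 2)) := by
        refine mul_le_mul_of_nonneg_left ?_ hC.le
        linarith
    _ = _ := by ring

lemma bddAbove_range_iff_mul_sq {Ω J : ℕ → ℝ} (hΩ : ∀ n, 0 < Ω n) :
    BddAbove (range fun n => (Ω n ^ 2)⁻¹ * J n) ↔ ∃ K, ∀ n, J n ≤ K * Ω n ^ 2 := by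
  simp only [BddAbove, Set.Nonempty, mem_upperBounds, forall_mem_range]
  refine exists_congr fun K => forall_congr' fun n => ?_
  rw [inv_mul_le_iff₀ (pow_pos (hΩ n) 2), mul_comm]

/-- Finitely many exceptional indices do not affect boundedness of a sequence. -/
lemma bddAbove_range_of_eventually {Ω J : ℕ → ℝ} (hΩ : ∀ n, 0 < Ω n) {K : ℝ}
    (h : ∀ᶠ n in atTop, J n ≤ K * Ω n ^ 2) :
    BddAbove (range fun n => (Ω n ^ 2)⁻¹ * J n) := by
  refine IsBoundedUnder.bddAbove_range (isBoundedUnder_of_eventually_le (a := K) ?_)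
  filter_upwards [h] with n hn
  rw [inv_mul_le_iff₀ (pow_pos (hΩ n) 2), mul_comm]
  exact hn

lemma bddAbove_iff_and_tendsto {C : ℝ} (hC : 0 < C) {ε Ω J I H E P : ℕ → ℝ}
    (hε : ∀ n, 0 < ε n) (hΩ : ∀ n, 0 < Ω n) (hP : ∀ n, 0 ≤ P n)
    (hJ : ∀ n, J n = H n + I n + E n)
    (hE : ∀ n, |E n| ≤ C * (ε n * Ω n ^ 3 + ε n * Ω n * P n))
    (hlow : ∀ n, P n * (1 - C * (ε n * Ω n)) - C * Ω n ^ 2 * (1 + ε n * Ω n) ≤ J n)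
    (hH : ∀ n, |H n| ≤ C * Ω n ^ 2) (h1 : Tendsto (fun n => ε n * Ω n) atTop (𝓝 0))
    (h3 : Tendsto (fun n => ε n * Ω n ^ 3) atTop (𝓝 0)) :
    (BddAbove (range fun n => (Ω n ^ 2)⁻¹ * J n) ↔ BddAbove (range fun n => (Ω n ^ 2)⁻¹ * I n)) ∧
    ((BddAbove (range fun n => (Ω n ^ 2)⁻¹ * J n) ∨ BddAbove (range fun n => (Ω n ^ 2)⁻¹ * I n)) →
      Tendsto E atTop (𝓝 0)) := by
  have hmain : ∀ K, ((∀ n, J n ≤ K * Ω n ^ 2) ∨ ∀ n, I n ≤ K * Ω n ^ 2) →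
      ∃ K', ∀ᶠ n in atTop, |E n| ≤ K' * (ε n * Ω n ^ 3) ∧ ε n * Ω n ≤ 1 := fun K h =>
    eventually_potential_le hC hε hΩ hP hJ hE hlow hH h1 h
  -- `ε Ω ≤ 1` gives `ε Ω³ ≤ Ω²`, so the remainder does not affect bounds at the scale `Ω²`.
  have hE2 : ∀ {K'} n, |E n| ≤ K' * (ε n * Ω n ^ 3) → ε n * Ω n ≤ 1 → |E n| ≤ |K'| * Ω n ^ 2 := by
    intro K' n h h'
    have hpos : 0 < ε n * Ω n ^ 3 := mul_pos (hε n) (pow_pos (hΩ n) 3)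
    have h4 : ε n * Ω n ^ 3 ≤ Ω n ^ 2 := by
      have := mul_le_mul_of_nonneg_right h' (sq_nonneg (Ω n))
      linarith
    exact (h.trans (mul_le_mul_of_nonneg_right (le_abs_self K') hpos.le)).trans
      (mul_le_mul_of_nonneg_left h4 (abs_nonneg K'))
  refine ⟨⟨fun h => ?_, fun h => ?_⟩, fun h => ?_⟩
  · obtain ⟨K, hK⟩ := (bddAbove_range_iff_mul_sq hΩ).1 h
    obtain ⟨K', hK'⟩ := hmain K (Or.inl hK)
    refine bddAbove_range_of_eventually hΩ (K := K + C + |K'|) ?_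
    filter_upwards [hK'] with n hn
    have := (abs_le.1 (hE2 n hn.1 hn.2)).1
    have := (abs_le.1 (hH n)).1
    linarith [hK n, hJ n]
  · obtain ⟨K, hK⟩ := (bddAbove_range_iff_mul_sq hΩ).1 h
    obtain ⟨K', hK'⟩ := hmain K (Or.inr hK)
    refine bddAbove_range_of_eventually hΩ (K := K + C + |K'|) ?_
    filter_upwards [hK'] with n hn
    have := (abs_le.1 (hE2 n hn.1 hn.2)).2
    have := (abs_le.1 (hH n)).2
    linarith [hK n, hJ n]
  · obtain ⟨K', hK'⟩ : ∃ K', ∀ᶠ n in atTop, |E n| ≤ K' * (ε n * Ω n ^ 3) ∧ ε n * Ω n ≤ 1 := by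
      rcases h with h | h
      · obtain ⟨K, hK⟩ := (bddAbove_range_iff_mul_sq hΩ).1 h
        exact hmain K (Or.inl hK)
      · obtain ⟨K, hK⟩ := (bddAbove_range_iff_mul_sq hΩ).1 h
        exact hmain K (Or.inr hK)
    have h0 : Tendsto (fun n => K' * (ε n * Ω n ^ 3)) atTop (𝓝 0) := by
      simpa using h3.const_mul K'
    exact squeeze_zero_norm' (hK'.mono fun n hn => hn.1) h0

/-- The expression is the `k`-th power of `t^{1/k} |ln t|`. -/
lemma tendsto_mul_abs_log_pow {k : ℕ} (hk : k ≠ 0) :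
    Tendsto (fun t : ℝ => t * |Real.log t| ^ k) (𝓝[>] 0) (𝓝 0) := by
  have h := ((tendsto_log_mul_rpow_nhdsGT_zero (r := (k : ℝ)⁻¹) (by positivity)).abs).pow k
  rw [abs_zero, zero_pow hk] at h
  refine h.congr' ?_
  filter_upwards [self_mem_nhdsWithin] with t ht
  have ht : 0 < t := ht
  rw [abs_mul, mul_pow, abs_of_pos (Real.rpow_pos_of_pos ht _), Real.rpow_inv_natCast_pow ht.le hk,
    mul_comm]

/-- For small `t` one has `ω t ≤ |ln t|`, so the angular speed is `O(|ln t|)`, whose powers are all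
beaten by `t`. -/
lemma tendsto_mul_angularSpeed_pow {ζmax : ℝ} (hζ : 0 < ζmax) {ω : ℝ → ℝ}
    (hωpos : ∀ t : ℝ, 0 < t → 0 < ω t)
    (hωlog : Tendsto (fun t => ω t / |Real.log t|) (𝓝[>] 0) (𝓝 0)) {k : ℕ} (hk : k ≠ 0) :
    Tendsto (fun t => t * angularSpeed ζmax ω t ^ k) (𝓝[>] 0) (𝓝 0) := by
  have h0 : Tendsto (fun t : ℝ => (1 / (2 * ζmax) + 1) ^ k * (t * |Real.log t| ^ k))
      (𝓝[>] 0) (𝓝 0) := by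
    simpa using (tendsto_mul_abs_log_pow hk).const_mul ((1 / (2 * ζmax) + 1) ^ k)
  refine squeeze_zero' ?_ ?_ h0
  · filter_upwards [self_mem_nhdsWithin] with t ht
    have ht : 0 < t := ht
    have := hωpos t ht
    rw [angularSpeed]
    positivity
  · filter_upwards [self_mem_nhdsWithin, hωlog.eventually (gt_mem_nhds one_pos),
      Ioo_mem_nhdsGT one_pos] with t ht h1 ht1
    have ht : 0 < t := ht
    have hlog : 0 < |Real.log t| := abs_pos.2 (Real.log_neg ht ht1.2).ne
    have hω : ω t ≤ |Real.log t| := by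
      rw [div_lt_one hlog] at h1; exact h1.le
    have hω0 := hωpos t ht
    have hle : angularSpeed ζmax ω t ≤ (1 / (2 * ζmax) + 1) * |Real.log t| := by
      rw [angularSpeed, add_mul, one_mul, div_mul_eq_mul_div, one_mul]
      linarith
    have hnn : 0 ≤ angularSpeed ζmax ω t := by rw [angularSpeed]; positivity
    calc _ ≤ t * ((1 / (2 * ζmax) + 1) * |Real.log t|) ^ k :=
          mul_le_mul_of_nonneg_left (pow_le_pow_left₀ hnn hle k) ht.le
      _ = _ := by rw [mul_pow]; ring

end

/-! ### The energy decomposition along a sequence. -/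

theorem proposition5p5 (D B : Set Plane) (hDB : IsAnnularPair D B)
    (V : Plane → Plane) (hV : LocallyLipschitz V)
    (ζ : Plane → ℝ) (hζ : IsDirichletPotential D B V ζ)
    (ζmax : ℝ) (hζmax : IsGreatest (ζ '' closure (annulus D B)) ζmax) (hζpos : 0 < ζmax)
    (ω : ℝ → ℝ) (hωpos : ∀ t : ℝ, 0 < t → 0 < ω t) (hωtop : Tendsto ω (𝓝[>] 0) atTop)
    (hωlog : Tendsto (fun t => ω t / |Real.log t|) (𝓝[>] 0) (𝓝 0))
    (ε : ℕ → ℝ) (hεpos : ∀ n, 0 < ε n) (hε : Tendsto ε atTop (𝓝 0))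
    (Ω : ℕ → ℝ) (hΩ : ∀ n, Ω n = angularSpeed ζmax ω (ε n))
    (ustar : ℕ → Plane → ℂ)
    (hustar : ∀ n, IsVortexlessMinimizer (annulus D B) V (Ω n) (ustar n))
    (d : ℕ → ℤ) (hd : ∀ n, HasDegree D B (ustar n) (d n))
    (Φ : ℕ → Plane → ℝ) (hΦ : ∀ n, IsPhasePotential D B V (Ω n) (d n) (Φ n))
    (u : ℕ → Plane → ℂ) (hu : ∀ n, MemH1 (annulus D B) (u n))
    (v : ℕ → Plane → ℂ) (hv : ∀ n x, v n x = conj (ustar n x) * u n x) :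
    (∀ n, MemH1 (annulus D B) (v n)) ∧
    (BddAbove (range fun n => (Ω n ^ 2)⁻¹ * energyJ (annulus D B) V (ε n) (Ω n) (u n)) ↔
      BddAbove (range fun n => (Ω n ^ 2)⁻¹ * ω (ε n) ^ 2 *
        reducedF (annulus D B) (Φ n) (ε n) (ω (ε n)) (v n))) ∧
    ((BddAbove (range fun n => (Ω n ^ 2)⁻¹ * energyJ (annulus D B) V (ε n) (Ω n) (u n)) ∨
      BddAbove (range fun n => (Ω n ^ 2)⁻¹ * ω (ε n) ^ 2 *
        reducedF (annulus D B) (Φ n) (ε n) (ω (ε n)) (v n))) →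
      Tendsto (fun n => energyJ (annulus D B) V (ε n) (Ω n) (u n) -
        (minH (annulus D B) V (Ω n) + ω (ε n) ^ 2 *
          reducedF (annulus D B) (Φ n) (ε n) (ω (ε n)) (v n))) atTop (𝓝 0)) := by
  obtain ⟨C, hC, hdec⟩ := exists_energy_decomposition hDB hV
  have hωε : ∀ n, 0 < ω (ε n) := fun n => hωpos _ (hεpos n)
  have hΩpos : ∀ n, 0 < Ω n := fun n => by
    have := hωε n
    rw [hΩ n, angularSpeed]
    positivity
  have hv' : ∀ n, v n = fun x => conj (ustar n x) * u n x := fun n => funext (hv n)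
  have h := fun n => hdec (ε n) (Ω n) (d n) (ustar n) (Φ n) (u n) (hεpos n) (hΩpos n) (hustar n)
    (hd n) (hΦ n) (hu n)
  simp only [← hv'] at h
  choose hH1 E P hP hJ hE hlow hH using h
  have hred : ∀ n, ω (ε n) ^ 2 * reducedF (annulus D B) (Φ n) (ε n) (ω (ε n)) (v n)
      = reducedEnergy (annulus D B) (Φ n) (ε n) (v n) := fun n =>
    mul_inv_cancel_left₀ (pow_ne_zero 2 (hωε n).ne') _
  have hlim : Tendsto ε atTop (𝓝[>] 0) :=
    tendsto_nhdsWithin_iff.2 ⟨hε, Eventually.of_forall hεpos⟩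
  have hpow : ∀ k : ℕ, k ≠ 0 → Tendsto (fun n => ε n * Ω n ^ k) atTop (𝓝 0) := fun k hk => by
    simp only [hΩ]
    exact (tendsto_mul_angularSpeed_pow hζpos hωpos hωlog hk).comp hlim
  -- `ε Ω → 0` serves to absorb the potential energy, `ε Ω³ → 0` makes the remainder vanish.
  obtain ⟨hiff, htends⟩ := bddAbove_iff_and_tendsto hC hεpos hΩpos hP hJ hE hlow hH
    (by simpa using hpow 1 one_ne_zero) (hpow 3 three_ne_zero)
  simp only [mul_assoc, hred]
  refine ⟨hH1, hiff, fun h => (htends h).congr fun n => ?_⟩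
  rw [hJ n]; ring
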